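/- **Setting.** Let $N\ge 1$, $K\ge 2$, $B\ge 0$ be integers and $M=NK$. A base station with $M$ antennas serves $K$ users with $N$ antennas each. The channels $\mathbf H_1,\dots,\mathbf H_K\in\mathbb C^{M\times N}$ have i.i.d. circularly symmetric complex Gaussian entries of mean $0$ and variance $1$. User $k$ has a random vector quantization codebook $\mathbf C_{k,1},\dots,\mathbf C_{k,2^B}\in\mathbb C^{M\times N}$ of i.i.d. isotropically distributed semi-unitary matrices; the codebooks of different users and the channels are independent. For $\widetilde{\mathbf H}_k$ with orthonormal columns spanning the column space of $\mathbf H_k$ let $$d^2(\mathbf H_k,\mathbf C)=N-\operatorname{tr}\big(\widetilde{\mathbf H}_k^H\mathbf C\mathbf C^H\widetilde{\mathbf H}_k\big),$$ let $\widehat{\mathbf H}_k$ be the codeword $\mathbf C_{k,i}$ minimizing $d^2(\mathbf H_k,\mathbf C_{k,i})$ (ties, which have probability zero, are broken by the least index), and let $\gamma=\frac1N\,\mathbb E\big[\min_i d^2(\mathbf H_k,\mathbf C_{k,i})\big]$. For a total power $\rho>0$ (noise variance $1$) the precoders are $\mathbf P_k=\sqrt{\rho/M}\,\bar{\mathbf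 P}_k$, where the columns of $\bar{\mathbf P}_k$ are an orthonormal basis of * MMSE: the column space of $\big(\sum_j\mathbf G_j\mathbf G_j^H+\tfrac{M}{\rho}\mathbf I_M\big)^{-1}\mathbf G_k$, with $\mathbf G_j=\sqrt M\,\widehat{\mathbf H}_j$; * MRT: the column space of $\widehat{\mathbf H}_k$; * BD: the orthogonal complement of the column spaces of all $\widehat{\mathbf H}_j$, $j\ne k$. With $\mathbf X_k=\mathbf H_k^H\mathbf P_k\mathbf P_k^H\mathbf H_k$ and $\mathbf Y_k=\sum_{j\ne k}\mathbf H_k^H\mathbf P_j\mathbf P_j^H\mathbf H_k+\mathbf I_N$, the achievable rate of user $k$ is $R_k(\rho)=\mathbb E\big[\log_2|\mathbf I_N+\mathbf X_k\mathbf Y_k^{-1}|\big]$, and its log-det-of-expectations approximation is $\widetilde R_k(\rho)=\log_2\big|\mathbf I_N+\mathbb E[\mathbf X_k]\,\mathbb E[\mathbf Y_k]^{-1}\big|$. Superscripts name the precoder. Put $$R^{\rm low}(\rho)=N\log_2\Big(1+\frac{\rho K(1-\gamma)}{\rho K-\rho+K}\Big),\qquad R^{\rm high}(\rho)=N\log_2\Big(1+\frac{\rho}{K+\rho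 K\gamma}\Big).$$ **Theorem.** The number $\gamma$ is the same for all users, $0<\gamma<1$, and for every user $k$ the following hold. The random variable in the definition of $R_k^{\rm MMSE}(\rho)$ is integrable for every $\rho>0$. 1. (Low SNR.) As $\rho\to0^+$, $R_k^{\rm MMSE}(\rho)\sim R^{\rm low}(\rho)$, i.e. the ratio tends to $1$, and $\widetilde R_k^{\rm MMSE}(\rho)=R^{\rm low}(\rho)+o(\rho^2)$. Moreover $\widetilde R_k^{\rm MRT}(\rho)=R^{\rm low}(\rho)$ for every $\rho>0$. 2. (High SNR.) As $\rho\to\infty$, the achievable rates $R_k^{\rm MMSE}(\rho)$ and $R_k^{\rm BD}(\rho)$ converge to one and the same finite limit, and the log-det-of-expectations approximation satisfies $\widetilde R_k^{\rm MMSE}(\rho)-R^{\rm high}(\rho)\to0$. Moreover $\widetilde R_k^{\rm BD}(\rho)=R^{\rm high}(\rho)$ for every $\rho>0$. 3. (Saturation.) $\lim_{\rho\to\infty}R^{\rm high}(\rho)=N\log_2\big(1+\frac1{K\gamma}\big)$. -/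

import Mathlib

open MeasureTheory ProbabilityTheory Filter Topology Asymptotics Matrix

noncomputable section

namespace LimitedFeedback

/-- Matrices carry the product (entrywise Borel) sigma-algebra. -/
instance instMeasurableSpaceMatrix {m n : Type*} : MeasurableSpace (Matrix m n ℂ) :=
  inferInstanceAs (MeasurableSpace (m → n → ℂ))

/-- The circularly symmetric complex Gaussian law with mean `0` and variance `E|z|² = 1`:
real and imaginary part are independent real Gaussians of variance `1/2`. -/
def stdComplexGaussian : Measure ℂ :=
  ((gaussianReal 0 (1 / 2)).prod (gaussianReal 0 (1 / 2))).map Complex.measurableEquivRealProd.symm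

/-- The orthogonal projector `A (Aᴴ A)⁻¹ Aᴴ` onto the column space of a matrix of full column rank.
It equals `W Wᴴ` for every matrix `W` whose columns are an orthonormal basis of that space. -/
def colProj {m n : Type*} [Fintype m] [Fintype n] [DecidableEq n] (A : Matrix m n ℂ) :
    Matrix m m ℂ :=
  A * (Aᴴ * A)⁻¹ * Aᴴ

theorem colProj_eq_of_orthonormal {m n : Type*} [Fintype m] [Fintype n] [DecidableEq n]
    (W : Matrix m n ℂ) (T : Matrix n n ℂ) (hW : Wᴴ * W = 1) (hT : IsUnit T.det) :
    colProj (W * T) = W * Wᴴ := by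
  have hT' : IsUnit (Tᴴ).det := by
    rw [Matrix.det_conjTranspose]; exact hT.star
  have h : (W * T)ᴴ * (W * T) = Tᴴ * T := by
    rw [Matrix.conjTranspose_mul, Matrix.mul_assoc, ← Matrix.mul_assoc Wᴴ, hW, Matrix.one_mul]
  rw [colProj, h, Matrix.mul_inv_rev, Matrix.conjTranspose_mul]
  calc W * T * (T⁻¹ * (Tᴴ)⁻¹) * (Tᴴ * Wᴴ)
      = W * (T * T⁻¹) * ((Tᴴ)⁻¹ * Tᴴ) * Wᴴ := by simp only [Matrix.mul_assoc]
    _ = W * Wᴴ := by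
      rw [Matrix.mul_nonsing_inv _ hT, Matrix.nonsing_inv_mul _ hT', Matrix.mul_one, Matrix.mul_one]

/-- Squared chordal distance `N - tr(H̃ᴴ C Cᴴ H̃)` between the column space of `H` (with orthonormal
basis `H̃`, so that `H̃ H̃ᴴ = colProj H`) and that of a codeword `C`. -/
def chordalSq {M N : ℕ} (H C : Matrix (Fin M) (Fin N) ℂ) : ℝ :=
  (N : ℝ) - (colProj H * (C * Cᴴ)).trace.re

theorem exists_isMin {n : ℕ} [NeZero n] (f : Fin n → ℝ) :
    (Finset.univ.filter fun i : Fin n => ∀ j, f i ≤ f j).Nonempty := by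
  obtain ⟨i, hi⟩ := Finite.exists_min f
  exact ⟨i, by simpa using hi⟩

/-- An index at which `f` is minimal (the least one in case of a tie). -/
def argminIdx {n : ℕ} [NeZero n] (f : Fin n → ℝ) : Fin n :=
  (Finset.univ.filter fun i : Fin n => ∀ j, f i ≤ f j).min' (exists_isMin f)

section Model

variable {Ω : Type*} [MeasurableSpace Ω] {N K B : ℕ}

/-- `K` users with `N` antennas each, a base station with `M = N K` antennas.
`H k` is the channel of user `k` and `C k 0, …, C k (2 ^ B - 1)` is its codebook.
Channel entries are i.i.d. standard complex Gaussian; the codewords are semi-unitary, i.i.d. and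
isotropically distributed (random vector quantization); all of these are jointly independent. -/
structure IsRVQSystem (P : Measure Ω)
    (H : Fin K → Ω → Matrix (Fin (N * K)) (Fin N) ℂ)
    (C : Fin K → Fin (2 ^ B) → Ω → Matrix (Fin (N * K)) (Fin N) ℂ) : Prop where
  measurable_channel : ∀ k, Measurable (H k)
  measurable_codeword : ∀ k i, Measurable (C k i)
  channel_entry_law : ∀ k a b, P.map (fun ω => H k ω a b) = stdComplexGaussian
  channel_entries_indep : ∀ k,
    iIndepFun (fun (p : Fin (N * K) × Fin N) ω => H k ω p.1 p.2) P
  codeword_semiunitary : ∀ k i ω, (C k i ω)ᴴ * C k i ω = 1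
  codeword_isotropic : ∀ k i, ∀ U ∈ Matrix.unitaryGroup (Fin (N * K)) ℂ,
    P.map (fun ω => U * C k i ω) = P.map (C k i)
  codeword_identDistrib : ∀ k i k' i', P.map (C k i) = P.map (C k' i')
  indep : iIndepFun (Sum.elim H fun p : Fin K × Fin (2 ^ B) => C p.1 p.2) P

/-- The quantized channel direction of user `k`: the codeword of user `k` at minimal chordal
distance from its channel. -/
def quantized (H : Fin K → Ω → Matrix (Fin (N * K)) (Fin N) ℂ)
    (C : Fin K → Fin (2 ^ B) → Ω → Matrix (Fin (N * K)) (Fin N) ℂ) (k : Fin K) (ω : Ω) :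
    Matrix (Fin (N * K)) (Fin N) ℂ :=
  C k (argminIdx fun i => chordalSq (H k ω) (C k i ω)) ω

/-- The quantization distortion per column, `γ = ξ / N` with `ξ = E[min_i d²(H_k, C_{k,i})]`. -/
def distortion (P : Measure Ω) (H : Fin K → Ω → Matrix (Fin (N * K)) (Fin N) ℂ)
    (C : Fin K → Fin (2 ^ B) → Ω → Matrix (Fin (N * K)) (Fin N) ℂ) (k : Fin K) : ℝ :=
  (∫ ω, ⨅ i, chordalSq (H k ω) (C k i ω) ∂P) / N

/-! ### Precoders

The precoding matrix of user `k` is `P_k = √(ρ / M) P̄_k`, where `P̄_k` has orthonormal columns.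
All rates depend on `P̄_k` only through the projector `P̄_k P̄_kᴴ`, and a precoder is given here by
these projectors, as functions of the power `ρ`, of the user and of the quantized channels
`Ĥ = [Ĥ_1, …, Ĥ_K]`. -/

/-- A block of the unnormalized MMSE precoder, `(G Gᴴ + (M / ρ) I)⁻¹ G_k` (noise variance `1`),
computed from the channel knowledge `G_j = √M Ĥ_j` of the base station. -/
def mmseBlock (ρ : ℝ) (Hq : Fin K → Matrix (Fin (N * K)) (Fin N) ℂ) (k : Fin K) :
    Matrix (Fin (N * K)) (Fin N) ℂ :=
  let G : Fin K → Matrix (Fin (N * K)) (Fin N) ℂ :=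
    fun j => ((Real.sqrt ((N * K : ℕ) : ℝ) : ℝ) : ℂ) • Hq j
  ((∑ j, G j * (G j)ᴴ) +
    ((((N * K : ℕ) : ℝ) / ρ : ℝ) : ℂ) • (1 : Matrix (Fin (N * K)) (Fin (N * K)) ℂ))⁻¹ * G k

/-- MMSE precoding. -/
def mmse (ρ : ℝ) (Hq : Fin K → Matrix (Fin (N * K)) (Fin N) ℂ) (k : Fin K) :
    Matrix (Fin (N * K)) (Fin (N * K)) ℂ :=
  colProj (mmseBlock ρ Hq k)

/-- Maximum ratio transmission: `P̄_k` spans the column space of `Ĥ_k`. -/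
def mrt (_ρ : ℝ) (Hq : Fin K → Matrix (Fin (N * K)) (Fin N) ℂ) (k : Fin K) :
    Matrix (Fin (N * K)) (Fin (N * K)) ℂ :=
  colProj (Hq k)

/-- Block diagonalization: `P̄_k` spans the orthogonal complement of the column spaces of all
`Ĥ_j`, `j ≠ k`. -/
def bd (_ρ : ℝ) (Hq : Fin K → Matrix (Fin (N * K)) (Fin N) ℂ) (k : Fin K) :
    Matrix (Fin (N * K)) (Fin (N * K)) ℂ :=
  1 - colProj (Matrix.of fun a (p : {j : Fin K // j ≠ k} × Fin N) => Hq p.1 a p.2)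

/-! ### Rates -/

/-- `H_kᴴ P_j P_jᴴ H_k`: covariance of the signal for user `j` at the receiver of user `k`. -/
def rxCov (pre : ℝ → (Fin K → Matrix (Fin (N * K)) (Fin N) ℂ) → Fin K →
      Matrix (Fin (N * K)) (Fin (N * K)) ℂ)
    (H : Fin K → Ω → Matrix (Fin (N * K)) (Fin N) ℂ)
    (C : Fin K → Fin (2 ^ B) → Ω → Matrix (Fin (N * K)) (Fin N) ℂ)
    (ρ : ℝ) (k j : Fin K) (ω : Ω) : Matrix (Fin N) (Fin N) ℂ :=
  ((ρ / ((N * K : ℕ) : ℝ) : ℝ) : ℂ) •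
    ((H k ω)ᴴ * pre ρ (fun l => quantized H C l ω) j * H k ω)

/-- Interference plus noise covariance at user `k`. -/
def intCov (pre : ℝ → (Fin K → Matrix (Fin (N * K)) (Fin N) ℂ) → Fin K →
      Matrix (Fin (N * K)) (Fin (N * K)) ℂ)
    (H : Fin K → Ω → Matrix (Fin (N * K)) (Fin N) ℂ)
    (C : Fin K → Fin (2 ^ B) → Ω → Matrix (Fin (N * K)) (Fin N) ℂ)
    (ρ : ℝ) (k : Fin K) (ω : Ω) : Matrix (Fin N) (Fin N) ℂ :=
  (∑ j ∈ Finset.univ.erase k, rxCov pre H C ρ k j ω) + 1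

/-- `log₂ |I + X Y⁻¹|`. -/
def logDet (X Y : Matrix (Fin N) (Fin N) ℂ) : ℝ :=
  Real.logb 2 (1 + X * Y⁻¹).det.re

/-- The rate of user `k` for one realization of channels and codebooks, `log₂ |I + SINR_k|`. -/
def instRate (pre : ℝ → (Fin K → Matrix (Fin (N * K)) (Fin N) ℂ) → Fin K →
      Matrix (Fin (N * K)) (Fin (N * K)) ℂ)
    (H : Fin K → Ω → Matrix (Fin (N * K)) (Fin N) ℂ)
    (C : Fin K → Fin (2 ^ B) → Ω → Matrix (Fin (N * K)) (Fin N) ℂ)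
    (ρ : ℝ) (k : Fin K) (ω : Ω) : ℝ :=
  logDet (rxCov pre H C ρ k k ω) (intCov pre H C ρ k ω)

/-- The achievable rate `R_k = E[log₂ |I + SINR_k|]`. -/
def rate (P : Measure Ω)
    (pre : ℝ → (Fin K → Matrix (Fin (N * K)) (Fin N) ℂ) → Fin K →
      Matrix (Fin (N * K)) (Fin (N * K)) ℂ)
    (H : Fin K → Ω → Matrix (Fin (N * K)) (Fin N) ℂ)
    (C : Fin K → Fin (2 ^ B) → Ω → Matrix (Fin (N * K)) (Fin N) ℂ)
    (ρ : ℝ) (k : Fin K) : ℝ :=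
  ∫ ω, instRate pre H C ρ k ω ∂P

/-- Entrywise expectation of a random matrix. -/
def expMat (P : Measure Ω) (X : Ω → Matrix (Fin N) (Fin N) ℂ) : Matrix (Fin N) (Fin N) ℂ :=
  Matrix.of fun a b => ∫ ω, X ω a b ∂P

/-- The log-det of expectations `log₂ |I + E[X] E[Y]⁻¹|` that approximates the achievable rate
`E[log₂ |I + X Y⁻¹|]`. -/
def rateOfMeans (P : Measure Ω)
    (pre : ℝ → (Fin K → Matrix (Fin (N * K)) (Fin N) ℂ) → Fin K →
      Matrix (Fin (N * K)) (Fin (N * K)) ℂ)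
    (H : Fin K → Ω → Matrix (Fin (N * K)) (Fin N) ℂ)
    (C : Fin K → Fin (2 ^ B) → Ω → Matrix (Fin (N * K)) (Fin N) ℂ)
    (ρ : ℝ) (k : Fin K) : ℝ :=
  logDet (expMat P fun ω => rxCov pre H C ρ k k ω) (expMat P fun ω => intCov pre H C ρ k ω)

end Model

/-- `R^low = N log₂ (1 + ρ K (1 - γ) / (ρ K - ρ + K))`. -/
def rLow (N K : ℕ) (γ ρ : ℝ) : ℝ :=
  N * Real.logb 2 (1 + ρ * K * (1 - γ) / (ρ * K - ρ + K))

/-- `R^high = N log₂ (1 + ρ / (K + ρ K γ))`. -/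
def rHigh (N K : ℕ) (γ ρ : ℝ) : ℝ :=
  N * Real.logb 2 (1 + ρ / (K + ρ * K * γ))

end LimitedFeedback

end

/-! Everything depends on the channels and codewords through column spaces, and the joint law is
invariant under a common unitary acting on the left and under a unitary acting on one channel from
the right. The second invariance makes `E[X_k]` and `E[Y_k]` multiples of the identity
(`matExp_gain`), so the log-det of expectations is a function of the scalar mean gains `E tr(H_kᴴ
P̄_j P̄_jᴴ H_k) / N` alone (`rateOfMeans_eq`).

The mean gains of MRT and BD come from conditioning and a Schur-type argument
(`exists_matExp_mul_eq_smul`). Given `H_k`, the mean of `Ĥ_k Ĥ_kᴴ` acts on the column space of `H_k`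
as the scalar `1 - γ`. Given all data of user `k`, the BD projector of another user has mean `(1 -
Ĥ_k Ĥ_kᴴ) / (K - 1)`. Projectors independent of user `k` have mean `1 / K` times the identity. This
gives both closed forms exactly.

MMSE interpolates between the two: with `S = ∑ Ĥ_j Ĥ_jᴴ` its projector is that onto the columns of
`(1 + ρ S)⁻¹ Ĥ_k`, which tends to MRT as `ρ → 0` and to BD as `ρ → ∞`.

At low SNR the rate lies between two traces with the same first order term. For the `o(ρ²)` claim an
`O(ρ)` error in the interference costs only `O(ρ³)`, but the signal gain must be right to `o(ρ)`.
Its first order change is minus the mean of `tr(F b)`, where `F = S - Ĥ_k Ĥ_kᴴ` is independent of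
user `k` with scalar mean and `b` is a function of user `k` with trace zero; hence it vanishes
(`integral_trace_slope_zero`).

At high SNR the realized rates converge almost surely to a noiseless rate, and the means follow from
a second moment bound uniform in `ρ ≥ 1`. The logarithm is large only if the channel is large or the
determinant of one interference covariance is small. The latter is controlled by a bound on `E
|det(Vᴴ G)|⁻¹` for Gaussian `G`, uniform in semi-unitary `V` (`exists_lintegral_inv_det_le`): the
determinant is affine in each entry, so the entries of `G` can be replaced by those of `V` one at a
time. -/

namespace LimitedFeedback

open scoped ComplexOrder MatrixOrder

set_option linter.unusedSectionVars false

/-! ### Projectors, semi-unitary matrices and a Schur-type lemma. -/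

section Algebra

variable {m n r : Type*} [Fintype m] [Fintype n] [Fintype r]
  [DecidableEq m] [DecidableEq n] [DecidableEq r]

/-! ### Projectors onto column spaces -/

theorem colProj_conjTranspose (A : Matrix m n ℂ) : (colProj A)ᴴ = colProj A := by
  simp only [colProj, conjTranspose_mul, conjTranspose_nonsing_inv, conjTranspose_conjTranspose,
    Matrix.mul_assoc]

theorem colProj_mul_self (A : Matrix m n ℂ) : colProj A * colProj A = colProj A := by
  by_cases h : IsUnit (Aᴴ * A).det
  · calc colProj A * colProj A = A * ((Aᴴ * A)⁻¹ * (Aᴴ * A)) * (Aᴴ * A)⁻¹ * Aᴴ := by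
          simp only [colProj, Matrix.mul_assoc]
      _ = colProj A := by rw [nonsing_inv_mul _ h, Matrix.mul_one, colProj]
  -- A singular Gram matrix has inverse `0` by convention, so the projector is `0`; this is why no
  -- rank hypothesis is needed.
  · simp [colProj, nonsing_inv_apply_not_isUnit _ h]

theorem colProj_mul_of_isUnit (A : Matrix m n ℂ) {T : Matrix n n ℂ} (hT : IsUnit T.det) :
    colProj (A * T) = colProj A := by
  have hT' : IsUnit (Tᴴ).det := by rw [det_conjTranspose]; exact hT.star
  have h : (A * T)ᴴ * (A * T) = Tᴴ * ((Aᴴ * A) * T) := by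
    simp only [conjTranspose_mul, Matrix.mul_assoc]
  rw [colProj, h, Matrix.mul_inv_rev, Matrix.mul_inv_rev, conjTranspose_mul]
  calc A * T * (T⁻¹ * (Aᴴ * A)⁻¹ * (Tᴴ)⁻¹) * (Tᴴ * Aᴴ)
      = A * (T * T⁻¹) * (Aᴴ * A)⁻¹ * ((Tᴴ)⁻¹ * Tᴴ) * Aᴴ := by simp only [Matrix.mul_assoc]
    _ = colProj A := by
      rw [mul_nonsing_inv _ hT, nonsing_inv_mul _ hT', Matrix.mul_one, Matrix.mul_one, colProj]

theorem colProj_smul (A : Matrix m n ℂ) {c : ℂ} (hc : c ≠ 0) : colProj (c • A) = colProj A := by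
  have h : c • A = A * (c • (1 : Matrix n n ℂ)) := by simp
  rw [h, colProj_mul_of_isUnit]
  simp [hc]

theorem colProj_mul_cancel {A : Matrix m n ℂ} (hA : IsUnit (Aᴴ * A).det) : colProj A * A = A := by
  rw [colProj, Matrix.mul_assoc, Matrix.mul_assoc, nonsing_inv_mul _ hA, Matrix.mul_one]

theorem trace_colProj {A : Matrix m n ℂ} (hA : IsUnit (Aᴴ * A).det) :
    (colProj A).trace = Fintype.card n := by
  rw [colProj, Matrix.mul_assoc, trace_mul_comm, Matrix.mul_assoc, nonsing_inv_mul _ hA, trace_one]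

theorem colProj_of_orthonormal {V : Matrix m n ℂ} (hV : Vᴴ * V = 1) : colProj V = V * Vᴴ := by
  simp [colProj, hV]

theorem colProj_isometry_mul {U : Matrix m m ℂ} (hU : Uᴴ * U = 1) (A : Matrix m n ℂ) :
    colProj (U * A) = U * colProj A * Uᴴ := by
  have h : (U * A)ᴴ * (U * A) = Aᴴ * A := by
    rw [conjTranspose_mul, Matrix.mul_assoc, ← Matrix.mul_assoc Uᴴ, hU, Matrix.one_mul]
  rw [colProj, h, conjTranspose_mul, colProj]
  simp only [Matrix.mul_assoc]

/-- The full column rank criterion used throughout: a left inverse makes `A` injective, hence its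
Gram matrix positive definite. -/
theorem isUnit_det_gram_of_leftInverse {A : Matrix m n ℂ} {L : Matrix n m ℂ} (h : L * A = 1) :
    IsUnit (Aᴴ * A).det := by
  have hinj : Function.Injective A.mulVec := by
    intro x y hxy
    have := congrArg (L *ᵥ ·) hxy
    simpa [mulVec_mulVec, h] using this
  exact (PosDef.conjTranspose_mul_self A hinj).isUnit.map detMonoidHom

theorem _root_.Matrix.PosSemidef.exists_eq_conjTranspose_mul_self {A : Matrix n n ℂ}
    (hA : A.PosSemidef) : ∃ T : Matrix n n ℂ, A = Tᴴ * T :=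
  CStarAlgebra.nonneg_iff_eq_star_mul_self.1 hA.nonneg

theorem exists_orthonormal_factor {A : Matrix m n ℂ} (hA : IsUnit (Aᴴ * A).det) :
    ∃ (V : Matrix m n ℂ) (T : Matrix n n ℂ), Vᴴ * V = 1 ∧ IsUnit T.det ∧ A = V * T := by
  obtain ⟨T, hT⟩ := (posSemidef_conjTranspose_mul_self A).exists_eq_conjTranspose_mul_self
  have hTu : IsUnit T.det := by
    rw [hT, det_mul] at hA
    exact isUnit_of_mul_isUnit_right hA
  have hTu' : IsUnit (Tᴴ).det := by rw [det_conjTranspose]; exact hTu.star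
  refine ⟨A * T⁻¹, T, ?_, hTu, ?_⟩
  · rw [conjTranspose_mul, Matrix.mul_assoc, ← Matrix.mul_assoc Aᴴ, hT, conjTranspose_nonsing_inv]
    calc (Tᴴ)⁻¹ * (Tᴴ * T * T⁻¹) = ((Tᴴ)⁻¹ * Tᴴ) * (T * T⁻¹) := by simp only [Matrix.mul_assoc]
      _ = 1 := by rw [nonsing_inv_mul _ hTu', mul_nonsing_inv _ hTu, Matrix.one_mul]
  · rw [Matrix.mul_assoc, nonsing_inv_mul _ hTu, Matrix.mul_one]

theorem exists_colProj_eq {A : Matrix m n ℂ} (hA : IsUnit (Aᴴ * A).det) :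
    ∃ V : Matrix m n ℂ, Vᴴ * V = 1 ∧ colProj A = V * Vᴴ := by
  obtain ⟨V, T, hV, hT, rfl⟩ := exists_orthonormal_factor hA
  exact ⟨V, hV, by rw [colProj_mul_of_isUnit _ hT, colProj_of_orthonormal hV]⟩

/-- A semi-unitary matrix can be completed to a unitary one. -/
theorem exists_orthonormal_completion {V : Matrix m n ℂ} (hV : Vᴴ * V = 1)
    (hcard : Fintype.card m = Fintype.card n + Fintype.card r) :
    ∃ V' : Matrix m r ℂ, V'ᴴ * V' = 1 ∧ V'ᴴ * V = 0 ∧ V * Vᴴ + V' * V'ᴴ = 1 := by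
  let v : n ⊕ r → EuclideanSpace ℂ m :=
    Sum.elim (fun j => WithLp.toLp 2 fun i => V i j) fun _ => 0
  have hvi : ∀ i j : n, inner ℂ (v (Sum.inl i)) (v (Sum.inl j)) = if i = j then (1 : ℂ) else 0 := by
    intro i j
    have := congrFun (congrFun hV i) j
    rw [one_apply, mul_apply] at this
    rw [← this, EuclideanSpace.inner_eq_star_dotProduct]
    simp [v, dotProduct, mul_comm]
  have hv : Orthonormal ℂ ((Set.range (Sum.inl : n → n ⊕ r)).domRestrict v) := by
    rw [orthonormal_iff_ite]
    rintro ⟨p, hp⟩ ⟨q, hq⟩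
    obtain ⟨i, rfl⟩ := hp
    obtain ⟨j, rfl⟩ := hq
    refine (hvi i j).trans ?_
    by_cases h : i = j
    · subst h; simp
    · rw [if_neg h, if_neg]
      intro h'
      exact h (Sum.inl_injective (congrArg Subtype.val h'))
  obtain ⟨b, hb⟩ := hv.exists_orthonormalBasis_extension_of_card_eq (by simp [hcard])
  have hbV : ∀ i j, b (Sum.inl j) i = V i j := fun i j => by
    rw [hb _ ⟨j, rfl⟩]; simp [v]
  have hon := orthonormal_iff_ite.1 b.orthonormal
  have hin : ∀ p q, ∑ i, star (b p i) * b q i = if p = q then 1 else 0 := fun p q => by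
    rw [← hon p q, EuclideanSpace.inner_eq_star_dotProduct]
    simp [dotProduct, mul_comm]
  let V' : Matrix m r ℂ := of fun i k => b (Sum.inr k) i
  have h1 : V'ᴴ * V' = 1 := by
    ext i j
    have := hin (Sum.inr i) (Sum.inr j)
    simpa [V', mul_apply, one_apply] using this
  have h2 : V'ᴴ * V = 0 := by
    ext i j
    have := hin (Sum.inr i) (Sum.inl j)
    simpa [V', mul_apply, hbV] using this
  refine ⟨V', h1, h2, ?_⟩
  have h3 : Vᴴ * V' = 0 := by simpa using congrArg conjTranspose h2
  -- The block matrix `[V V']` is square, so its left inverse is also a right inverse, which is the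
  -- completeness relation.
  have hW : fromRows Vᴴ V'ᴴ * fromCols V V' = 1 := by
    rw [fromRows_mul_fromCols, hV, h1, h2, h3, fromBlocks_one]
  have hW' := (Matrix.mul_eq_one_comm_of_card_eq _ _ _ (by simp [hcard])).1 hW
  rwa [fromCols_mul_fromRows] at hW'

theorem card_le_of_orthonormal {V : Matrix m n ℂ} (hV : Vᴴ * V = 1) :
    Fintype.card n ≤ Fintype.card m := by
  have h := rank_mul_le_right Vᴴ V
  rw [hV, rank_one] at h
  exact h.trans (rank_le_card_height V)

/-- The unitary group acts transitively on semi-unitary matrices. -/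
theorem exists_unitary_mul_eq {V W : Matrix m n ℂ} (hV : Vᴴ * V = 1) (hW : Wᴴ * W = 1) :
    ∃ U ∈ unitaryGroup m ℂ, U * V = W := by
  have hc : Fintype.card m = Fintype.card n + Fintype.card (Fin (Fintype.card m - Fintype.card n)) := by
    have := card_le_of_orthonormal hV
    simp; omega
  obtain ⟨V', h1, h2, h3⟩ := exists_orthonormal_completion (r := Fin _) hV hc
  obtain ⟨W', k1, k2, k3⟩ := exists_orthonormal_completion (r := Fin _) hW hc
  have h2' : Vᴴ * V' = 0 := by simpa using congrArg conjTranspose h2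
  refine ⟨W * Vᴴ + W' * V'ᴴ, ?_, ?_⟩
  · rw [mem_unitaryGroup_iff, star_eq_conjTranspose]
    calc (W * Vᴴ + W' * V'ᴴ) * (W * Vᴴ + W' * V'ᴴ)ᴴ
        = W * (Vᴴ * V) * Wᴴ + W * (Vᴴ * V') * W'ᴴ + W' * (V'ᴴ * V) * Wᴴ
          + W' * (V'ᴴ * V') * W'ᴴ := by
          simp only [conjTranspose_add, conjTranspose_mul, conjTranspose_conjTranspose,
            Matrix.mul_add, Matrix.add_mul, Matrix.mul_assoc]
          abel
      _ = 1 := by rw [hV, h1, h2, h2']; simpa using k3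
  · rw [Matrix.add_mul, Matrix.mul_assoc, Matrix.mul_assoc, hV, h2]; simp

/-! ### Matrices commuting with reflections -/

theorem reflection_mem_unitaryGroup {u : m → ℂ} (hu : star u ⬝ᵥ u = 1) :
    1 - (2 : ℂ) • vecMulVec u (star u) ∈ unitaryGroup m ℂ := by
  have h : vecMulVec u (star u) * vecMulVec u (star u) = vecMulVec u (star u) := by
    rw [vecMulVec_mul_vecMulVec, hu, one_smul]
  have hs : star (vecMulVec u (star u)) = vecMulVec u (star u) := by
    rw [star_eq_conjTranspose, conjTranspose_vecMulVec, star_star]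
  rw [mem_unitaryGroup_iff, star_sub, star_smul, star_one, hs]
  simp only [Matrix.sub_mul, Matrix.mul_sub, Matrix.one_mul, Matrix.mul_one, h,
    Matrix.mul_smul, Matrix.smul_mul]
  rw [star_ofNat]
  module

/-- Schur's lemma by hand. Commuting with the reflection along `u` is commuting with the rank one
matrix `u uᴴ`; polarization extends this to all `u vᴴ` with `u`, `v` in the range of `Q`, and these
matrix units leave only scalars on that range. -/
theorem exists_smul_of_commute_reflections {Q R : Matrix m m ℂ}
    (h : ∀ u : m → ℂ, star u ⬝ᵥ u = 1 → Q *ᵥ u = u →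
      (1 - (2 : ℂ) • vecMulVec u (star u)) * R = R * (1 - (2 : ℂ) • vecMulVec u (star u)))
    (hQ : Q * Q = Q) : ∃ a : ℂ, R * Q = a • Q := by
  -- The commutator of `u vᴴ` with `R`, sesquilinear in `(u, v)`; it is to be shown zero on the
  -- range of `Q`.
  let B : (m → ℂ) → (m → ℂ) → Matrix m m ℂ := fun u v =>
    vecMulVec u (star v) * R - R * vecMulVec u (star v)
  have hunit : ∀ u, star u ⬝ᵥ u = 1 → Q *ᵥ u = u → B u u = 0 := by
    intro u hu hQu
    have := h u hu hQu
    simp only [Matrix.sub_mul, Matrix.mul_sub, Matrix.one_mul, Matrix.mul_one, Matrix.smul_mul,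
      Matrix.mul_smul, sub_right_inj] at this
    simpa [B, sub_eq_zero] using smul_right_injective _ (two_ne_zero' ℂ) this
  have hnorm : ∀ u : m → ℂ, u ≠ 0 → ∃ c : ℂ, c ≠ 0 ∧ star (c • u) ⬝ᵥ (c • u) = 1 := by
    intro u hu
    have hpos : 0 < star u ⬝ᵥ u := dotProduct_star_self_pos_iff.2 hu
    obtain ⟨s, hs⟩ : ∃ s : ℝ, star u ⬝ᵥ u = s :=
      ⟨(star u ⬝ᵥ u).re, by
        rw [Complex.pos_iff] at hpos; exact Complex.ext rfl hpos.2.symm⟩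
    rw [hs] at hpos
    have hs0 : 0 < s := by exact_mod_cast hpos
    refine ⟨((Real.sqrt s)⁻¹ : ℝ), by
      exact_mod_cast (inv_pos.2 (Real.sqrt_pos.2 hs0)).ne', ?_⟩
    rw [star_smul, smul_dotProduct, dotProduct_smul, hs]
    simp only [smul_eq_mul, RCLike.star_def, Complex.conj_ofReal]
    rw [← Complex.ofReal_mul, ← Complex.ofReal_mul]
    norm_cast
    rw [← mul_assoc, ← mul_inv, Real.mul_self_sqrt hs0.le, inv_mul_cancel₀ hs0.ne']
  have hBsmul : ∀ (c : ℂ) u, B (c • u) (c • u) = (c * star c) • B u u := by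
    intro c u
    simp only [B, star_smul, smul_vecMulVec, vecMulVec_smul, Matrix.smul_mul, Matrix.mul_smul,
      smul_sub, smul_smul, mul_comm]
  have hdiag : ∀ u, Q *ᵥ u = u → B u u = 0 := by
    intro u hQu
    by_cases hu : u = 0
    · simp [B, hu]
    obtain ⟨c, hc, hc1⟩ := hnorm u hu
    have := hunit _ hc1 (by rw [mulVec_smul, hQu])
    rw [hBsmul] at this
    exact (smul_eq_zero.1 this).resolve_left (mul_ne_zero hc (star_ne_zero.2 hc))
  have hpol : ∀ u v, Q *ᵥ u = u → Q *ᵥ v = v → B u v = 0 := by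
    intro u v hu hv
    have h1 : B u v + B v u = 0 := by
      have e : B (u + v) (u + v) = B u u + B u v + (B v u + B v v) := by
        simp only [B, star_add, add_vecMulVec, vecMulVec_add, Matrix.add_mul, Matrix.mul_add]
        abel
      rw [hdiag _ (by rw [mulVec_add, hu, hv]), hdiag u hu, hdiag v hv] at e
      simpa using e.symm
    -- The second half of complex polarization: replacing `v` by `i v` turns the symmetric
    -- combination into the antisymmetric one.
    have h2 : B u v - B v u = 0 := by
      have e : B (u + Complex.I • v) (u + Complex.I • v)
          = B u u - Complex.I • (B u v - B v u) + B v v := by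
        simp only [B, star_add, star_smul, add_vecMulVec, vecMulVec_add, Matrix.add_mul,
          Matrix.mul_add, smul_vecMulVec, vecMulVec_smul, Matrix.smul_mul, Matrix.mul_smul,
          smul_sub, smul_smul, smul_add, RCLike.star_def, Complex.conj_I]
        simp only [neg_smul, Complex.I_mul_I, neg_mul, neg_neg, one_smul]
        abel
      rw [hdiag _ (by rw [mulVec_add, mulVec_smul, hu, hv]), hdiag u hu, hdiag v hv] at e
      have e' : Complex.I • (B u v - B v u) = 0 := by
        rw [zero_sub, add_zero] at e; exact neg_eq_zero.1 e.symm
      exact (smul_eq_zero.1 e').resolve_left Complex.I_ne_zero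
    have h3 : (2 : ℂ) • B u v = 0 := by
      rw [two_smul]
      calc B u v + B u v = (B u v + B v u) + (B u v - B v u) := by abel
        _ = 0 := by rw [h1, h2, add_zero]
    exact (smul_eq_zero.1 h3).resolve_left two_ne_zero
  by_cases hQ0 : Q = 0
  · exact ⟨0, by simp [hQ0]⟩
  obtain ⟨x, hx⟩ : ∃ x, Q *ᵥ x ≠ 0 := by
    by_contra! hall
    exact hQ0 (by ext i j; simpa using congrFun (hall (Pi.single j 1)) i)
  obtain ⟨c, -, hc1⟩ := hnorm _ hx
  set v := c • (Q *ᵥ x)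
  have hv : Q *ᵥ v = v := by simp only [v, mulVec_smul, mulVec_mulVec, hQ]
  refine ⟨star v ⬝ᵥ (R *ᵥ v), ?_⟩
  have key : ∀ y, (R * Q) *ᵥ y = ((star v ⬝ᵥ (R *ᵥ v)) • Q) *ᵥ y := by
    intro y
    have hy : Q *ᵥ (Q *ᵥ y) = Q *ᵥ y := by rw [mulVec_mulVec, hQ]
    -- Applied to the unit vector `v`, the relation `u vᴴ R = R u vᴴ` with `u = Q y` reads `(vᴴ R v)
    -- u = R u`.
    have e := hpol _ v hy hv
    rw [sub_eq_zero] at e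
    have e' := congrArg (· *ᵥ v) e
    simp only [← mulVec_mulVec, vecMulVec_mulVec, hc1] at e'
    simpa [← mulVec_mulVec, smul_mulVec] using e'.symm
  ext i j
  simpa using congrFun (key (Pi.single j 1)) i

end Algebra

end LimitedFeedback

namespace LimitedFeedback

open scoped ComplexOrder MatrixOrder

set_option linter.unusedSectionVars false

/-! ### Inequalities and limits for log-determinants. -/

section LogDet

variable {m n : Type*} [Fintype m] [Fintype n] [DecidableEq m] [DecidableEq n]

theorem one_le_re_det_one_add {B : Matrix n n ℂ} (hB : B.PosSemidef) : 1 ≤ (1 + B).det.re := by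
  have hA : (1 + B).PosSemidef := PosSemidef.one.add hB
  rw [hA.1.det_eq_prod_eigenvalues, ← RCLike.ofReal_prod]
  change 1 ≤ ((∏ i, hA.1.eigenvalues i : ℝ) : ℂ).re
  rw [Complex.ofReal_re]
  suffices key : ∀ i, 1 ≤ hA.1.eigenvalues i by
    calc (1 : ℝ) = ∏ _i : n, 1 := by simp
      _ ≤ _ := Finset.prod_le_prod (fun _ _ => zero_le_one) fun i _ => key i
  intro i
  rw [hA.1.eigenvalues_eq, add_mulVec, dotProduct_add, one_mulVec]
  have h1 := hB.re_dotProduct_nonneg (⇑(hA.1.eigenvectorBasis i))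
  have h2 : star (⇑(hA.1.eigenvectorBasis i)) ⬝ᵥ ⇑(hA.1.eigenvectorBasis i) = (1 : ℂ) := by
    have := hA.1.eigenvectorBasis.inner_eq_one i
    rwa [EuclideanSpace.inner_eq_star_dotProduct, dotProduct_comm] at this
  rw [h2, map_add, RCLike.one_re]
  linarith

theorem re_det_le_trace_pow {A : Matrix n n ℂ} (hA : A.PosSemidef) :
    A.det.re ≤ A.trace.re ^ Fintype.card n := by
  rw [hA.1.det_eq_prod_eigenvalues, ← RCLike.ofReal_prod, hA.1.trace_eq_sum_eigenvalues,
    ← RCLike.ofReal_sum]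
  change ((∏ i, hA.1.eigenvalues i : ℝ) : ℂ).re ≤ ((∑ i, hA.1.eigenvalues i : ℝ) : ℂ).re ^ _
  rw [Complex.ofReal_re, Complex.ofReal_re]
  calc ∏ i, hA.1.eigenvalues i ≤ ∏ _i : n, ∑ i, hA.1.eigenvalues i :=
        Finset.prod_le_prod (fun i _ => hA.eigenvalues_nonneg i) fun i hi =>
          Finset.single_le_sum (fun j _ => hA.eigenvalues_nonneg j) hi
    _ = _ := by simp

/-- The scalar bound `log x ≤ x - 1` summed over the eigenvalues. Both trace bounds on the rate
below come from it. -/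
theorem log_re_det_le {A : Matrix n n ℂ} (hA : A.PosDef) :
    Real.log A.det.re ≤ A.trace.re - Fintype.card n := by
  have ht : A.trace.re - Fintype.card n = ∑ i, (hA.1.eigenvalues i - 1) := by
    have h' := congrArg Complex.re hA.1.trace_eq_sum_eigenvalues
    rw [← RCLike.ofReal_sum] at h'
    change _ = ((∑ i, hA.1.eigenvalues i : ℝ) : ℂ).re at h'
    rw [Complex.ofReal_re] at h'
    simp [h']
  rw [ht, hA.1.det_eq_prod_eigenvalues, ← RCLike.ofReal_prod]
  change Real.log ((∏ i, hA.1.eigenvalues i : ℝ) : ℂ).re ≤ _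
  rw [Complex.ofReal_re, Real.log_prod fun i _ => (hA.eigenvalues_pos i).ne']
  exact Finset.sum_le_sum fun i _ => Real.log_le_sub_one_of_pos (hA.eigenvalues_pos i)

/-- Up to a similarity, `X Y⁻¹` is positive semidefinite. -/
theorem exists_posSemidef_det_one_add_mul_inv {X Y : Matrix n n ℂ} (hX : X.PosSemidef)
    (hY : Y.PosDef) :
    ∃ B : Matrix n n ℂ, B.PosSemidef ∧ (1 + X * Y⁻¹).det = (1 + B).det ∧
      (X * Y⁻¹).trace = B.trace := by
  obtain ⟨L, hL⟩ := hY.inv.posSemidef.exists_eq_conjTranspose_mul_self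
  refine ⟨L * X * Lᴴ, hX.mul_mul_conjTranspose_same L, ?_, ?_⟩
  · rw [hL, ← Matrix.mul_assoc, det_one_add_mul_comm, Matrix.mul_assoc]
  · rw [hL, ← Matrix.mul_assoc, trace_mul_comm, Matrix.mul_assoc]

theorem one_le_re_det_one_add_mul_inv {X Y : Matrix n n ℂ} (hX : X.PosSemidef) (hY : Y.PosDef) :
    1 ≤ (1 + X * Y⁻¹).det.re := by
  obtain ⟨B, hB, h1, -⟩ := exists_posSemidef_det_one_add_mul_inv hX hY
  rw [h1]
  exact one_le_re_det_one_add hB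

theorem log_re_det_one_add_mul_inv_le_trace {X Y : Matrix n n ℂ} (hX : X.PosSemidef)
    (hY : Y.PosDef) : Real.log (1 + X * Y⁻¹).det.re ≤ (X * Y⁻¹).trace.re := by
  obtain ⟨B, hB, h1, h2⟩ := exists_posSemidef_det_one_add_mul_inv hX hY
  rw [h1, h2]
  simpa using log_re_det_le (PosDef.one.add_posSemidef hB)

theorem re_trace_mul_nonneg {X W : Matrix n n ℂ} (hX : X.PosSemidef) (hW : W.PosSemidef) :
    0 ≤ (X * W).trace.re := by
  obtain ⟨L, rfl⟩ := hX.exists_eq_conjTranspose_mul_self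
  rw [Matrix.mul_assoc, trace_mul_comm]
  exact (Complex.nonneg_iff.1 (hW.mul_mul_conjTranspose_same L).trace_nonneg).1

/-- Since `Z + 1 ≥ 1`, its inverse is at most `1`, so interference and noise only lower the trace
bound. The resulting bound by the signal power alone is the integrable majorant at low SNR. -/
theorem log_re_det_one_add_mul_inv_le {X Z : Matrix n n ℂ} (hX : X.PosSemidef)
    (hZ : Z.PosSemidef) : Real.log (1 + X * (Z + 1)⁻¹).det.re ≤ X.trace.re := by
  have hY : (Z + 1).PosDef := PosDef.posSemidef_add hZ PosDef.one
  refine (log_re_det_one_add_mul_inv_le_trace hX hY).trans ?_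
  have hu : IsUnit (Z + 1).det := hY.isUnit.map detMonoidHom
  have hW : (1 - (Z + 1)⁻¹).PosSemidef := by
    -- With `W = (Z + 1)⁻¹`, the congruence `1 - W = W (Z + Z²) W` exhibits positivity.
    have h3 : (1 - (Z + 1)⁻¹) = (Z + 1)⁻¹ᴴ * (Z + Zᴴ * Z) * (Z + 1)⁻¹ := by
      rw [hZ.1, hY.inv.1]
      calc 1 - (Z + 1)⁻¹ = (Z + 1 - 1) * (Z + 1)⁻¹ := by
            rw [Matrix.sub_mul, mul_nonsing_inv _ hu, Matrix.one_mul]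
        _ = Z * (Z + 1)⁻¹ := by rw [add_sub_cancel_right]
        _ = ((Z + 1)⁻¹ * (Z + 1)) * Z * (Z + 1)⁻¹ := by
            rw [nonsing_inv_mul _ hu, Matrix.one_mul]
        _ = (Z + 1)⁻¹ * (Z + Z * Z) * (Z + 1)⁻¹ := by
            simp only [Matrix.mul_assoc, Matrix.add_mul, Matrix.mul_add, Matrix.one_mul]
            rw [add_comm]
    rw [h3]
    exact (hZ.add (posSemidef_conjTranspose_mul_self Z)).conjTranspose_mul_mul_same _
  have := re_trace_mul_nonneg hX hW
  rw [Matrix.mul_sub, Matrix.mul_one, trace_sub, Complex.sub_re] at this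
  linarith

theorem det_one_add_mul_inv {X Y : Matrix n n ℂ} (hY : IsUnit Y.det) :
    (1 + X * Y⁻¹).det * Y.det = (X + Y).det := by
  rw [← det_mul, Matrix.add_mul, Matrix.one_mul, Matrix.mul_assoc, nonsing_inv_mul _ hY,
    Matrix.mul_one, add_comm]

theorem re_det_eq {A : Matrix n n ℂ} (hA : A.PosSemidef) : A.det = (A.det.re : ℂ) :=
  Complex.ext rfl (by simpa using (Complex.nonneg_iff.1 hA.det_nonneg).2.symm)

theorem re_det_nonneg {A : Matrix n n ℂ} (hA : A.PosSemidef) : 0 ≤ A.det.re :=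
  (Complex.nonneg_iff.1 hA.det_nonneg).1

theorem re_det_mono {A B : Matrix n n ℂ} (hA : A.PosSemidef) (hB : B.PosSemidef) :
    A.det.re ≤ (B + A).det.re := by
  by_cases h : A.det = 0
  · rw [h]; exact re_det_nonneg (hB.add hA)
  have hA' := (hA.posDef_iff_det_ne_zero).2 h
  rw [← det_one_add_mul_inv (isUnit_iff_ne_zero.2 h), re_det_eq hA, Complex.re_mul_ofReal,
    Complex.ofReal_re]
  exact le_mul_of_one_le_left (re_det_nonneg hA) (one_le_re_det_one_add_mul_inv hB hA')

/-- For a product bound on `det (1 + X Y⁻¹)` when `Y = Z + W` with `W` nonsingular. -/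
theorem re_det_one_add_mul_inv_le {X Z W : Matrix n n ℂ} (hX : X.PosSemidef) (hZ : Z.PosSemidef)
    (hW : W.PosSemidef) (hY : (Z + W).PosDef) :
    (1 + X * (Z + W)⁻¹).det.re * W.det.re ≤ (X + (Z + W)).trace.re ^ Fintype.card n := by
  have hu : IsUnit (Z + W).det := hY.isUnit.map detMonoidHom
  -- `det(1 + X Y⁻¹) det Y = det(X + Y)` is at most a power of the trace, and `det Y ≥ det W`.
  refine le_trans ?_ (re_det_le_trace_pow (hX.add hY.posSemidef))
  rw [← det_one_add_mul_inv hu, re_det_eq hY.posSemidef, Complex.re_mul_ofReal]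
  exact mul_le_mul_of_nonneg_left (re_det_mono hW hZ)
    (zero_le_one.trans (one_le_re_det_one_add_mul_inv hX hY))

/-! ### Limits -/

theorem tendsto_matrix_mul {ι k : Type*} [Fintype k] {l : Filter ι} {A : ι → Matrix m n ℂ}
    {B : ι → Matrix n k ℂ} {A₀ : Matrix m n ℂ} {B₀ : Matrix n k ℂ} (hA : Tendsto A l (𝓝 A₀))
    (hB : Tendsto B l (𝓝 B₀)) : Tendsto (fun i => A i * B i) l (𝓝 (A₀ * B₀)) := by
  refine tendsto_pi_nhds.2 fun i => tendsto_pi_nhds.2 fun j => ?_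
  simp only [mul_apply]
  exact tendsto_finsetSum _ fun x _ =>
    (((hA.apply_nhds i).apply_nhds x).mul ((hB.apply_nhds x).apply_nhds j))

theorem tendsto_conjTranspose {ι : Type*} {l : Filter ι} {A : ι → Matrix m n ℂ}
    {A₀ : Matrix m n ℂ} (hA : Tendsto A l (𝓝 A₀)) : Tendsto (fun i => (A i)ᴴ) l (𝓝 A₀ᴴ) :=
  (continuous_id.matrix_conjTranspose.tendsto A₀).comp hA

theorem tendsto_trace {ι : Type*} {l : Filter ι} {A : ι → Matrix n n ℂ} {A₀ : Matrix n n ℂ}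
    (hA : Tendsto A l (𝓝 A₀)) : Tendsto (fun i => (A i).trace) l (𝓝 A₀.trace) :=
  (continuous_id.matrix_trace.tendsto A₀).comp hA

theorem tendsto_det {ι : Type*} {l : Filter ι} {A : ι → Matrix n n ℂ} {A₀ : Matrix n n ℂ}
    (hA : Tendsto A l (𝓝 A₀)) : Tendsto (fun i => (A i).det) l (𝓝 A₀.det) :=
  (continuous_id.matrix_det.tendsto A₀).comp hA

theorem tendsto_inv_of_isUnit {ι : Type*} {l : Filter ι} {A : ι → Matrix n n ℂ} {A₀ : Matrix n n ℂ}
    (h : Tendsto A l (𝓝 A₀)) (hA : IsUnit A₀.det) : Tendsto (fun i => (A i)⁻¹) l (𝓝 A₀⁻¹) := by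
  have ha : Tendsto (fun i => (A i).adjugate) l (𝓝 A₀.adjugate) :=
    (continuous_id.matrix_adjugate.tendsto A₀).comp h
  simp only [inv_def, Ring.inverse_eq_inv']
  exact ((tendsto_det h).inv₀ hA.ne_zero).smul ha

theorem tendsto_colProj {ι : Type*} {l : Filter ι} {A : ι → Matrix m n ℂ} {A₀ : Matrix m n ℂ}
    (h : Tendsto A l (𝓝 A₀)) (hA : IsUnit (A₀ᴴ * A₀).det) :
    Tendsto (fun i => colProj (A i)) l (𝓝 (colProj A₀)) := by
  have hH := tendsto_conjTranspose h
  exact tendsto_matrix_mul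
    (tendsto_matrix_mul h (tendsto_inv_of_isUnit (tendsto_matrix_mul hH h) hA)) hH

/-- The inequality `log det C ≤ tr C - n` is applied to `C = L Y Lᴴ` with `Lᴴ L = (X + Y)⁻¹`. The
determinant of `C` is the reciprocal of `det(1 + X Y⁻¹)`, so the upper bound for `C` becomes a lower
bound here. -/
theorem le_log_re_det_one_add_mul_inv {X Y : Matrix n n ℂ} (hX : X.PosSemidef) (hY : Y.PosDef) :
    (X * (X + Y)⁻¹).trace.re ≤ Real.log (1 + X * Y⁻¹).det.re := by
  have hXY : (X + Y).PosDef := PosDef.posSemidef_add hX hY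
  have hu : IsUnit (X + Y).det := hXY.isUnit.map detMonoidHom
  have hv : IsUnit Y.det := hY.isUnit.map detMonoidHom
  obtain ⟨L, hL⟩ := hXY.inv.posSemidef.exists_eq_conjTranspose_mul_self
  have hLu : IsUnit L.det := by
    have := hXY.inv.isUnit.map detMonoidHom
    rw [hL, map_mul] at this
    exact isUnit_of_mul_isUnit_right this
  have hC : (L * Y * Lᴴ).PosDef := hY.mul_mul_conjTranspose_same <|
    vecMul_injective_of_isUnit ((isUnit_iff_isUnit_det _).2 hLu)
  have hdet : (L * Y * Lᴴ).det * (1 + X * Y⁻¹).det = 1 := by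
    have h1 : (L * Y * Lᴴ).det = Y.det * (X + Y)⁻¹.det := by
      rw [hL]; simp only [det_mul]; ring
    rw [h1, mul_right_comm, mul_comm Y.det, det_one_add_mul_inv hv, ← det_mul,
      mul_nonsing_inv _ hu, det_one]
  have htr : (L * Y * Lᴴ).trace = Fintype.card n - (X * (X + Y)⁻¹).trace := by
    have h1 : (L * Y * Lᴴ).trace = (Y * (X + Y)⁻¹).trace := by
      rw [hL, ← Matrix.mul_assoc, trace_mul_comm (Y * Lᴴ), Matrix.mul_assoc]
    have h2 : Y * (X + Y)⁻¹ = 1 - X * (X + Y)⁻¹ := by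
      rw [eq_sub_iff_add_eq', ← Matrix.add_mul, mul_nonsing_inv _ hu]
    rw [h1, h2, trace_sub, trace_one]
  have h3 := log_re_det_le hC
  rw [htr, Complex.sub_re, Complex.natCast_re] at h3
  have h4 : (L * Y * Lᴴ).det.re * (1 + X * Y⁻¹).det.re = 1 := by
    have := congrArg Complex.re hdet
    rw [re_det_eq hC.posSemidef, Complex.re_ofReal_mul, Complex.one_re] at this
    simpa using this
  have h5 : Real.log (L * Y * Lᴴ).det.re = - Real.log (1 + X * Y⁻¹).det.re := by
    rw [eq_inv_of_mul_eq_one_left h4, Real.log_inv]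
  linarith

/-- The lower trace bound with `(X + Y)⁻¹` and the upper one with `Y⁻¹` are both linear in the
signal to leading order, so a squeeze replaces differentiation of the determinant. -/
theorem tendsto_log_det_div {X Y : ℝ → Matrix n n ℂ} {X₀ : Matrix n n ℂ}
    (hX : ∀ ρ > 0, (X ρ).PosSemidef) (hY : ∀ ρ > 0, (Y ρ).PosDef)
    (hX₀ : Tendsto X (𝓝[>] 0) (𝓝 X₀)) (hY₀ : Tendsto Y (𝓝[>] 0) (𝓝 1)) :
    Tendsto (fun ρ : ℝ => Real.log (1 + ((ρ : ℂ) • X ρ) * (Y ρ)⁻¹).det.re / ρ) (𝓝[>] 0)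
      (𝓝 X₀.trace.re) := by
  have hρ : Tendsto (fun ρ : ℝ => (ρ : ℂ)) (𝓝[>] 0) (𝓝 0) := by
    have : Tendsto (fun ρ : ℝ => (ρ : ℂ)) (𝓝 0) (𝓝 ((0 : ℝ) : ℂ)) :=
      Complex.continuous_ofReal.tendsto 0
    rw [Complex.ofReal_zero] at this
    exact this.mono_left nhdsWithin_le_nhds
  have hup : Tendsto (fun ρ => (X ρ * (Y ρ)⁻¹).trace.re) (𝓝[>] 0) (𝓝 X₀.trace.re) := by
    have := tendsto_trace (tendsto_matrix_mul hX₀ (tendsto_inv_of_isUnit hY₀ (by simp)))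
    rw [inv_one, Matrix.mul_one] at this
    exact (Complex.continuous_re.tendsto _).comp this
  have hlo : Tendsto (fun ρ : ℝ => (X ρ * ((ρ : ℂ) • X ρ + Y ρ)⁻¹).trace.re) (𝓝[>] 0)
      (𝓝 X₀.trace.re) := by
    have h1 : Tendsto (fun ρ : ℝ => (ρ : ℂ) • X ρ + Y ρ) (𝓝[>] 0) (𝓝 1) := by
      simpa using (hρ.smul hX₀).add hY₀
    have := tendsto_trace (tendsto_matrix_mul hX₀ (tendsto_inv_of_isUnit h1 (by simp)))
    rw [inv_one, Matrix.mul_one] at this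
    exact (Complex.continuous_re.tendsto _).comp this
  have hps : ∀ ρ : ℝ, 0 < ρ → ((ρ : ℂ) • X ρ).PosSemidef := fun ρ h =>
    (hX ρ h).smul (Complex.zero_le_real.2 h.le)
  refine tendsto_of_tendsto_of_tendsto_of_le_of_le' hlo hup ?_ ?_
  · filter_upwards [self_mem_nhdsWithin] with ρ (h : 0 < ρ)
    rw [le_div_iff₀ h]
    refine le_trans (le_of_eq ?_) (le_log_re_det_one_add_mul_inv (hps ρ h) (hY ρ h))
    rw [Matrix.smul_mul, trace_smul, smul_eq_mul, Complex.re_ofReal_mul, mul_comm]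
  · filter_upwards [self_mem_nhdsWithin] with ρ (h : 0 < ρ)
    rw [div_le_iff₀ h]
    refine (log_re_det_one_add_mul_inv_le_trace (hps ρ h) (hY ρ h)).trans (le_of_eq ?_)
    rw [Matrix.smul_mul, trace_smul, smul_eq_mul, Complex.re_ofReal_mul, mul_comm]

end LogDet

end LimitedFeedback

namespace LimitedFeedback

open scoped ENNReal

set_option linter.unusedSectionVars false

/-! ### Anti-concentration of a complex Gaussian variable. -/

section Gaussian

/-- Replace the random coordinates one at a time by those of a fixed point. -/
theorem lintegral_pi_le_pow_mul {ι : Type*} [Fintype ι] [DecidableEq ι] {X : ι → Type*}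
    [∀ i, MeasurableSpace (X i)] (μ : ∀ i, Measure (X i)) [∀ i, SigmaFinite (μ i)]
    {F : (∀ i, X i) → ℝ≥0∞} (hF : Measurable F) (d : ∀ i, X i) (A : ℝ≥0∞)
    (h : ∀ (c : ∀ i, X i) (k : ι),
      ∫⁻ x, F (Function.update c k x) ∂μ k ≤ A * F (Function.update c k (d k))) :
    ∫⁻ x, F x ∂Measure.pi μ ≤ A ^ Fintype.card ι * F d := by
  have key : ∀ (s : Finset ι) (x : ∀ i, X i),
      (∫⋯∫⁻_s, F ∂μ) x ≤ A ^ s.card * F (s.piecewise d x) := by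
    intro s
    induction s using Finset.induction_on with
    | empty => intro x; simp
    | insert i s hi ih =>
      intro x
      rw [lmarginal_insert F hF hi, Finset.card_insert_of_notMem hi]
      calc ∫⁻ y, (∫⋯∫⁻_s, F ∂μ) (Function.update x i y) ∂μ i
          ≤ ∫⁻ y, A ^ s.card * F (Function.update (s.piecewise d x) i y) ∂μ i := by
            refine lintegral_mono fun y => (ih _).trans (le_of_eq ?_)
            rw [Finset.update_piecewise_of_notMem _ _ _ hi]
        _ = A ^ s.card * ∫⁻ y, F (Function.update (s.piecewise d x) i y) ∂μ i :=
            lintegral_const_mul _ (hF.comp (measurable_update _))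
        _ ≤ A ^ s.card * (A * F (Function.update (s.piecewise d x) i (d i))) := by
            gcongr
            exact h _ _
        _ = A ^ (s.card + 1) * F ((insert i s).piecewise d x) := by
            rw [Finset.piecewise_insert, pow_succ, mul_assoc]
  have hne : Nonempty (∀ i, X i) := ⟨d⟩
  have := key Finset.univ d
  rwa [lmarginal_univ, Finset.card_univ, Finset.piecewise_univ] at this

instance : IsProbabilityMeasure stdComplexGaussian :=
  Measure.isProbabilityMeasure_map (by fun_prop)

/-- The density is `exp(-|z|²) / π`; an upper bound is all that is needed, so the factor `1 / π` is
dropped. -/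
theorem lintegral_stdComplexGaussian_le {g : ℂ → ℝ≥0∞} (hg : Measurable g) :
    ∫⁻ z, g z ∂stdComplexGaussian ≤ ∫⁻ z, ENNReal.ofReal (Real.exp (-‖z‖ ^ 2)) * g z := by
  have hpdf : ∀ x y : ℝ, gaussianPDF 0 (1 / 2) x * gaussianPDF 0 (1 / 2) y
      ≤ ENNReal.ofReal (Real.exp (-(x ^ 2 + y ^ 2))) := by
    intro x y
    rw [gaussianPDF, gaussianPDF, ← ENNReal.ofReal_mul (gaussianPDFReal_nonneg _ _ _)]
    refine ENNReal.ofReal_le_ofReal ?_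
    have h1 : ∀ x, gaussianPDFReal 0 (1 / 2) x ≤ Real.exp (-x ^ 2) := by
      intro x
      rw [gaussianPDFReal]
      have hs : 1 ≤ Real.sqrt (2 * Real.pi * ((1 / 2 : NNReal) : ℝ)) := by
        rw [Real.one_le_sqrt]
        push_cast
        linarith [Real.pi_gt_three]
      have he : -(x - 0) ^ 2 / (2 * ((1 / 2 : NNReal) : ℝ)) = - x ^ 2 := by
        push_cast; ring
      rw [he]
      exact mul_le_of_le_one_left (Real.exp_pos _).le (inv_le_one_of_one_le₀ hs)
    calc _ ≤ Real.exp (-x ^ 2) * Real.exp (-y ^ 2) :=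
          mul_le_mul (h1 x) (h1 y) (gaussianPDFReal_nonneg _ _ _) (Real.exp_pos _).le
      _ = _ := by rw [← Real.exp_add]; ring_nf
  rw [stdComplexGaussian, lintegral_map_equiv, gaussianReal_of_var_ne_zero _ (by norm_num),
    prod_withDensity (measurable_gaussianPDF _ _) (measurable_gaussianPDF _ _),
    ← (Complex.volume_preserving_equiv_real_prod.symm).lintegral_comp
      (f := fun z : ℂ => ENNReal.ofReal (Real.exp (-‖z‖ ^ 2)) * g z) (by fun_prop),
    lintegral_withDensity_eq_lintegral_mul _ (by fun_prop) (by fun_prop)]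
  refine lintegral_mono fun p => ?_
  simp only [Pi.mul_apply]
  gcongr
  refine (hpdf p.1 p.2).trans (le_of_eq ?_)
  congr 3
  rw [← Complex.normSq_eq_norm_sq, Complex.normSq_apply]
  simp [Complex.measurableEquivRealProd, sq]

theorem integrable_norm_sq_stdComplexGaussian :
    Integrable (fun z : ℂ => ‖z‖ ^ 2) stdComplexGaussian ∧
      ∫ z, ‖z‖ ^ 2 ∂stdComplexGaussian = 1 := by
  have h2 : Integrable (fun x : ℝ => x ^ 2) (gaussianReal 0 (1 / 2)) :=
    (memLp_id_gaussianReal 2).integrable_sq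
  have h2' : ∫ x : ℝ, x ^ 2 ∂gaussianReal 0 (1 / 2) = 1 / 2 := by
    have := variance_fun_id_gaussianReal (μ := 0) (v := 1 / 2)
    rw [variance_of_integral_eq_zero (by fun_prop) (by simp)] at this
    rw [this]; simp
  have hfun : ∀ p : ℝ × ℝ, ‖Complex.measurableEquivRealProd.symm p‖ ^ 2 = p.1 ^ 2 + p.2 ^ 2 := by
    intro p
    rw [← Complex.normSq_eq_norm_sq, Complex.normSq_apply]
    simp [Complex.measurableEquivRealProd, sq]
  have i1 : Integrable (fun p : ℝ × ℝ => p.1 ^ 2)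
      ((gaussianReal 0 (1 / 2)).prod (gaussianReal 0 (1 / 2))) := h2.comp_fst _
  have i2 : Integrable (fun p : ℝ × ℝ => p.2 ^ 2)
      ((gaussianReal 0 (1 / 2)).prod (gaussianReal 0 (1 / 2))) := h2.comp_snd _
  constructor
  · rw [stdComplexGaussian, integrable_map_equiv]
    refine (i1.add i2).congr (ae_of_all _ fun p => ?_)
    simp only [Pi.add_apply, Function.comp_apply, hfun]
  · rw [stdComplexGaussian, integral_map_equiv]
    simp only [hfun]
    rw [integral_add i1 i2, integral_fun_fst (fun x : ℝ => x ^ 2),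
      integral_fun_snd (fun x : ℝ => x ^ 2), h2']
    norm_num

/-- In polar coordinates the Jacobian `r` cancels the singularity `1 / r`. -/
theorem lintegral_ball_inv_norm_lt_top :
    ∫⁻ z : ℂ, (Metric.ball (0 : ℂ) 1).indicator (fun z => ‖z‖ₑ⁻¹) z < ∞ := by
  rw [← Complex.lintegral_comp_polarCoord_symm]
  calc ∫⁻ p in polarCoord.target, ENNReal.ofReal p.1 •
        (Metric.ball (0 : ℂ) 1).indicator (fun z => ‖z‖ₑ⁻¹) (Complex.polarCoord.symm p)
      ≤ ∫⁻ p in polarCoord.target, (Set.Ioo (0 : ℝ) 1 ×ˢ Set.Ioo (-Real.pi) Real.pi).indicator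
          (fun _ => 1) p := by
        refine setLIntegral_mono' polarCoord.open_target.measurableSet fun p hp => ?_
        rw [polarCoord_target] at hp
        have hp1 : 0 < p.1 := hp.1
        have hn : ‖Complex.polarCoord.symm p‖ = p.1 := by
          rw [Complex.norm_polarCoord_symm, abs_of_pos hp1]
        by_cases h : p.1 < 1
        · have hb : Complex.polarCoord.symm p ∈ Metric.ball (0 : ℂ) 1 := by
            rwa [mem_ball_zero_iff, hn]
          have hp' : p ∈ Set.Ioo (0 : ℝ) 1 ×ˢ Set.Ioo (-Real.pi) Real.pi := ⟨⟨hp1, h⟩, hp.2⟩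
          rw [Set.indicator_of_mem hb,
            Set.indicator_of_mem hp', ← ofReal_norm, hn, smul_eq_mul,
            ENNReal.mul_inv_cancel (by simpa using hp1) ENNReal.ofReal_ne_top]
        · have hb : Complex.polarCoord.symm p ∉ Metric.ball (0 : ℂ) 1 := by
            rwa [mem_ball_zero_iff, hn]
          rw [Set.indicator_of_notMem hb]
          simp
    _ ≤ ∫⁻ p, (Set.Ioo (0 : ℝ) 1 ×ˢ Set.Ioo (-Real.pi) Real.pi).indicator (fun _ => 1) p :=
        setLIntegral_le_lintegral _ _
    _ < ∞ := by
        rw [lintegral_indicator_const (measurableSet_Ioo.prod measurableSet_Ioo), one_mul,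
          Measure.volume_eq_prod, Measure.prod_prod]
        exact ENNReal.mul_lt_top (by simp) (by simp)

/-- Outside the unit disc around `z₀` the inverse distance is at most `1` and the weight has finite
mean. Inside, weight times density is at most `2`, and translation invariance of Lebesgue measure
makes the remaining integral independent of `z₀`. -/
theorem exists_lintegral_weighted_inv_le :
    ∃ A : ℝ≥0∞, A ≠ ∞ ∧ ∀ z₀ : ℂ,
      ∫⁻ z, (1 + ‖z‖ₑ) * ‖z - z₀‖ₑ⁻¹ ∂stdComplexGaussian ≤ A := by
  set J : ℝ≥0∞ := ∫⁻ z : ℂ, (Metric.ball (0 : ℂ) 1).indicator (fun z => ‖z‖ₑ⁻¹) z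
  set E : ℝ≥0∞ := ∫⁻ z, (1 + ‖z‖ₑ) ∂stdComplexGaussian
  have hE : E ≠ ∞ := by
    have h2 : Integrable (fun z : ℂ => 1 + (1 + ‖z‖ ^ 2)) stdComplexGaussian :=
      (integrable_const _).add
        ((integrable_const _).add integrable_norm_sq_stdComplexGaussian.1)
    refine ne_top_of_le_ne_top h2.lintegral_lt_top.ne (lintegral_mono fun z => ?_)
    rw [ENNReal.ofReal_add zero_le_one (by positivity), ENNReal.ofReal_one, ← ofReal_norm]
    gcongr
    nlinarith [sq_nonneg (‖z‖ - 1)]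
  have hmeas : Measurable fun z : ℂ => (Metric.ball (0 : ℂ) 1).indicator (fun z => ‖z‖ₑ⁻¹) z :=
    Measurable.indicator (by fun_prop) measurableSet_ball
  refine ⟨E + 2 * J, ?_, fun z₀ => ?_⟩
  · exact ENNReal.add_ne_top.2
      ⟨hE, ENNReal.mul_ne_top (by simp) lintegral_ball_inv_norm_lt_top.ne⟩
  have hmeas' : Measurable fun z : ℂ =>
      (Metric.ball (0 : ℂ) 1).indicator (fun z => ‖z‖ₑ⁻¹) (z - z₀) :=
    hmeas.comp (measurable_id.sub_const z₀)
  have hpt : ∀ z : ℂ, (1 + ‖z‖ₑ) * ‖z - z₀‖ₑ⁻¹ ≤ (1 + ‖z‖ₑ) + (1 + ‖z‖ₑ) *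
      (Metric.ball (0 : ℂ) 1).indicator (fun z => ‖z‖ₑ⁻¹) (z - z₀) := by
    intro z
    by_cases h : z - z₀ ∈ Metric.ball (0 : ℂ) 1
    · rw [Set.indicator_of_mem h]
      exact le_add_self
    · rw [Set.indicator_of_notMem h, mul_zero, add_zero]
      refine mul_le_of_le_one_right zero_le (ENNReal.inv_le_one.2 ?_)
      rw [mem_ball_zero_iff, not_lt] at h
      rw [← ofReal_norm, ← ENNReal.ofReal_one]
      exact ENNReal.ofReal_le_ofReal h
  calc _ ≤ ∫⁻ z, ((1 + ‖z‖ₑ) + (1 + ‖z‖ₑ) *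
        (Metric.ball (0 : ℂ) 1).indicator (fun z => ‖z‖ₑ⁻¹) (z - z₀)) ∂stdComplexGaussian :=
        lintegral_mono hpt
    _ = E + ∫⁻ z, (1 + ‖z‖ₑ) *
        (Metric.ball (0 : ℂ) 1).indicator (fun z => ‖z‖ₑ⁻¹) (z - z₀) ∂stdComplexGaussian :=
        lintegral_add_left (by fun_prop) _
    _ ≤ E + ∫⁻ z, 2 * (Metric.ball (0 : ℂ) 1).indicator (fun z => ‖z‖ₑ⁻¹) (z - z₀) := by
        refine add_le_add le_rfl ?_
        refine (lintegral_stdComplexGaussian_le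
          ((by fun_prop : Measurable fun z : ℂ => 1 + ‖z‖ₑ).mul hmeas')).trans
          (lintegral_mono fun z => ?_)
        simp only [Pi.mul_apply]
        rw [← mul_assoc]
        gcongr
        rw [← ofReal_norm, ← ENNReal.ofReal_one,
          ← ENNReal.ofReal_add zero_le_one (norm_nonneg _),
          ← ENNReal.ofReal_mul (Real.exp_pos _).le, ← ENNReal.ofReal_ofNat]
        refine ENNReal.ofReal_le_ofReal ?_
        rw [Real.exp_neg, inv_mul_le_iff₀ (Real.exp_pos _)]
        nlinarith [Real.add_one_le_exp (‖z‖ ^ 2), sq_nonneg (‖z‖ - 1)]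
    _ = E + 2 * J := by
        rw [lintegral_const_mul _ hmeas',
          lintegral_sub_right_eq_self
            (fun z => (Metric.ball (0 : ℂ) 1).indicator (fun z => ‖z‖ₑ⁻¹) z) z₀]

/-- Anti-concentration of affine functions of a complex Gaussian variable. -/
theorem exists_lintegral_inv_affine_le :
    ∃ A : ℝ≥0∞, A ≠ ∞ ∧ ∀ a b v : ℂ, ‖v‖ ≤ 1 →
      ∫⁻ z, ‖a * z + b‖ₑ⁻¹ ∂stdComplexGaussian ≤ A * ‖a * v + b‖ₑ⁻¹ := by
  obtain ⟨A, hA, h⟩ := exists_lintegral_weighted_inv_le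
  refine ⟨1 + A, by simpa using hA, fun a b v hv => ?_⟩
  by_cases ha : a = 0
  · simp only [ha, zero_mul, zero_add, lintegral_const, measure_univ, mul_one]
    exact le_mul_of_one_le_left zero_le le_self_add
  set z₀ := -b / a
  -- Because `|a v + b| ≤ |a| + |b|` for `|v| ≤ 1`, it suffices to bound the integral times `|a| +
  -- |b|`. The term with `b` is handled by writing `b` as `a (z - z₀) - a z`; at `z = z₀` the right
  -- side is infinite.
  have hpt : ∀ z : ℂ, (‖a‖ₑ + ‖b‖ₑ) * ‖a * z + b‖ₑ⁻¹ ≤ 1 + (1 + ‖z‖ₑ) * ‖z - z₀‖ₑ⁻¹ := by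
    intro z
    have hz : a * z + b = a * (z - z₀) := by simp only [z₀]; field_simp; ring
    by_cases h0 : z - z₀ = 0
    · rw [h0, enorm_zero, ENNReal.inv_zero, ENNReal.mul_top (by simp)]
      simp
    have hne : ‖z - z₀‖ₑ ≠ 0 := by simpa using h0
    have hane : ‖a‖ₑ ≠ 0 := by simpa using ha
    have hb : ‖b‖ₑ ≤ ‖a * (z - z₀)‖ₑ + ‖a‖ₑ * ‖z‖ₑ := by
      calc ‖b‖ₑ = ‖a * (z - z₀) - a * z‖ₑ := by rw [← hz, add_sub_cancel_left]
        _ ≤ _ := by rw [← enorm_mul]; exact enorm_sub_le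
    rw [hz, enorm_mul] at *
    have hmul : (‖a‖ₑ * ‖z - z₀‖ₑ) ≠ 0 := mul_ne_zero hane hne
    have hmul' : (‖a‖ₑ * ‖z - z₀‖ₑ) ≠ ∞ := ENNReal.mul_ne_top (by simp) (by simp)
    calc (‖a‖ₑ + ‖b‖ₑ) * (‖a‖ₑ * ‖z - z₀‖ₑ)⁻¹
        ≤ (‖a‖ₑ + (‖a‖ₑ * ‖z - z₀‖ₑ + ‖a‖ₑ * ‖z‖ₑ)) * (‖a‖ₑ * ‖z - z₀‖ₑ)⁻¹ := by gcongr
      _ = (‖a‖ₑ * ‖z - z₀‖ₑ) * (‖a‖ₑ * ‖z - z₀‖ₑ)⁻¹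
            + (1 + ‖z‖ₑ) * (‖a‖ₑ * (‖a‖ₑ * ‖z - z₀‖ₑ)⁻¹) := by ring
      _ = 1 + (1 + ‖z‖ₑ) * ‖z - z₀‖ₑ⁻¹ := by
          rw [ENNReal.mul_inv_cancel hmul hmul', ENNReal.mul_inv (Or.inl hane) (Or.inr hne),
            ← mul_assoc ‖a‖ₑ, ENNReal.mul_inv_cancel hane (by simp), one_mul]
  have hint : (‖a‖ₑ + ‖b‖ₑ) * ∫⁻ z, ‖a * z + b‖ₑ⁻¹ ∂stdComplexGaussian ≤ 1 + A := by
    rw [← lintegral_const_mul _ (by fun_prop)]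
    refine (lintegral_mono hpt).trans ?_
    rw [lintegral_add_left measurable_const]
    simpa using h z₀
  have hab : ‖a‖ₑ + ‖b‖ₑ ≠ 0 := by simp [ha]
  have hab' : ‖a‖ₑ + ‖b‖ₑ ≠ ∞ := by simp
  have hav : ‖a * v + b‖ₑ ≤ ‖a‖ₑ + ‖b‖ₑ := by
    refine (enorm_add_le _ _).trans ?_
    gcongr
    rw [enorm_mul]
    refine mul_le_of_le_one_right zero_le ?_
    rw [← ofReal_norm, ← ENNReal.ofReal_one]
    exact ENNReal.ofReal_le_ofReal hv
  calc ∫⁻ z, ‖a * z + b‖ₑ⁻¹ ∂stdComplexGaussian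
      = (‖a‖ₑ + ‖b‖ₑ)⁻¹ * ((‖a‖ₑ + ‖b‖ₑ) * ∫⁻ z, ‖a * z + b‖ₑ⁻¹ ∂stdComplexGaussian) := by
        rw [← mul_assoc, ENNReal.inv_mul_cancel hab hab', one_mul]
    _ ≤ (‖a * v + b‖ₑ)⁻¹ * (1 + A) := by
        gcongr
    _ = _ := mul_comm _ _

end Gaussian

end LimitedFeedback

namespace LimitedFeedback

open scoped ENNReal

set_option linter.unusedSectionVars false

/-! ### Measurability of matrix operations. -/

section Measurability

variable {α : Type*} [MeasurableSpace α] {l m n : Type*} [Fintype l] [Fintype m] [Fintype n]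
  [DecidableEq m] [DecidableEq n]

theorem measurable_matrix_iff {f : α → Matrix m n ℂ} :
    Measurable f ↔ ∀ i j, Measurable fun a => f a i j := by
  refine ⟨fun h i j => (measurable_pi_iff.1 (measurable_pi_iff.1 h i)) j, fun h => ?_⟩
  exact measurable_pi_iff.2 fun i => measurable_pi_iff.2 fun j => h i j

theorem _root_.Measurable.matrix_apply {f : α → Matrix m n ℂ} (h : Measurable f) (i : m) (j : n) :
    Measurable fun a => f a i j :=
  measurable_matrix_iff.1 h i j

theorem _root_.Measurable.matrix_mul {f : α → Matrix l m ℂ} {g : α → Matrix m n ℂ} (hf : Measurable f)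
    (hg : Measurable g) : Measurable fun a => f a * g a := by
  refine measurable_pi_iff.2 fun i => measurable_pi_iff.2 fun j => ?_
  simp only [mul_apply]
  exact Finset.measurable_sum _ fun k _ =>
    (measurable_pi_iff.1 (measurable_pi_iff.1 hf i) k).mul
      (measurable_pi_iff.1 (measurable_pi_iff.1 hg k) j)

theorem _root_.Measurable.matrix_add {f g : α → Matrix m n ℂ} (hf : Measurable f) (hg : Measurable g) :
    Measurable fun a => f a + g a :=
  measurable_matrix_iff.2 fun i j => (hf.matrix_apply i j).add (hg.matrix_apply i j)

theorem _root_.Measurable.matrix_sub {f g : α → Matrix m n ℂ} (hf : Measurable f) (hg : Measurable g) :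
    Measurable fun a => f a - g a :=
  measurable_matrix_iff.2 fun i j => (hf.matrix_apply i j).sub (hg.matrix_apply i j)

theorem _root_.Measurable.matrix_sum {ι : Type*} {s : Finset ι} {f : ι → α → Matrix m n ℂ}
    (hf : ∀ i, Measurable (f i)) : Measurable fun a => ∑ i ∈ s, f i a := by
  refine measurable_matrix_iff.2 fun i j => ?_
  simp only [Matrix.sum_apply]
  exact Finset.measurable_sum _ fun k _ => (hf k).matrix_apply i j

theorem _root_.Measurable.matrix_smul {f : α → Matrix m n ℂ} (hf : Measurable f) (c : ℂ) :
    Measurable fun a => c • f a :=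
  measurable_matrix_iff.2 fun i j => (hf.matrix_apply i j).const_mul c

theorem _root_.Measurable.matrix_conjTranspose {f : α → Matrix m n ℂ} (hf : Measurable f) :
    Measurable fun a => (f a)ᴴ :=
  measurable_matrix_iff.2 fun i j => continuous_star.measurable.comp (hf.matrix_apply j i)

theorem _root_.Measurable.matrix_trace {f : α → Matrix n n ℂ} (hf : Measurable f) :
    Measurable fun a => (f a).trace :=
  Finset.measurable_sum _ fun k _ => hf.matrix_apply k k

theorem _root_.Measurable.matrix_det {f : α → Matrix n n ℂ} (hf : Measurable f) :
    Measurable fun a => (f a).det := by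
  simp only [det_apply]
  exact Finset.measurable_sum _ fun σ _ =>
    (Finset.measurable_prod _ fun i _ => hf.matrix_apply _ _).const_smul _

theorem _root_.Measurable.matrix_inv {f : α → Matrix n n ℂ} (hf : Measurable f) :
    Measurable fun a => (f a)⁻¹ := by
  refine measurable_matrix_iff.2 fun i j => ?_
  simp only [inv_def, Ring.inverse_eq_inv', Matrix.smul_apply, smul_eq_mul, adjugate_apply]
  refine (Measurable.matrix_det hf).inv.mul (Measurable.matrix_det ?_)
  refine measurable_matrix_iff.2 fun i' j' => ?_
  by_cases h : i' = j
  · subst h; simp only [updateRow_self]; exact measurable_const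
  · simp only [updateRow_ne h]; exact hf.matrix_apply _ _

theorem _root_.Measurable.colProj {f : α → Matrix m n ℂ} (hf : Measurable f) :
    Measurable fun a => colProj (f a) :=
  ((hf.matrix_mul (hf.matrix_conjTranspose.matrix_mul hf).matrix_inv).matrix_mul
    hf.matrix_conjTranspose)

end Measurability

/-! ### Gaussian matrices: inverse moments of minors and unitary invariance. -/

section GaussianMatrix

variable {l m n : Type*} [Fintype l] [Fintype m] [Fintype n]
  [DecidableEq l] [DecidableEq m] [DecidableEq n]

/-- Law of a matrix with i.i.d. standard complex Gaussian entries. -/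
noncomputable def gaussianMatrix (m n : Type*) [Fintype m] [Fintype n] : Measure (Matrix m n ℂ) :=
  (Measure.pi fun _ : m × n => stdComplexGaussian).map fun g => of fun a b => g (a, b)

theorem measurable_matrixOfUncurried :
    Measurable fun g : m × n → ℂ => (of fun a b => g (a, b) : Matrix m n ℂ) :=
  measurable_matrix_iff.2 fun i j => measurable_pi_apply (i, j)

instance : IsProbabilityMeasure (gaussianMatrix m n) :=
  Measure.isProbabilityMeasure_map measurable_matrixOfUncurried.aemeasurable

/-- An entry of `G` in column `j` enters only column `j` of `L G`, and the determinant is linear in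
each column. This lets the scalar anti-concentration bound be applied entry by entry. -/
theorem exists_det_mul_update_eq (L : Matrix n m ℂ) (g : m × n → ℂ) (p : m × n) :
    ∃ α β : ℂ, ∀ x, (L * (of fun a b => Function.update g p x (a, b) : Matrix m n ℂ)).det
      = α * x + β := by
  set W : Matrix n n ℂ := L * (of fun a b => Function.update g p 0 (a, b) : Matrix m n ℂ)
  refine ⟨(W.updateCol p.2 fun i => L i p.1).det, W.det, fun x => ?_⟩
  have h : L * (of fun a b => Function.update g p x (a, b) : Matrix m n ℂ)
      = W.updateCol p.2 ((fun i => W i p.2) + x • fun i => L i p.1) := by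
    ext i j
    have hsplit : ∀ a, Function.update g p x (a, j)
        = Function.update g p 0 (a, j) + if (a, j) = p then x else 0 := by
      intro a
      by_cases h : (a, j) = p <;> simp [h]
    by_cases hj : j = p.2
    · subst hj
      rw [updateCol_self, mul_apply]
      simp only [of_apply, hsplit, mul_add, Finset.sum_add_distrib, Pi.add_apply, Pi.smul_apply,
        smul_eq_mul, W, mul_apply, add_right_inj]
      have : ∀ a, ((a, p.2) = p) = (a = p.1) := fun a => by
        rw [Prod.ext_iff]; simp
      simp only [this, mul_ite, mul_zero, Finset.sum_ite_eq', Finset.mem_univ, if_true, mul_comm]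
    · rw [updateCol_ne hj, mul_apply]
      have : ∀ a, ((a, j) = p) = False := fun a => by
        rw [Prod.ext_iff]; simp [hj]
      simp only [of_apply, hsplit, W, mul_apply, this, if_false, add_zero]
  rw [h, det_updateCol_add, det_updateCol_smul]
  have h' : (W.updateCol p.2 fun i => W i p.2) = W := by
    ext i j
    by_cases hj : j = p.2
    · subst hj; simp
    · simp [updateCol_ne hj]
  rw [h']
  ring

theorem norm_apply_le_one_of_orthonormal {V : Matrix m n ℂ} (hV : Vᴴ * V = 1) (i : m) (j : n) :
    ‖V i j‖ ≤ 1 := by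
  have h := congrFun (congrFun hV j) j
  rw [mul_apply, one_apply_eq] at h
  have h2 : ∑ a, ‖V a j‖ ^ 2 = 1 := by
    have : ∀ a, Vᴴ j a * V a j = ((‖V a j‖ ^ 2 : ℝ) : ℂ) := fun a => by
      rw [conjTranspose_apply, RCLike.star_def, Complex.conj_mul']; norm_cast
    simp only [this] at h
    exact_mod_cast h
  have h3 := Finset.single_le_sum (f := fun a => ‖V a j‖ ^ 2) (fun a _ => by positivity)
    (Finset.mem_univ i)
  simp only [h2] at h3
  exact (sq_le_one_iff₀ (norm_nonneg _)).1 h3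

/-- For a Gaussian matrix `G` the expectation of `|det (Vᴴ G)|⁻¹` is bounded uniformly in the
semi-unitary matrix `V`. -/
theorem exists_lintegral_inv_det_le (m n : Type*) [Fintype m] [Fintype n] [DecidableEq m]
    [DecidableEq n] :
    ∃ A : ℝ≥0∞, A ≠ ∞ ∧ ∀ V : Matrix m n ℂ, Vᴴ * V = 1 →
      ∫⁻ G, ‖(Vᴴ * G).det‖ₑ⁻¹ ∂gaussianMatrix m n ≤ A := by
  obtain ⟨A, hA, h⟩ := exists_lintegral_inv_affine_le
  refine ⟨A ^ Fintype.card (m × n), ENNReal.pow_ne_top hA, fun V hV => ?_⟩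
  have hm : Measurable fun G : Matrix m n ℂ => ‖(Vᴴ * G).det‖ₑ⁻¹ :=
    ((measurable_const.matrix_mul measurable_id).matrix_det).enorm.inv
  rw [gaussianMatrix, lintegral_map hm measurable_matrixOfUncurried]
  -- The reference point is `G = V`: its entries have modulus at most `1`, and there the determinant
  -- is `det(Vᴴ V) = 1`, whence a bound without `V`.
  have key := lintegral_pi_le_pow_mul (fun _ : m × n => stdComplexGaussian)
    (hm.comp measurable_matrixOfUncurried) (fun p => V p.1 p.2) A ?_
  · refine key.trans (le_of_eq ?_)
    have : (of fun a b => V a b : Matrix m n ℂ) = V := rfl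
    simp [this, hV]
  · intro c k
    obtain ⟨α, β, hαβ⟩ := exists_det_mul_update_eq Vᴴ c k
    simp only [Function.comp_apply, hαβ]
    exact h α β _ (norm_apply_le_one_of_orthonormal hV _ _)

theorem ae_det_conjTranspose_mul_ne_zero {V : Matrix m n ℂ} (hV : Vᴴ * V = 1) :
    ∀ᵐ G ∂gaussianMatrix m n, (Vᴴ * G).det ≠ 0 := by
  obtain ⟨A, hA, h⟩ := exists_lintegral_inv_det_le m n
  have hm : Measurable fun G : Matrix m n ℂ => ‖(Vᴴ * G).det‖ₑ⁻¹ :=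
    ((measurable_const.matrix_mul measurable_id).matrix_det).enorm.inv
  filter_upwards [ae_lt_top hm (ne_top_of_le_ne_top hA (h V hV))] with G hG h0
  simp [h0] at hG

/-! ### Unitary invariance -/

theorem charFun_stdComplexGaussian (t : ℂ) :
    charFun stdComplexGaussian t = Complex.exp (-(‖t‖ ^ 2 / 4 : ℝ)) := by
  have h : ∀ p : ℝ × ℝ, Complex.exp (inner ℝ (Complex.measurableEquivRealProd.symm p) t * Complex.I)
      = Complex.exp (inner ℝ p.1 t.re * Complex.I) * Complex.exp (inner ℝ p.2 t.im * Complex.I) := by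
    intro p
    rw [← Complex.exp_add, ← add_mul, ← Complex.ofReal_add]
    congr 3
    simp [Complex.inner, Complex.measurableEquivRealProd]
  rw [charFun_apply, stdComplexGaussian, integral_map_equiv]
  simp only [h]
  rw [integral_prod_mul (fun x : ℝ => Complex.exp (inner ℝ x t.re * Complex.I))
    (fun x : ℝ => Complex.exp (inner ℝ x t.im * Complex.I)), ← charFun_apply, ← charFun_apply,
    charFun_gaussianReal, charFun_gaussianReal, ← Complex.exp_add, ← Complex.normSq_eq_norm_sq,
    Complex.normSq_apply]
  congr 1
  push_cast
  ring

/-- The characteristic function depends on the norm of its argument only, so a map with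
norm-preserving adjoint `T'` preserves the law. Stating this through the adjoint covers left and
right multiplication of matrices at once. -/
theorem map_pi_stdComplexGaussian_eq {ι : Type*} [Fintype ι] {T : (ι → ℂ) → ι → ℂ}
    {T' : (ι → ℂ) → ι → ℂ} (hT : Measurable T)
    (hadj : ∀ x t, star (T x) ⬝ᵥ t = star x ⬝ᵥ T' t)
    (hnorm : ∀ t, star (T' t) ⬝ᵥ T' t = star t ⬝ᵥ t) :
    (Measure.pi fun _ : ι => stdComplexGaussian).map T
      = Measure.pi fun _ : ι => stdComplexGaussian := by
  have : IsProbabilityMeasure ((Measure.pi fun _ : ι => stdComplexGaussian).map T) :=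
    Measure.isProbabilityMeasure_map hT.aemeasurable
  have hcf : ∀ t : PiLp 2 fun _ : ι => ℂ,
      charFun ((Measure.pi fun _ : ι => stdComplexGaussian).map (WithLp.toLp 2)) t
        = Complex.exp (-((star (WithLp.ofLp t) ⬝ᵥ WithLp.ofLp t).re / 4 : ℝ)) := by
    intro t
    rw [charFun_pi]
    simp only [charFun_stdComplexGaussian, ← Complex.exp_sum]
    congr 1
    rw [Finset.sum_neg_distrib, ← Complex.ofReal_sum, ← Finset.sum_div]
    congr 3
    simp only [dotProduct, Complex.re_sum, Pi.star_apply, RCLike.star_def, Complex.conj_mul']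
    refine Finset.sum_congr rfl fun i _ => ?_
    norm_cast
  have hinner : ∀ x t : ι → ℂ, inner ℝ (WithLp.toLp 2 x : PiLp 2 fun _ : ι => ℂ) (WithLp.toLp 2 t)
      = (star x ⬝ᵥ t).re := by
    intro x t
    rw [PiLp.inner_apply]
    simp only [dotProduct, Complex.re_sum]
    refine Finset.sum_congr rfl fun i _ => ?_
    simp [Complex.inner, mul_comm]
  refine charFun_eq_pi_iff.1 fun t => ?_
  rw [← charFun_pi, hcf, ← hnorm]
  have h2 := hcf (WithLp.toLp 2 (T' (WithLp.ofLp t)))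
  rw [← h2, charFun_apply, charFun_apply, integral_map (by fun_prop) (by fun_prop),
    integral_map hT.aemeasurable (by fun_prop), integral_map (by fun_prop) (by fun_prop)]
  congr 1
  ext x
  have h3 := hinner (T x) (WithLp.ofLp t)
  rw [hadj, ← hinner] at h3
  rw [← h3]

theorem star_dotProduct_uncurry (A B : Matrix m n ℂ) :
    (star fun p : m × n => A p.1 p.2) ⬝ᵥ (fun p => B p.1 p.2) = (Aᴴ * B).trace := by
  simp only [dotProduct, trace, diag_apply, mul_apply, conjTranspose_apply, Fintype.sum_prod_type,
    Pi.star_apply]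
  exact Finset.sum_comm

theorem map_gaussianMatrix_eq {T T' : Matrix m n ℂ → Matrix m n ℂ} (hT : Measurable T)
    (hadj : ∀ A B, ((T A)ᴴ * B).trace = (Aᴴ * T' B).trace)
    (hnorm : ∀ B, ((T' B)ᴴ * T' B).trace = (Bᴴ * B).trace) :
    (gaussianMatrix m n).map T = gaussianMatrix m n := by
  let c : (m × n → ℂ) → Matrix m n ℂ := fun g => of fun a b => g (a, b)
  let d : Matrix m n ℂ → m × n → ℂ := fun A p => A p.1 p.2
  have hd : Measurable d := measurable_pi_iff.2 fun p => measurable_id.matrix_apply p.1 p.2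
  have hcd : ∀ A, c (d A) = A := fun A => rfl
  have hc : Measurable c := measurable_matrixOfUncurried
  have key := map_pi_stdComplexGaussian_eq (T := fun g => d (T (c g)))
    (T' := fun g => d (T' (c g))) (hd.comp (hT.comp hc))
    (fun x t => by
      have h1 := star_dotProduct_uncurry (T (c x)) (c t)
      have h2 := star_dotProduct_uncurry (c x) (T' (c t))
      rw [hadj, ← h2] at h1
      exact h1)
    (fun t => by
      have h1 := star_dotProduct_uncurry (T' (c t)) (T' (c t))
      have h2 := star_dotProduct_uncurry (c t) (c t)
      rw [hnorm, ← h2] at h1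
      exact h1)
  change ((Measure.pi fun _ : m × n => stdComplexGaussian).map c).map T
    = (Measure.pi fun _ : m × n => stdComplexGaussian).map c
  rw [Measure.map_map hT hc]
  have key' := congrArg (Measure.map c) key
  rw [Measure.map_map (f := fun g => d (T (c g))) hc (hd.comp (hT.comp hc))] at key'
  exact key'

theorem map_unitary_mul_gaussianMatrix {U : Matrix m m ℂ} (hU : U ∈ unitaryGroup m ℂ) :
    (gaussianMatrix m n).map (fun G => U * G) = gaussianMatrix m n := by
  rw [mem_unitaryGroup_iff, star_eq_conjTranspose] at hU
  refine map_gaussianMatrix_eq (T' := fun B => Uᴴ * B)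
    (measurable_const.matrix_mul measurable_id) (fun A B => ?_) fun B => ?_
  · rw [conjTranspose_mul, Matrix.mul_assoc]
  · rw [conjTranspose_mul, conjTranspose_conjTranspose, Matrix.mul_assoc, ← Matrix.mul_assoc U, hU,
      Matrix.one_mul]

theorem map_mul_unitary_gaussianMatrix {U : Matrix n n ℂ} (hU : U ∈ unitaryGroup n ℂ) :
    (gaussianMatrix m n).map (fun G => G * U) = gaussianMatrix m n := by
  have hU' := (mem_unitaryGroup_iff'.1 hU)
  rw [star_eq_conjTranspose] at hU'
  refine map_gaussianMatrix_eq (T' := fun B => B * Uᴴ)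
    (measurable_id.matrix_mul measurable_const) (fun A B => ?_) fun B => ?_
  · rw [conjTranspose_mul, Matrix.mul_assoc, trace_mul_comm, Matrix.mul_assoc]
  · rw [conjTranspose_mul, conjTranspose_conjTranspose, Matrix.mul_assoc, trace_mul_comm,
      Matrix.mul_assoc, Matrix.mul_assoc, hU', Matrix.mul_one]

end GaussianMatrix

end LimitedFeedback

namespace LimitedFeedback

open scoped ENNReal

set_option linter.unusedSectionVars false

/-! ### Conditioning on coordinates by resampling the others. -/

section Resampling

variable {Ω S X : Type*} [MeasurableSpace Ω] [Fintype S] [MeasurableSpace X]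
  {P : Measure Ω} [IsProbabilityMeasure P] {Y : Ω → S → X}

/-- Resample the coordinates outside `T`. -/
def mix (T : S → Prop) [DecidablePred T] (x y : S → X) : S → X := fun s => if T s then x s else y s

variable (T : S → Prop) [DecidablePred T]

theorem measurable_mix : Measurable fun p : (S → X) × (S → X) => mix T p.1 p.2 := by
  refine measurable_pi_iff.2 fun s => ?_
  by_cases h : T s
  · simp only [mix, h, if_true]; fun_prop
  · simp only [mix, h, if_false]; fun_prop

theorem measurable_mix_comp (hY : Measurable Y) :
    Measurable fun p : Ω × Ω => mix T (Y p.1) (Y p.2) :=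
  (measurable_mix T).comp ((hY.comp measurable_fst).prodMk (hY.comp measurable_snd))

theorem map_mix_pi (μ : S → Measure X) [∀ s, IsProbabilityMeasure (μ s)] :
    ((Measure.pi μ).prod (Measure.pi μ)).map (fun p => mix T p.1 p.2) = Measure.pi μ := by
  refine (Measure.pi_eq fun A hA => ?_).symm
  rw [Measure.map_apply (measurable_mix T) (MeasurableSet.univ_pi hA)]
  have : (fun p : (S → X) × (S → X) => mix T p.1 p.2) ⁻¹' Set.univ.pi A
      = (Set.univ.pi fun s => if T s then A s else Set.univ) ×ˢ
        (Set.univ.pi fun s => if T s then Set.univ else A s) := by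
    ext p
    simp only [Set.mem_preimage, Set.mem_univ_pi, Set.mem_prod, mix]
    rw [← forall_and]
    refine forall_congr' fun s => ?_
    by_cases h : T s <;> simp [h]
  rw [this, Measure.prod_prod, Measure.pi_pi, Measure.pi_pi, ← Finset.prod_mul_distrib]
  refine Finset.prod_congr rfl fun s _ => ?_
  by_cases h : T s <;> simp [h]

/-- For independent coordinates, redrawing those outside `T` from an independent copy leaves the
joint law unchanged. This is the form conditioning takes below: the outer variable `ω'` carries the
frozen coordinates, the inner variable `ω` the random ones. -/
theorem map_mix (hY : Measurable Y) (hind : iIndepFun (fun s ω => Y ω s) P) :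
    (P.prod P).map (fun p => mix T (Y p.1) (Y p.2)) = P.map Y := by
  have hYs : ∀ s, Measurable fun ω => Y ω s := fun s => (measurable_pi_apply s).comp hY
  have hlaw : P.map Y = Measure.pi fun s => P.map fun ω => Y ω s :=
    hind.map_fun_eq_pi_map fun s => (hYs s).aemeasurable
  have : ∀ s, IsProbabilityMeasure (P.map fun ω => Y ω s) := fun s =>
    Measure.isProbabilityMeasure_map (hYs s).aemeasurable
  have h := map_mix_pi T fun s => P.map fun ω => Y ω s
  rw [← hlaw, Measure.map_prod_map _ _ hY hY,
    Measure.map_map (measurable_mix T) (hY.prodMap hY)] at h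
  exact h

theorem ae_of_ae_mix (hY : Measurable Y) (hind : iIndepFun (fun s ω => Y ω s) P)
    {p : (S → X) → Prop} (hp : MeasurableSet {x | p x})
    (h : ∀ ω', ∀ᵐ ω ∂P, p (mix T (Y ω') (Y ω))) : ∀ᵐ ω ∂P, p (Y ω) := by
  rw [← ae_map_iff hY.aemeasurable hp, ← map_mix T hY hind,
    ae_map_iff (measurable_mix_comp T hY).aemeasurable hp,
    Measure.ae_prod_iff_ae_ae (p := fun z : Ω × Ω => p (mix T (Y z.1) (Y z.2)))
      (measurable_mix_comp T hY hp)]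
  exact ae_of_all _ h

theorem ae_mix_of_ae (hY : Measurable Y) (hind : iIndepFun (fun s ω => Y ω s) P)
    {p : (S → X) → Prop} (hp : MeasurableSet {x | p x}) (h : ∀ᵐ ω ∂P, p (Y ω)) :
    ∀ᵐ ω' ∂P, ∀ᵐ ω ∂P, p (mix T (Y ω') (Y ω)) := by
  rw [← ae_map_iff hY.aemeasurable hp, ← map_mix T hY hind,
    ae_map_iff (measurable_mix_comp T hY).aemeasurable hp,
    Measure.ae_prod_iff_ae_ae (p := fun z : Ω × Ω => p (mix T (Y z.1) (Y z.2)))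
      (measurable_mix_comp T hY hp)] at h
  exact h

theorem lintegral_mix (hY : Measurable Y) (hind : iIndepFun (fun s ω => Y ω s) P)
    {F : (S → X) → ℝ≥0∞} (hF : Measurable F) :
    ∫⁻ ω, F (Y ω) ∂P = ∫⁻ ω', ∫⁻ ω, F (mix T (Y ω') (Y ω)) ∂P ∂P := by
  rw [← lintegral_map hF hY, ← map_mix T hY hind, lintegral_map hF (measurable_mix_comp T hY),
    lintegral_prod (fun p : Ω × Ω => F (mix T (Y p.1) (Y p.2)))
      (hF.comp (measurable_mix_comp T hY)).aemeasurable]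

theorem integral_mix {E : Type*} [NormedAddCommGroup E] [NormedSpace ℝ E]
    [MeasurableSpace E] [BorelSpace E] [SecondCountableTopology E]
    (hY : Measurable Y) (hind : iIndepFun (fun s ω => Y ω s) P)
    {F : (S → X) → E} (hF : Measurable F) (hint : Integrable (fun ω => F (Y ω)) P) :
    ∫ ω, F (Y ω) ∂P = ∫ ω', ∫ ω, F (mix T (Y ω') (Y ω)) ∂P ∂P := by
  have hF' : ∀ ν : Measure (S → X), AEStronglyMeasurable F ν := fun ν => hF.aestronglyMeasurable
  have h1 : Integrable F (P.map Y) :=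
    (integrable_map_measure (hF' _) hY.aemeasurable).2 hint
  rw [← map_mix T hY hind] at h1
  have h2 := (integrable_map_measure (hF' _) (measurable_mix_comp T hY).aemeasurable).1 h1
  rw [← integral_map hY.aemeasurable (hF' _), ← map_mix T hY hind,
    integral_map (measurable_mix_comp T hY).aemeasurable (hF' _), integral_prod (fun p : Ω × Ω => F (mix T (Y p.1) (Y p.2))) h2]

omit [DecidablePred T] in
/-- Applying law-preserving maps to independent coordinates does not change the joint law. -/
theorem map_coordinatewise (hY : Measurable Y) (hind : iIndepFun (fun s ω => Y ω s) P)
    {φ : S → X → X} (hφ : ∀ s, Measurable (φ s))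
    (h : ∀ s, (P.map fun ω => Y ω s).map (φ s) = P.map fun ω => Y ω s) :
    P.map (fun ω s => φ s (Y ω s)) = P.map Y := by
  have hYs : ∀ s, Measurable fun ω => Y ω s := fun s => (measurable_pi_apply s).comp hY
  have h2 := hind.comp φ hφ
  have hlaw : P.map Y = Measure.pi fun s => P.map fun ω => Y ω s :=
    hind.map_fun_eq_pi_map fun s => (hYs s).aemeasurable
  have hlaw2 := h2.map_fun_eq_pi_map fun s => ((hφ s).comp (hYs s)).aemeasurable
  rw [hlaw]
  refine hlaw2.trans ?_
  congr 1
  ext1 s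
  rw [← h s, Measure.map_map (hφ s) (hYs s)]

omit [DecidablePred T] in
theorem integral_coordinatewise {E : Type*} [NormedAddCommGroup E] [NormedSpace ℝ E]
    [MeasurableSpace E] [BorelSpace E] [SecondCountableTopology E]
    (hY : Measurable Y) (hind : iIndepFun (fun s ω => Y ω s) P)
    {φ : S → X → X} (hφ : ∀ s, Measurable (φ s))
    (h : ∀ s, (P.map fun ω => Y ω s).map (φ s) = P.map fun ω => Y ω s)
    {F : (S → X) → E} (hF : Measurable F) :
    ∫ ω, F (fun s => φ s (Y ω s)) ∂P = ∫ ω, F (Y ω) ∂P := by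
  have hYs : ∀ s, Measurable fun ω => Y ω s := fun s => (measurable_pi_apply s).comp hY
  have hm : Measurable fun ω s => φ s (Y ω s) :=
    measurable_pi_iff.2 fun s => (hφ s).comp (hYs s)
  rw [← integral_map hm.aemeasurable hF.aestronglyMeasurable, map_coordinatewise hY hind hφ h,
    integral_map hY.aemeasurable hF.aestronglyMeasurable]

end Resampling

/-! ### Entrywise expectations of random matrices. -/

section MatrixExpectation

variable {Ω : Type*} [MeasurableSpace Ω] {P : Measure Ω} {m n : Type*} [Fintype m] [Fintype n]
  [DecidableEq m] [DecidableEq n]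

/-- Entrywise expectation of a random matrix. -/
noncomputable def matExp (P : Measure Ω) (X : Ω → Matrix m n ℂ) : Matrix m n ℂ :=
  of fun a b => ∫ ω, X ω a b ∂P

theorem matExp_mul_left {l : Type*} [Fintype l] {X : Ω → Matrix m n ℂ}
    (hX : ∀ a b, Integrable (fun ω => X ω a b) P) (A : Matrix l m ℂ) :
    matExp P (fun ω => A * X ω) = A * matExp P X := by
  ext a b
  simp only [matExp, mul_apply, of_apply]
  rw [integral_finsetSum _ fun c _ => (hX c b).const_mul _]
  simp only [integral_const_mul]

theorem matExp_mul_right {l : Type*} [Fintype l] {X : Ω → Matrix m n ℂ}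
    (hX : ∀ a b, Integrable (fun ω => X ω a b) P) (A : Matrix n l ℂ) :
    matExp P (fun ω => X ω * A) = matExp P X * A := by
  ext a b
  simp only [matExp, mul_apply, of_apply]
  rw [integral_finsetSum _ fun c _ => (hX a c).mul_const _]
  simp only [integral_mul_const]

theorem trace_matExp {X : Ω → Matrix n n ℂ} (hX : ∀ a b, Integrable (fun ω => X ω a b) P) :
    (matExp P X).trace = ∫ ω, (X ω).trace ∂P := by
  simp only [matExp, trace, diag_apply, of_apply]
  rw [integral_finsetSum _ fun c _ => hX c c]

theorem integrable_mul_left {l : Type*} [Fintype l] {X : Ω → Matrix m n ℂ}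
    (hX : ∀ a b, Integrable (fun ω => X ω a b) P) (A : Matrix l m ℂ) (a : l) (b : n) :
    Integrable (fun ω => (A * X ω) a b) P := by
  simp only [mul_apply]
  exact integrable_finsetSum _ fun c _ => (hX c b).const_mul _

theorem integrable_mul_right {l : Type*} [Fintype l] {X : Ω → Matrix m n ℂ}
    (hX : ∀ a b, Integrable (fun ω => X ω a b) P) (A : Matrix n l ℂ) (a : m) (b : l) :
    Integrable (fun ω => (X ω * A) a b) P := by
  simp only [mul_apply]
  exact integrable_finsetSum _ fun c _ => (hX a c).mul_const _

theorem matExp_conj {l : Type*} [Fintype l] [DecidableEq l] {X : Ω → Matrix m n ℂ}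
    (hX : ∀ a b, Integrable (fun ω => X ω a b) P) (A : Matrix l m ℂ) {k : Type*} [Fintype k]
    (B : Matrix n k ℂ) : matExp P (fun ω => A * X ω * B) = A * matExp P X * B := by
  rw [matExp_mul_right (integrable_mul_left hX A), matExp_mul_left hX]

/-- A random matrix whose mean is invariant under conjugation by the reflections in the range of
a projector has a mean that acts as a scalar on that range. -/
theorem exists_matExp_mul_eq_smul {X : Ω → Matrix m m ℂ} {Q : Matrix m m ℂ} (hQ : Q * Q = Q) (hQh : Qᴴ = Q)
    (h : ∀ U ∈ unitaryGroup m ℂ, (∀ v : m → ℂ, Q *ᵥ v = 0 → U *ᵥ v = v) → U * Q = Q * U →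
      matExp P X = U * matExp P X * Uᴴ) :
    ∃ a : ℂ, matExp P X * Q = a • Q := by
  refine exists_smul_of_commute_reflections (fun u hu hQu => ?_) hQ
  have hU := reflection_mem_unitaryGroup hu
  set U := 1 - (2 : ℂ) • vecMulVec u (star u)
  have hsu : star u ᵥ* Q = star u := by
    have := congrArg star hQu
    rwa [star_mulVec, hQh] at this
  have h1 := h U hU (fun v hv => by
      have : star u ⬝ᵥ v = 0 := by
        rw [← hsu, ← dotProduct_mulVec, hv, dotProduct_zero]
      rw [Matrix.sub_mulVec, one_mulVec, smul_mulVec, vecMulVec_mulVec, this]; simp)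
    (by
      simp only [U, Matrix.sub_mul, Matrix.mul_sub, Matrix.one_mul, Matrix.mul_one,
        Matrix.smul_mul, Matrix.mul_smul, vecMulVec_mul, mul_vecMulVec, hsu, hQu])
  have h2 : Uᴴ * U = 1 := mem_unitaryGroup_iff'.1 hU
  conv_rhs => rw [h1]
  rw [Matrix.mul_assoc, h2, Matrix.mul_one]

end MatrixExpectation

end LimitedFeedback

namespace LimitedFeedback

open scoped ENNReal ComplexOrder

set_option linter.unusedSectionVars false

/-! ### Sums of Gram blocks and biorthogonality. -/

section GramSum

variable {m n κ : Type*} [Fintype m] [Fintype n] [Fintype κ]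
  [DecidableEq m] [DecidableEq n] [DecidableEq κ]

theorem posSemidef_sum_mul_conjTranspose (D : κ → Matrix m n ℂ) :
    (∑ j, D j * (D j)ᴴ).PosSemidef :=
  posSemidef_sum _ fun j _ => posSemidef_self_mul_conjTranspose (D j)

/-- If blocks of complementary sizes together span the space, then they are biorthogonal to the
blocks `S⁻¹ D_j`. -/
theorem conjTranspose_mul_inv_mul {D : κ → Matrix m n ℂ}
    (hcard : Fintype.card m = Fintype.card κ * Fintype.card n)
    (hS : IsUnit (∑ j, D j * (D j)ᴴ).det) (i j : κ) :
    (D i)ᴴ * ((∑ j, D j * (D j)ᴴ)⁻¹ * D j) = if i = j then 1 else 0 := by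
  set S := ∑ j, D j * (D j)ᴴ
  let F : Matrix m (κ × n) ℂ := of fun a p => D p.1 a p.2
  have hF : F * Fᴴ = S := by
    ext a b
    simp only [F, S, mul_apply, Matrix.sum_apply, Fintype.sum_prod_type, conjTranspose_apply,
      of_apply]
  have h1 : F * (Fᴴ * S⁻¹) = 1 := by rw [← Matrix.mul_assoc, hF, mul_nonsing_inv _ hS]
  -- The concatenation `F` of all blocks is square by the cardinality hypothesis, so its right
  -- inverse is a left inverse.
  have h2 : Fᴴ * S⁻¹ * F = 1 :=
    (Matrix.mul_eq_one_comm_of_card_eq _ _ _ (by simp [hcard])).1 h1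
  ext a b
  have h3 := congrFun (congrFun h2 (i, a)) (j, b)
  rw [← Matrix.mul_assoc]
  have h4 : ((D i)ᴴ * S⁻¹ * D j) a b = (Fᴴ * S⁻¹ * F) (i, a) (j, b) := by
    simp only [mul_apply, conjTranspose_apply, F, of_apply]
  rw [h4, h3]
  by_cases h : i = j
  · subst h; simp [one_apply]
  · simp [one_apply, h]

/-- A null vector `v` of the new sum is killed by `xᴴ` and by every `(c j)ᴴ` with `j ≠ k`. Then `S v
= d dᴴ v`, hence `v = S⁻¹ d (dᴴ v)`, and `xᴴ v = 0` forces `dᴴ v = 0` as soon as `dᴴ S⁻¹ x` is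
nonsingular. -/
theorem isUnit_gramSum_update {c : κ → Matrix m n ℂ} {k : κ} {d x : Matrix m n ℂ}
    (hS : IsUnit (∑ j, Function.update c k d j * (Function.update c k d j)ᴴ).det)
    (hx : ((dᴴ * (∑ j, Function.update c k d j * (Function.update c k d j)ᴴ)⁻¹) * x).det ≠ 0) :
    (∑ j, Function.update c k x j * (Function.update c k x j)ᴴ).det ≠ 0 := by
  set S := ∑ j, Function.update c k d j * (Function.update c k d j)ᴴ with hSdef
  have hps := posSemidef_sum_mul_conjTranspose (Function.update c k x)
  have hSh : Sᴴ = S := (posSemidef_sum_mul_conjTranspose (Function.update c k d)).1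
  rw [← hps.posDef_iff_det_ne_zero]
  refine PosDef.of_dotProduct_mulVec_pos hps.1 fun v hv => ?_
  refine lt_of_le_of_ne (hps.dotProduct_mulVec_nonneg v) fun h0 => hv ?_
  have h1 : ∀ j, (Function.update c k x j)ᴴ *ᵥ v = 0 := by
    have e : star v ⬝ᵥ (∑ j, Function.update c k x j * (Function.update c k x j)ᴴ) *ᵥ v
        = ∑ j, star ((Function.update c k x j)ᴴ *ᵥ v) ⬝ᵥ ((Function.update c k x j)ᴴ *ᵥ v) := by
      rw [sum_mulVec, dotProduct_sum]
      refine Finset.sum_congr rfl fun j _ => ?_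
      rw [← mulVec_mulVec, dotProduct_mulVec, star_mulVec, conjTranspose_conjTranspose]
    rw [e, eq_comm, Finset.sum_eq_zero_iff_of_nonneg fun j _ => dotProduct_star_self_nonneg _] at h0
    intro j
    exact dotProduct_star_self_eq_zero.1 (h0 j (Finset.mem_univ j))
  have hSv : S *ᵥ v = d *ᵥ (dᴴ *ᵥ v) := by
    rw [hSdef, sum_mulVec, Finset.sum_eq_single k]
    · rw [Function.update_self, mulVec_mulVec]
    · intro j _ hj
      have := h1 j
      rw [Function.update_of_ne hj] at this
      rw [Function.update_of_ne hj, ← mulVec_mulVec, this, mulVec_zero]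
    · simp
  have hv' : v = (S⁻¹ * d) *ᵥ (dᴴ *ᵥ v) := by
    rw [← mulVec_mulVec, ← hSv, mulVec_mulVec, nonsing_inv_mul _ hS, one_mulVec]
  have hxv : xᴴ *ᵥ v = 0 := by simpa using h1 k
  have hw : (dᴴ * S⁻¹ * x)ᴴ *ᵥ (dᴴ *ᵥ v) = 0 := by
    rw [conjTranspose_mul, conjTranspose_mul, conjTranspose_conjTranspose,
      conjTranspose_nonsing_inv, hSh, ← mulVec_mulVec, ← hv', hxv]
  have hw' : dᴴ *ᵥ v = 0 := by
    refine eq_zero_of_mulVec_eq_zero ?_ hw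
    rw [det_conjTranspose]
    exact star_ne_zero.2 hx
  rw [hv', hw', mulVec_zero]

end GramSum

/-! ### The random system and its generic position. -/

section System

/-- Index set of all channels and codewords. -/
abbrev Idx (K B : ℕ) := Fin K ⊕ Fin K × Fin (2 ^ B)

variable {Ω : Type*} {N K B : ℕ}

/-- All channels and codewords as one family. -/
def allMat (H : Fin K → Ω → Matrix (Fin (N * K)) (Fin N) ℂ)
    (C : Fin K → Fin (2 ^ B) → Ω → Matrix (Fin (N * K)) (Fin N) ℂ) (ω : Ω) :
    Idx K B → Matrix (Fin (N * K)) (Fin N) ℂ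
  | Sum.inl k => H k ω
  | Sum.inr p => C p.1 p.2 ω

/-- The quantized channels as a function of all channels and codewords. -/
noncomputable def quantizedOf (x : Idx K B → Matrix (Fin (N * K)) (Fin N) ℂ) (k : Fin K) :
    Matrix (Fin (N * K)) (Fin N) ℂ :=
  x (Sum.inr (k, argminIdx fun i => chordalSq (x (Sum.inl k)) (x (Sum.inr (k, i)))))

theorem quantizedOf_congr {x y : Idx K B → Matrix (Fin (N * K)) (Fin N) ℂ} {k : Fin K}
    (h : x (Sum.inl k) = y (Sum.inl k)) (h' : ∀ i, x (Sum.inr (k, i)) = y (Sum.inr (k, i))) :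
    quantizedOf x k = quantizedOf y k := by
  simp only [quantizedOf, h, h']

theorem measurable_argminIdx {α : Type*} [MeasurableSpace α] {n : ℕ} [NeZero n]
    {f : α → Fin n → ℝ} (hf : ∀ i, Measurable fun a => f a i) :
    Measurable fun a => argminIdx (f a) := by
  have hmin : ∀ i, MeasurableSet {a | ∀ j, f a i ≤ f a j} := fun i => by
    simp only [Set.ofPred_forall]
    exact MeasurableSet.iInter fun j => measurableSet_le (hf i) (hf j)
  refine measurable_to_countable' fun i => ?_
  have : (fun a => argminIdx (f a)) ⁻¹' {i}
      = {a | ∀ j, f a i ≤ f a j} ∩ ⋂ i' : {i' // i' < i}, {a | ∀ j, f a i' ≤ f a j}ᶜ := by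
    ext a
    simp only [Set.mem_preimage, Set.mem_singleton_iff, argminIdx, Set.mem_inter_iff,
      Set.mem_ofPred_eq, Set.mem_iInter, Set.mem_compl_iff, Subtype.forall]
    rw [Finset.min'_eq_iff]
    simp only [Finset.mem_filter, Finset.mem_univ, true_and]
    refine and_congr_right fun _ => ⟨fun h i' hi' hm => ?_, fun h i' hm => ?_⟩
    · exact absurd (h i' hm) (not_le.2 hi')
    · by_contra hlt
      exact h i' (not_le.1 hlt) hm
  rw [this]
  exact (hmin i).inter (MeasurableSet.iInter fun i' => (hmin _).compl)

theorem argminIdx_le {n : ℕ} [NeZero n] (f : Fin n → ℝ) (j : Fin n) : f (argminIdx f) ≤ f j := by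
  have := Finset.min'_mem _ (exists_isMin f)
  simp only [Finset.mem_filter, Finset.mem_univ, true_and] at this
  exact this j

theorem iInf_eq_argminIdx {n : ℕ} [NeZero n] (f : Fin n → ℝ) : ⨅ i, f i = f (argminIdx f) :=
  le_antisymm (ciInf_le (Set.finite_range f).bddBelow _) (le_ciInf fun j => argminIdx_le f j)

theorem measurable_chordalSq {α : Type*} [MeasurableSpace α] {M n : ℕ}
    {f g : α → Matrix (Fin M) (Fin n) ℂ} (hf : Measurable f) (hg : Measurable g) :
    Measurable fun a => chordalSq (f a) (g a) := by
  have := (hf.colProj.matrix_mul (hg.matrix_mul hg.matrix_conjTranspose)).matrix_trace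
  exact measurable_const.sub (Complex.measurable_re.comp this)

theorem measurable_quantizedOf (k : Fin K) :
    Measurable fun x : Idx K B → Matrix (Fin (N * K)) (Fin N) ℂ => quantizedOf x k := by
  have h1 : Measurable fun x : Idx K B → Matrix (Fin (N * K)) (Fin N) ℂ =>
      argminIdx fun i => chordalSq (x (Sum.inl k)) (x (Sum.inr (k, i))) :=
    measurable_argminIdx fun i =>
      measurable_chordalSq (measurable_pi_apply _) (measurable_pi_apply _)
  have h2 : Measurable fun p : (Idx K B → Matrix (Fin (N * K)) (Fin N) ℂ) × Fin (2 ^ B) =>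
      p.1 (Sum.inr (k, p.2)) :=
    measurable_from_prod_countable_left fun i => measurable_pi_apply (Sum.inr (k, i))
  exact h2.comp (measurable_id.prodMk h1)

variable [MeasurableSpace Ω] {P : Measure Ω} [IsProbabilityMeasure P]
  {H : Fin K → Ω → Matrix (Fin (N * K)) (Fin N) ℂ}
  {C : Fin K → Fin (2 ^ B) → Ω → Matrix (Fin (N * K)) (Fin N) ℂ}

namespace IsRVQSystem

theorem measurable_allMat (hsys : IsRVQSystem P H C) : Measurable (allMat H C) := by
  refine measurable_pi_iff.2 fun s => ?_
  rcases s with k | p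
  · exact hsys.measurable_channel k
  · exact hsys.measurable_codeword p.1 p.2

theorem iIndepFun_allMat (hsys : IsRVQSystem P H C) :
    iIndepFun (fun s ω => allMat H C ω s) P := by
  convert hsys.indep using 1
  ext s ω
  rcases s with k | p <;> rfl

theorem map_channel (hsys : IsRVQSystem P H C) (k : Fin K) :
    P.map (H k) = gaussianMatrix (Fin (N * K)) (Fin N) := by
  have hm : ∀ p : Fin (N * K) × Fin N, Measurable fun ω => H k ω p.1 p.2 := fun p =>
    (hsys.measurable_channel k).matrix_apply _ _
  have h1 := (hsys.channel_entries_indep k).map_fun_eq_pi_map fun p => (hm p).aemeasurable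
  simp only [hsys.channel_entry_law] at h1
  rw [gaussianMatrix, ← h1, Measure.map_map measurable_matrixOfUncurried
    (measurable_pi_iff.2 hm)]
  rfl

theorem map_unitary_mul (hsys : IsRVQSystem P H C) {U : Matrix (Fin (N * K)) (Fin (N * K)) ℂ}
    (hU : U ∈ unitaryGroup (Fin (N * K)) ℂ) (s : Idx K B) :
    (P.map fun ω => allMat H C ω s).map (fun A => U * A) = P.map fun ω => allMat H C ω s := by
  rcases s with k | p
  · change (P.map (H k)).map _ = P.map (H k)
    rw [hsys.map_channel, map_unitary_mul_gaussianMatrix hU]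
  · change (P.map (C p.1 p.2)).map _ = P.map (C p.1 p.2)
    rw [Measure.map_map (g := fun A => U * A) (measurable_const.matrix_mul measurable_id)
      (hsys.measurable_codeword p.1 p.2)]
    exact hsys.codeword_isotropic p.1 p.2 U hU

theorem quantizedOf_semiunitary (hsys : IsRVQSystem P H C) (k : Fin K) (ω : Ω) :
    (quantizedOf (allMat H C ω) k)ᴴ * quantizedOf (allMat H C ω) k = 1 :=
  hsys.codeword_semiunitary _ _ _

/-! ### Generic position -/

/-- Freezing everything but the channel of user `k` turns the codeword into a fixed semi-unitary
matrix tested against a Gaussian one. -/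
theorem ae_det_codeword_mul_channel_ne_zero (hsys : IsRVQSystem P H C) (k : Fin K)
    (p : Fin K × Fin (2 ^ B)) : ∀ᵐ ω ∂P, ((C p.1 p.2 ω)ᴴ * H k ω).det ≠ 0 := by
  refine ae_of_ae_mix (Y := allMat H C) (fun s => s ≠ Sum.inl k) hsys.measurable_allMat
    hsys.iIndepFun_allMat (p := fun x => ((x (Sum.inr p))ᴴ * x (Sum.inl k)).det ≠ 0) ?_ fun ω' => ?_
  · exact (((measurable_pi_apply _).matrix_conjTranspose.matrix_mul
      (measurable_pi_apply _)).matrix_det) (measurableSet_singleton 0).compl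
  · simp only [mix, ne_eq, reduceCtorEq, not_false_eq_true, if_true, not_true_eq_false, if_false]
    have h := ae_det_conjTranspose_mul_ne_zero (hsys.codeword_semiunitary p.1 p.2 ω')
    rw [← hsys.map_channel k] at h
    exact ae_of_ae_map (hsys.measurable_channel k).aemeasurable h

theorem isUnit_gram_of_det_ne_zero {m n : Type*} [Fintype m] [Fintype n] [DecidableEq m]
    [DecidableEq n] {A V : Matrix m n ℂ} (h : (Vᴴ * A).det ≠ 0) : IsUnit (Aᴴ * A).det := by
  refine isUnit_det_gram_of_leftInverse (L := (Vᴴ * A)⁻¹ * Vᴴ) ?_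
  rw [Matrix.mul_assoc, nonsing_inv_mul _ (isUnit_iff_ne_zero.2 h)]

theorem ae_isUnit_gram_channel (hsys : IsRVQSystem P H C) (k : Fin K) :
    ∀ᵐ ω ∂P, IsUnit ((H k ω)ᴴ * H k ω).det := by
  filter_upwards [hsys.ae_det_codeword_mul_channel_ne_zero k (k, 0)] with ω h
  exact isUnit_gram_of_det_ne_zero h

/-- The orthogonal complement of a codeword has dimension `N K - N ≥ N`, which is where `K ≥ 2`
enters. It contains an orthonormal `N`-frame `V`, and `det(Vᴴ H_k) ≠ 0` almost surely. This excludes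
perfect quantization and yields `γ > 0`. -/
theorem ae_det_channel_compl_ne_zero (hsys : IsRVQSystem P H C) (hK : 2 ≤ K) (k : Fin K)
    (i : Fin (2 ^ B)) :
    ∀ᵐ ω ∂P, ((H k ω)ᴴ * (1 - C k i ω * (C k i ω)ᴴ) * H k ω).det ≠ 0 := by
  refine ae_of_ae_mix (Y := allMat H C) (fun s => s ≠ Sum.inl k) hsys.measurable_allMat
    hsys.iIndepFun_allMat (p := fun x => ((x (Sum.inl k))ᴴ *
      (1 - x (Sum.inr (k, i)) * (x (Sum.inr (k, i)))ᴴ) * x (Sum.inl k)).det ≠ 0) ?_ fun ω' => ?_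
  · exact ((((measurable_pi_apply _).matrix_conjTranspose.matrix_mul
      (measurable_const.matrix_sub ((measurable_pi_apply _).matrix_mul
        (measurable_pi_apply _).matrix_conjTranspose))).matrix_mul
      (measurable_pi_apply _)).matrix_det) (measurableSet_singleton 0).compl
  · simp only [mix, ne_eq, reduceCtorEq, not_false_eq_true, if_true, not_true_eq_false, if_false]
    have hle : 2 * N ≤ N * K := by rw [mul_comm]; exact Nat.mul_le_mul_left _ hK
    -- The index type splits the `N K - N` complementary directions into the `N` columns of the
    -- frame `V` and the rest.
    obtain ⟨V', h1, h2, h3⟩ := exists_orthonormal_completion (r := Fin N ⊕ Fin (N * K - 2 * N))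
      (hsys.codeword_semiunitary k i ω') (by simp; omega)
    let V := V'.submatrix id (Sum.inl : Fin N → Fin N ⊕ Fin (N * K - 2 * N))
    have hV : Vᴴ * V = 1 := by
      have := congrArg (fun A => A.submatrix (Sum.inl : Fin N → Fin N ⊕ Fin (N * K - 2 * N))
        Sum.inl) h1
      ext a b
      have h := congrFun (congrFun this a) b
      simpa [V, mul_apply, one_apply] using h
    have hVC : Vᴴ * C k i ω' = 0 := by
      ext a b
      have h := congrFun (congrFun h2 (Sum.inl a)) b
      simpa [V, mul_apply] using h
    have h := ae_det_conjTranspose_mul_ne_zero hV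
    rw [← hsys.map_channel k] at h
    filter_upwards [ae_of_ae_map (hsys.measurable_channel k).aemeasurable h] with ω hω
    change ¬ ((H k ω)ᴴ * (1 - C k i ω' * (C k i ω')ᴴ) * H k ω).det = 0
    set A := (1 - C k i ω' * (C k i ω')ᴴ) * H k ω
    have hA : (1 - C k i ω' * (C k i ω')ᴴ)ᴴ * (1 - C k i ω' * (C k i ω')ᴴ)
        = 1 - C k i ω' * (C k i ω')ᴴ := by
      have hc := hsys.codeword_semiunitary k i ω'
      simp only [conjTranspose_sub, conjTranspose_one, conjTranspose_mul,
        conjTranspose_conjTranspose, Matrix.sub_mul, Matrix.mul_sub, Matrix.one_mul,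
        Matrix.mul_one]
      rw [Matrix.mul_assoc (C k i ω'), ← Matrix.mul_assoc (C k i ω')ᴴ, hc, Matrix.one_mul]
      simp
    have hg : (H k ω)ᴴ * (1 - C k i ω' * (C k i ω')ᴴ) * H k ω = Aᴴ * A := by
      rw [conjTranspose_mul, Matrix.mul_assoc _ _ A, ← Matrix.mul_assoc _ _ (H k ω), hA,
        Matrix.mul_assoc]
    rw [hg]
    refine (isUnit_gram_of_det_ne_zero (V := V) ?_).ne_zero
    rwa [← Matrix.mul_assoc, Matrix.mul_sub, ← Matrix.mul_assoc, hVC, Matrix.zero_mul, sub_zero,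
      Matrix.mul_one]

/-- An isotropic codeword is in general position with respect to a fixed subspace. -/
theorem ae_det_mul_codeword_ne_zero (hsys : IsRVQSystem P H C) (p : Fin K × Fin (2 ^ B))
    {E : Matrix (Fin N) (Fin (N * K)) ℂ} {d : Matrix (Fin (N * K)) (Fin N) ℂ} (hE : E * d = 1) :
    ∀ᵐ ω ∂P, (E * C p.1 p.2 ω).det ≠ 0 := by
  have hEd : dᴴ * Eᴴ = 1 := by rw [← conjTranspose_mul, hE, conjTranspose_one]
  obtain ⟨V, T, hV, hT, hEV⟩ := exists_orthonormal_factor (isUnit_det_gram_of_leftInverse hEd)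
  have h1 := ae_mix_of_ae (Y := allMat H C) (fun s => s = Sum.inl p.1) hsys.measurable_allMat
    hsys.iIndepFun_allMat (p := fun x => ((x (Sum.inr p))ᴴ * x (Sum.inl p.1)).det ≠ 0)
    ((((measurable_pi_apply _).matrix_conjTranspose.matrix_mul
      (measurable_pi_apply _)).matrix_det) (measurableSet_singleton 0).compl)
    (hsys.ae_det_codeword_mul_channel_ne_zero p.1 p)
  -- A single channel realization in general position to almost every codeword is fixed. A unitary
  -- rotates the columns of `Eᴴ` onto those of this channel, and isotropy lets the codeword absorb
  -- it.
  obtain ⟨ω', hω1, hω2⟩ := (h1.and (hsys.ae_isUnit_gram_channel p.1)).exists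
  obtain ⟨V', T', hV', hT', hH⟩ := exists_orthonormal_factor hω2
  obtain ⟨U, hU, hUV⟩ := exists_unitary_mul_eq hV' hV
  have hU' : star U ∈ unitaryGroup (Fin (N * K)) ℂ := Unitary.star_mem hU
  have hmeas : MeasurableSet {A : Matrix (Fin (N * K)) (Fin N) ℂ | ((H p.1 ω')ᴴ * A).det ≠ 0} :=
    ((measurable_const.matrix_mul measurable_id).matrix_det) (measurableSet_singleton 0).compl
  have h2 : ∀ᵐ A ∂P.map (C p.1 p.2), ((H p.1 ω')ᴴ * A).det ≠ 0 := by
    rw [ae_map_iff (hsys.measurable_codeword p.1 p.2).aemeasurable hmeas]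
    filter_upwards [hω1] with ω hω h0
    refine hω ?_
    have : ((C p.1 p.2 ω)ᴴ * H p.1 ω').det = 0 := by
      have h := congrArg star h0
      rw [← det_conjTranspose, conjTranspose_mul, conjTranspose_conjTranspose, star_zero] at h
      exact h
    simpa [mix, allMat] using this
  rw [← hsys.codeword_isotropic p.1 p.2 _ hU',
    ae_map_iff (measurable_const.matrix_mul (hsys.measurable_codeword p.1 p.2)).aemeasurable
      hmeas] at h2
  filter_upwards [h2] with ω hω h0
  refine hω ?_
  have hE' : E = Tᴴ * (V'ᴴ * star U) := by
    rw [star_eq_conjTranspose, ← conjTranspose_mul, hUV, ← conjTranspose_mul, ← hEV,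
      conjTranspose_conjTranspose]
  rw [hE', Matrix.mul_assoc, det_mul] at h0
  have hTn : (Tᴴ).det ≠ 0 := by rw [det_conjTranspose]; exact star_ne_zero.2 hT.ne_zero
  have h0' := (mul_eq_zero.1 h0).resolve_left hTn
  rw [hH, conjTranspose_mul, Matrix.mul_assoc, ← Matrix.mul_assoc V'ᴴ, det_mul, h0', mul_zero]

/-- Blocks of the standard basis: the nonsingular configuration from which codewords are exchanged
one at a time. -/
theorem exists_gramSum_eq_one : ∃ d : Fin K → Matrix (Fin (N * K)) (Fin N) ℂ,
    ∑ j, d j * (d j)ᴴ = 1 := by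
  refine ⟨fun j => of fun a b => if finProdFinEquiv (b, j) = a then 1 else 0, ?_⟩
  ext a a'
  simp only [Matrix.sum_apply, mul_apply, conjTranspose_apply, of_apply, one_apply]
  rw [Finset.sum_comm, ← Fintype.sum_prod_type'
    (f := fun b j => (if finProdFinEquiv (b, j) = a then (1 : ℂ) else 0) *
      star (if finProdFinEquiv (b, j) = a' then (1 : ℂ) else 0)),
    finProdFinEquiv.sum_comp (fun q => (if q = a then (1 : ℂ) else 0) *
      star (if q = a' then (1 : ℂ) else 0))]
  simp [eq_comm]

/-- All selections of one codeword per user are treated at once, since the selected indices are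
random; there are finitely many. For one selection, the fixed blocks are exchanged for random
codewords successively, and each exchange almost surely preserves nonsingularity. -/
theorem ae_det_gramSum_ne_zero (hsys : IsRVQSystem P H C) :
    ∀ᵐ ω ∂P, ∀ ι : Fin K → Fin (2 ^ B),
      (∑ j, C j (ι j) ω * (C j (ι j) ω)ᴴ).det ≠ 0 := by
  refine ae_all_iff.2 fun ι => ?_
  have hcard : Fintype.card (Fin (N * K)) = Fintype.card (Fin K) * Fintype.card (Fin N) := by
    simp [mul_comm]
  have hm : ∀ j, Measurable (C j (ι j)) := fun j => hsys.measurable_codeword _ _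
  have : ∀ j, IsProbabilityMeasure (P.map (C j (ι j))) := fun j =>
    Measure.isProbabilityMeasure_map (hm j).aemeasurable
  have hind : iIndepFun (fun j => C j (ι j)) P :=
    hsys.indep.precomp (g := fun j => Sum.inr (j, ι j)) fun i j h => by
      simpa using congrArg Prod.fst (Sum.inr_injective h)
  have hdet : Measurable fun c : Fin K → Matrix (Fin (N * K)) (Fin N) ℂ =>
      (∑ j, c j * (c j)ᴴ).det :=
    (Measurable.matrix_sum fun j => (measurable_pi_apply j).matrix_mul
      (measurable_pi_apply j).matrix_conjTranspose).matrix_det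
  have hset : MeasurableSet {c : Fin K → Matrix (Fin (N * K)) (Fin N) ℂ |
      (∑ j, c j * (c j)ᴴ).det = 0} := hdet (measurableSet_singleton 0)
  -- With penalty `∞` on singular configurations, the replacement inequality with constant `1` says
  -- that nonsingularity of the fixed configuration passes to almost every random one.
  let F : (Fin K → Matrix (Fin (N * K)) (Fin N) ℂ) → ℝ≥0∞ :=
    fun c => if (∑ j, c j * (c j)ᴴ).det = 0 then ∞ else 0
  have hF : Measurable F := Measurable.ite hset measurable_const measurable_const
  obtain ⟨d, hd⟩ := exists_gramSum_eq_one (N := N) (K := K)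
  have hpi := lintegral_pi_le_pow_mul (fun j => P.map (C j (ι j))) hF d 1 fun c k => by
    by_cases h : (∑ j, Function.update c k (d k) j * (Function.update c k (d k) j)ᴴ).det = 0
    · have : F (Function.update c k (d k)) = ∞ := if_pos h
      rw [this]; simp
    · have hu := isUnit_iff_ne_zero.2 h
      have hE := conjTranspose_mul_inv_mul hcard hu k k
      rw [if_pos rfl, ← Matrix.mul_assoc, Function.update_self] at hE
      have h0 := hsys.ae_det_mul_codeword_ne_zero (k, ι k) hE
      have hset' : MeasurableSet {x : Matrix (Fin (N * K)) (Fin N) ℂ |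
          F (Function.update c k x) = 0} :=
        (hF.comp (measurable_update c)) (measurableSet_singleton 0)
      have h1 : ∀ᵐ x ∂P.map (C k (ι k)), F (Function.update c k x) = 0 := by
        rw [ae_map_iff (hm k).aemeasurable hset']
        filter_upwards [h0] with ω hω
        exact if_neg (isUnit_gramSum_update hu hω)
      rw [lintegral_congr_ae h1]
      simp
  have hFd : F d = 0 := if_neg (by simp [hd])
  rw [hFd, mul_zero, nonpos_iff_eq_zero, lintegral_eq_zero_iff hF,
    ← hind.map_fun_eq_pi_map fun j => (hm j).aemeasurable] at hpi
  filter_upwards [ae_of_ae_map (measurable_pi_iff.2 hm).aemeasurable hpi] with ω hω h0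
  have : F (fun j => C j (ι j) ω) = ∞ := if_pos h0
  rw [this] at hω
  simp at hω

end IsRVQSystem

end System

end LimitedFeedback

namespace LimitedFeedback

open scoped ENNReal ComplexOrder

set_option linter.unusedSectionVars false

/-! ### Entrywise and trace bounds. -/

section Bounds

variable {m n : Type*} [Fintype m] [Fintype n] [DecidableEq m] [DecidableEq n]

/-- Squared Frobenius norm. -/
noncomputable def frobSq (A : Matrix m n ℂ) : ℝ := ∑ a, ∑ b, ‖A a b‖ ^ 2

theorem frobSq_nonneg (A : Matrix m n ℂ) : 0 ≤ frobSq A :=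
  Finset.sum_nonneg fun _ _ => Finset.sum_nonneg fun _ _ => sq_nonneg _

theorem sum_row_le_frobSq (A : Matrix m n ℂ) (a : m) : ∑ b, ‖A a b‖ ^ 2 ≤ frobSq A :=
  Finset.single_le_sum (f := fun a => ∑ b, ‖A a b‖ ^ 2)
    (fun _ _ => Finset.sum_nonneg fun _ _ => sq_nonneg _) (Finset.mem_univ a)

theorem sum_col_le_frobSq (A : Matrix m n ℂ) (b : n) : ∑ a, ‖A a b‖ ^ 2 ≤ frobSq A :=
  Finset.sum_le_sum fun a _ => Finset.single_le_sum (f := fun b => ‖A a b‖ ^ 2)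
    (fun _ _ => sq_nonneg _) (Finset.mem_univ b)

theorem trace_mul_conjTranspose_eq_frobSq (A : Matrix m n ℂ) :
    (A * Aᴴ).trace = (frobSq A : ℂ) := by
  simp only [trace, diag_apply, mul_apply, conjTranspose_apply, frobSq, Complex.ofReal_sum]
  refine Finset.sum_congr rfl fun a _ => Finset.sum_congr rfl fun b _ => ?_
  rw [RCLike.star_def, Complex.mul_conj']
  norm_cast

theorem norm_mul_conjTranspose_apply_le (A : Matrix m n ℂ) (a b : m) :
    ‖(A * Aᴴ) a b‖ ≤ frobSq A := by
  rw [mul_apply]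
  calc ‖∑ j, A a j * Aᴴ j b‖ ≤ ∑ j, (‖A a j‖ ^ 2 + ‖A b j‖ ^ 2) / 2 := by
        refine norm_sum_le_of_le _ fun j _ => ?_
        rw [norm_mul, conjTranspose_apply, norm_star]
        nlinarith [sq_nonneg (‖A a j‖ - ‖A b j‖)]
    _ ≤ frobSq A := by
        rw [← Finset.sum_div, Finset.sum_add_distrib]
        linarith [sum_row_le_frobSq A a, sum_row_le_frobSq A b]

theorem norm_conj_apply_le (A : Matrix m n ℂ) {Q : Matrix m m ℂ} {c : ℝ}
    (hQ : ∀ i j, ‖Q i j‖ ≤ c) (a b : n) :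
    ‖(Aᴴ * Q * A) a b‖ ≤ c * Fintype.card m * frobSq A := by
  rw [Matrix.mul_assoc, mul_apply]
  by_cases hm : IsEmpty m
  · simp
  rw [not_isEmpty_iff] at hm
  obtain ⟨i₀⟩ := hm
  have hc : 0 ≤ c := (norm_nonneg _).trans (hQ i₀ i₀)
  calc ‖∑ i, Aᴴ a i * (Q * A) i b‖
      ≤ ∑ i, ∑ j, c * ((‖A i a‖ ^ 2 + ‖A j b‖ ^ 2) / 2) := by
        refine norm_sum_le_of_le _ fun i _ => ?_
        rw [mul_apply, Finset.mul_sum]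
        refine norm_sum_le_of_le _ fun j _ => ?_
        rw [norm_mul, norm_mul, conjTranspose_apply, norm_star]
        calc ‖A i a‖ * (‖Q i j‖ * ‖A j b‖) ≤ ‖A i a‖ * (c * ‖A j b‖) := by
              gcongr
              exact hQ i j
          _ = c * (‖A i a‖ * ‖A j b‖) := by ring
          _ ≤ _ := by
              gcongr
              nlinarith [sq_nonneg (‖A i a‖ - ‖A j b‖)]
    _ = c * Fintype.card m * ((∑ i, ‖A i a‖ ^ 2 + ∑ j, ‖A j b‖ ^ 2) / 2) := by
        simp only [← Finset.mul_sum, ← Finset.sum_div, Finset.sum_add_distrib, Finset.sum_const,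
          Finset.card_univ, nsmul_eq_mul]
        ring
    _ ≤ c * Fintype.card m * frobSq A := by
        gcongr
        linarith [sum_col_le_frobSq A a, sum_col_le_frobSq A b]

theorem norm_trace_conj_le (A : Matrix m n ℂ) {Q : Matrix m m ℂ} {c : ℝ}
    (hQ : ∀ i j, ‖Q i j‖ ≤ c) :
    ‖(Aᴴ * Q * A).trace‖ ≤ Fintype.card n * (c * Fintype.card m * frobSq A) := by
  refine (norm_sum_le_of_le _ fun a _ => norm_conj_apply_le A hQ a a).trans (le_of_eq ?_)
  simp

/-- The diagonal of `A - A²` gives `∑ a, |A a b|² ≤ |A b b|`; the term `a = b` bounds the diagonal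
by `1`, and then every entry. It serves projectors and the resolvents `(1 + ρ S)⁻¹` alike. -/
theorem norm_apply_le_one_of_contraction {A : Matrix m m ℂ} (hA : Aᴴ = A)
    (h : (A - A * A).PosSemidef) (a b : m) : ‖A a b‖ ≤ 1 := by
  have key : ∀ b, ∑ a, ‖A a b‖ ^ 2 ≤ ‖A b b‖ := by
    intro b
    have h1 := (Complex.nonneg_iff.1 (h.diag_nonneg (i := b))).1
    have h2 : (A * A) b b = ((∑ a, ‖A a b‖ ^ 2 : ℝ) : ℂ) := by
      conv_lhs => rw [← hA]
      rw [hA, ← congrArg (· * A) hA, mul_apply, Complex.ofReal_sum]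
      refine Finset.sum_congr rfl fun a _ => ?_
      rw [conjTranspose_apply, RCLike.star_def, Complex.conj_mul']
      norm_cast
    rw [Matrix.sub_apply, h2, Complex.sub_re, Complex.ofReal_re] at h1
    linarith [Complex.re_le_norm (A b b)]
  have hle : ∀ a b, ‖A a b‖ ^ 2 ≤ ‖A b b‖ := fun a b =>
    (Finset.single_le_sum (f := fun a => ‖A a b‖ ^ 2) (fun _ _ => sq_nonneg _)
      (Finset.mem_univ a)).trans (key b)
  have hdiag : ‖A b b‖ ≤ 1 := by
    by_contra hlt
    nlinarith [hle b b]
  exact (sq_le_one_iff₀ (norm_nonneg _)).1 ((hle a b).trans hdiag)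

theorem norm_apply_le_one_of_proj {A : Matrix m m ℂ} (hA : Aᴴ = A) (h : A * A = A) (a b : m) :
    ‖A a b‖ ≤ 1 :=
  norm_apply_le_one_of_contraction hA (by rw [h, sub_self]; exact PosSemidef.zero) a b

theorem posSemidef_of_proj {A : Matrix m m ℂ} (hA : Aᴴ = A) (h : A * A = A) : A.PosSemidef := by
  have := posSemidef_conjTranspose_mul_self A
  rwa [hA, h] at this

theorem norm_colProj_apply_le (A : Matrix m n ℂ) (a b : m) : ‖colProj A a b‖ ≤ 1 :=
  norm_apply_le_one_of_proj (colProj_conjTranspose A) (colProj_mul_self A) a b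

theorem norm_outer_apply_le {V : Matrix m n ℂ} (hV : Vᴴ * V = 1) (a b : m) :
    ‖(V * Vᴴ) a b‖ ≤ 1 := by
  rw [← colProj_of_orthonormal hV]
  exact norm_colProj_apply_le V a b

theorem one_sub_outer_conjTranspose (V : Matrix m n ℂ) : (1 - V * Vᴴ)ᴴ = 1 - V * Vᴴ := by
  simp [conjTranspose_sub, conjTranspose_mul]

theorem one_sub_outer_mul_self {V : Matrix m n ℂ} (hV : Vᴴ * V = 1) :
    (1 - V * Vᴴ) * (1 - V * Vᴴ) = 1 - V * Vᴴ := by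
  simp only [Matrix.sub_mul, Matrix.mul_sub, Matrix.one_mul, Matrix.mul_one]
  rw [Matrix.mul_assoc V, ← Matrix.mul_assoc Vᴴ, hV, Matrix.one_mul]
  simp

theorem one_sub_outer_mul {V : Matrix m n ℂ} (hV : Vᴴ * V = 1) : (1 - V * Vᴴ) * V = 0 := by
  rw [Matrix.sub_mul, Matrix.mul_assoc, hV, Matrix.one_mul, Matrix.mul_one, sub_self]

end Bounds

/-! ### Conditional means of trace products. -/

section Conditioning

variable {Ω S X : Type*} [MeasurableSpace Ω] [Fintype S] [MeasurableSpace X]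
  {P : Measure Ω} [IsProbabilityMeasure P] {Y : Ω → S → X} {m : Type*} [Fintype m] [DecidableEq m]

theorem integrable_of_bounded {f : Ω → ℂ} (hf : Measurable f) {c : ℝ} (h : ∀ ω, ‖f ω‖ ≤ c) :
    Integrable f P :=
  Integrable.of_bound hf.aestronglyMeasurable c (ae_of_all _ h)

/-- Conditional expectation given the coordinates in `T`, for a product of which one factor depends
on these coordinates only. -/
theorem integral_trace_mul_mix (T : S → Prop) [DecidablePred T] (hY : Measurable Y)
    (hind : iIndepFun (fun s ω => Y ω s) P) {F b : (S → X) → Matrix m m ℂ} (hF : Measurable F)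
    (hb : Measurable b) {c : ℝ} (hFc : ∀ ω' ω i j, ‖F (mix T (Y ω') (Y ω)) i j‖ ≤ c)
    (hbT : ∀ ω' ω, b (mix T (Y ω') (Y ω)) = b (Y ω'))
    (hbi : ∀ i j, Integrable (fun ω => b (Y ω) i j) P) :
    ∫ ω, (F (Y ω) * b (Y ω)).trace ∂P
      = ∫ ω', (matExp P (fun ω => F (mix T (Y ω') (Y ω))) * b (Y ω')).trace ∂P := by
  have hself : ∀ ω, mix T (Y ω) (Y ω) = Y ω := fun ω => by ext s; simp [mix]
  have hint : Integrable (fun ω => (F (Y ω) * b (Y ω)).trace) P := by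
    simp only [trace, diag_apply, mul_apply]
    refine integrable_finsetSum _ fun i _ => integrable_finsetSum _ fun j _ => ?_
    refine (hbi j i).bdd_mul ((hF.comp hY).matrix_apply i j).aestronglyMeasurable
      (ae_of_all _ fun ω => ?_) (c := c)
    rw [← hself ω]
    exact hFc ω ω i j
  rw [integral_mix T hY hind (F := fun x => (F x * b x).trace) (hF.matrix_mul hb).matrix_trace hint]
  refine integral_congr_ae (ae_of_all _ fun ω' => ?_)
  have hm : ∀ i j, Integrable (fun ω => F (mix T (Y ω') (Y ω)) i j) P := fun i j =>
    integrable_of_bounded ((hF.comp ((measurable_mix_comp T hY).comp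
      measurable_prodMk_left)).matrix_apply i j) fun ω => hFc ω' ω i j
  simp only [hbT]
  rw [← matExp_mul_right hm, trace_matExp (integrable_mul_right hm _)]

end Conditioning

end LimitedFeedback

namespace LimitedFeedback

open scoped ENNReal ComplexOrder

set_option linter.unusedSectionVars false

/-! ### Chordal distance: range and invariance. -/

section Chordal

variable {m n : Type*} [Fintype m] [Fintype n] [DecidableEq m] [DecidableEq n]

theorem eq_zero_of_frobSq_eq_zero {A : Matrix m n ℂ} (h : frobSq A = 0) : A = 0 := by
  have h1 : (A * Aᴴ).trace = 0 := by rw [trace_mul_conjTranspose_eq_frobSq, h]; simp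
  exact trace_mul_conjTranspose_self_eq_zero_iff.1 h1

theorem trace_outer_of_orthonormal {V : Matrix m n ℂ} (hV : Vᴴ * V = 1) :
    (V * Vᴴ).trace = Fintype.card n := by
  rw [trace_mul_comm, hV, trace_one]

theorem trace_proj_mul_outer {Q : Matrix m m ℂ} (hQh : Qᴴ = Q) (hQ : Q * Q = Q)
    (V : Matrix m n ℂ) : (Q * (V * Vᴴ)).trace = (frobSq (Q * V) : ℂ) := by
  rw [← trace_mul_conjTranspose_eq_frobSq, conjTranspose_mul, hQh, ← Matrix.mul_assoc (Q * V),
    trace_mul_comm _ Q, Matrix.mul_assoc Q V, ← Matrix.mul_assoc Q Q, hQ]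

variable {M N : ℕ}

theorem chordalSq_eq_frobSq (h : Matrix (Fin M) (Fin N) ℂ) {c : Matrix (Fin M) (Fin N) ℂ}
    (hc : cᴴ * c = 1) : chordalSq h c = frobSq ((1 - colProj h) * c) := by
  have h1 := trace_proj_mul_outer (Q := 1 - colProj h) (V := c)
    (by rw [conjTranspose_sub, conjTranspose_one, colProj_conjTranspose])
    (by
      rw [Matrix.sub_mul, Matrix.mul_sub, Matrix.mul_sub, colProj_mul_self]
      simp)
  rw [Matrix.sub_mul, Matrix.one_mul, trace_sub, trace_outer_of_orthonormal hc] at h1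
  have h2 := congrArg Complex.re h1
  rw [chordalSq, ← Complex.ofReal_re (frobSq _), ← h2]
  simp

theorem chordalSq_nonneg (h : Matrix (Fin M) (Fin N) ℂ) {c : Matrix (Fin M) (Fin N) ℂ}
    (hc : cᴴ * c = 1) : 0 ≤ chordalSq h c := by
  rw [chordalSq_eq_frobSq h hc]; exact frobSq_nonneg _

theorem chordalSq_eq_sub_frobSq (h c : Matrix (Fin M) (Fin N) ℂ) :
    chordalSq h c = N - frobSq (colProj h * c) := by
  rw [chordalSq, trace_proj_mul_outer (colProj_conjTranspose h) (colProj_mul_self h),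
    Complex.ofReal_re]

theorem chordalSq_le (h c : Matrix (Fin M) (Fin N) ℂ) : chordalSq h c ≤ N := by
  rw [chordalSq_eq_sub_frobSq]; linarith [frobSq_nonneg (colProj h * c)]

/-- Equality would make the codeword orthogonal to the column space of `h`, so that `cᴴ h = 0`. -/
theorem chordalSq_lt (hN : 1 ≤ N) {h c : Matrix (Fin M) (Fin N) ℂ} (hd : (cᴴ * h).det ≠ 0) :
    chordalSq h c < N := by
  rw [chordalSq_eq_sub_frobSq]
  refine sub_lt_self _ (lt_of_le_of_ne (frobSq_nonneg _) fun h0 => hd ?_)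
  have h1 := eq_zero_of_frobSq_eq_zero h0.symm
  have h2 : cᴴ * colProj h = 0 := by
    have := congrArg conjTranspose h1
    rwa [conjTranspose_mul, colProj_conjTranspose, conjTranspose_zero] at this
  have : Nonempty (Fin N) := ⟨⟨0, hN⟩⟩
  rw [← colProj_mul_cancel (IsRVQSystem.isUnit_gram_of_det_ne_zero hd), ← Matrix.mul_assoc, h2,
    Matrix.zero_mul, det_zero]

/-- Distance zero means `c = h L`; then `(cᴴ h) L = 1`, so `h = c (cᴴ h)` lies in the column space
of `c` and is annihilated by `1 - c cᴴ`. -/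
theorem chordalSq_pos (hN : 1 ≤ N) {h c : Matrix (Fin M) (Fin N) ℂ} (hc : cᴴ * c = 1)
    (hd : (hᴴ * (1 - c * cᴴ) * h).det ≠ 0) : 0 < chordalSq h c := by
  refine lt_of_le_of_ne (chordalSq_nonneg h hc) fun h0 => hd ?_
  rw [chordalSq_eq_frobSq h hc] at h0
  have h1 := eq_zero_of_frobSq_eq_zero h0.symm
  rw [Matrix.sub_mul, Matrix.one_mul, sub_eq_zero] at h1
  set L := (hᴴ * h)⁻¹ * hᴴ * c with hL
  have hcL : c = h * L := by
    conv_lhs => rw [h1]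
    simp only [colProj, hL, Matrix.mul_assoc]
  have hLi : (cᴴ * h) * L = 1 := by rw [Matrix.mul_assoc, ← hcL, hc]
  have hLi' : L * (cᴴ * h) = 1 := mul_eq_one_comm.1 hLi
  have hh : h = c * (cᴴ * h) := by
    conv_rhs => rw [hcL]
    rw [Matrix.mul_assoc, ← hcL, hLi', Matrix.mul_one]
  have : Nonempty (Fin N) := ⟨⟨0, hN⟩⟩
  rw [Matrix.mul_assoc, show (1 - c * cᴴ) * h = 0 by
    rw [hh, ← Matrix.mul_assoc, one_sub_outer_mul hc, Matrix.zero_mul], Matrix.mul_zero,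
    det_zero]

theorem chordalSq_congr {h h' : Matrix (Fin M) (Fin N) ℂ} (hh : colProj h = colProj h')
    (c : Matrix (Fin M) (Fin N) ℂ) : chordalSq h c = chordalSq h' c := by
  rw [chordalSq, chordalSq, hh]

theorem chordalSq_unitary_mul {U : Matrix (Fin M) (Fin M) ℂ} (hU : Uᴴ * U = 1)
    (h c : Matrix (Fin M) (Fin N) ℂ) : chordalSq (U * h) (U * c) = chordalSq h c := by
  rw [chordalSq, chordalSq, colProj_isometry_mul hU]
  congr 2
  rw [conjTranspose_mul, trace_mul_comm]
  calc (U * c * (cᴴ * Uᴴ) * (U * colProj h * Uᴴ)).trace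
      = (U * (c * cᴴ * (Uᴴ * U) * colProj h * Uᴴ)).trace := by simp only [Matrix.mul_assoc]
    _ = _ := by
      rw [hU, Matrix.mul_one, trace_mul_comm, Matrix.mul_assoc, hU, Matrix.mul_one,
        trace_mul_comm]

/-- This allows the codewords to be rotated while the channel stays frozen, the symmetry behind the
conditional mean given the channel. -/
theorem chordalSq_mul_of_commute {U : Matrix (Fin M) (Fin M) ℂ} (hU : Uᴴ * U = 1)
    {h : Matrix (Fin M) (Fin N) ℂ} (hh : U * colProj h = colProj h * U)
    (c : Matrix (Fin M) (Fin N) ℂ) : chordalSq h (U * c) = chordalSq h c := by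
  rw [← chordalSq_unitary_mul hU h c]
  refine chordalSq_congr ?_ _
  rw [colProj_isometry_mul hU, hh, Matrix.mul_assoc, mul_eq_one_comm.1 hU, Matrix.mul_one]

end Chordal

/-! ### The quantizer and its distortion. -/

section Quantized

variable {N K B : ℕ}

theorem quantizedOf_eq_mul {x y : Idx K B → Matrix (Fin (N * K)) (Fin N) ℂ} {k : Fin K}
    {U : Matrix (Fin (N * K)) (Fin (N * K)) ℂ}
    (hd : ∀ i, chordalSq (y (Sum.inl k)) (y (Sum.inr (k, i)))
      = chordalSq (x (Sum.inl k)) (x (Sum.inr (k, i))))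
    (hc : ∀ i, y (Sum.inr (k, i)) = U * x (Sum.inr (k, i))) :
    quantizedOf y k = U * quantizedOf x k := by
  rw [quantizedOf, hc, quantizedOf]
  simp only [hd]

theorem quantizedOf_unitary_mul {U : Matrix (Fin (N * K)) (Fin (N * K)) ℂ} (hU : Uᴴ * U = 1)
    (x : Idx K B → Matrix (Fin (N * K)) (Fin N) ℂ) (k : Fin K) :
    quantizedOf (fun s => U * x s) k = U * quantizedOf x k :=
  quantizedOf_eq_mul (fun _ => chordalSq_unitary_mul hU _ _) fun _ => rfl

variable {Ω : Type*} [MeasurableSpace Ω] {P : Measure Ω} [IsProbabilityMeasure P]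
  {H : Fin K → Ω → Matrix (Fin (N * K)) (Fin N) ℂ}
  {C : Fin K → Fin (2 ^ B) → Ω → Matrix (Fin (N * K)) (Fin N) ℂ}

theorem abs_iInf_chordalSq_le {n : ℕ} [NeZero n] (h : Matrix (Fin (N * K)) (Fin N) ℂ)
    {c : Fin n → Matrix (Fin (N * K)) (Fin N) ℂ} (hc : ∀ i, (c i)ᴴ * c i = 1) :
    |⨅ i, chordalSq h (c i)| ≤ N := by
  rw [iInf_eq_argminIdx, abs_of_nonneg (chordalSq_nonneg h (hc _))]
  exact chordalSq_le _ _

theorem measurable_iInf_chordalSq {α : Type*} [MeasurableSpace α] {n : ℕ} [NeZero n]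
    {f : α → Matrix (Fin (N * K)) (Fin N) ℂ} {c : Fin n → α → Matrix (Fin (N * K)) (Fin N) ℂ}
    (hf : Measurable f) (hc : ∀ i, Measurable (c i)) :
    Measurable fun a => ⨅ i, chordalSq (f a) (c i a) :=
  Measurable.iInf fun i => measurable_chordalSq hf (hc i)

namespace IsRVQSystem

/-- Conjugation invariance of a mean from equivariance and isotropy. -/
theorem matExp_eq_conj (hsys : IsRVQSystem P H C)
    {F : (Idx K B → Matrix (Fin (N * K)) (Fin N) ℂ) → Matrix (Fin (N * K)) (Fin (N * K)) ℂ}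
    (hF : Measurable F) {c : ℝ} (hFc : ∀ ω i j, ‖F (allMat H C ω) i j‖ ≤ c)
    {U : Matrix (Fin (N * K)) (Fin (N * K)) ℂ} (hU : U ∈ unitaryGroup (Fin (N * K)) ℂ)
    (hFU : ∀ ω, F (fun s => U * allMat H C ω s) = U * F (allMat H C ω) * Uᴴ) :
    matExp P (fun ω => F (allMat H C ω)) = U * matExp P (fun ω => F (allMat H C ω)) * Uᴴ := by
  have hint : ∀ i j, Integrable (fun ω => F (allMat H C ω) i j) P := fun i j =>
    integrable_of_bounded ((hF.comp hsys.measurable_allMat).matrix_apply i j) fun ω => hFc ω i j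
  rw [← matExp_conj hint]
  ext i j
  simp only [matExp, of_apply]
  rw [← integral_coordinatewise hsys.measurable_allMat hsys.iIndepFun_allMat
    (φ := fun _ A => U * A) (fun _ => measurable_const.matrix_mul measurable_id)
    (fun s => hsys.map_unitary_mul hU s) (F := fun x => F x i j) (hF.matrix_apply i j)]
  simp only [hFU]

/-! ### Distortion -/

theorem integral_iInf_chordalSq_unitary_mul (hsys : IsRVQSystem P H C) (k : Fin K)
    {U : Matrix (Fin (N * K)) (Fin (N * K)) ℂ} (hU : U ∈ unitaryGroup (Fin (N * K)) ℂ)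
    (h : Matrix (Fin (N * K)) (Fin N) ℂ) :
    ∫ ω, ⨅ i, chordalSq (U * h) (C k i ω) ∂P = ∫ ω, ⨅ i, chordalSq h (C k i ω) ∂P := by
  have h1 := integral_coordinatewise hsys.measurable_allMat hsys.iIndepFun_allMat
    (φ := fun _ A => U * A) (fun _ => measurable_const.matrix_mul measurable_id)
    (fun s => hsys.map_unitary_mul hU s)
    (F := fun x => ⨅ i : Fin (2 ^ B), chordalSq (U * h) (x (Sum.inr (k, i))))
    (measurable_iInf_chordalSq measurable_const fun i => measurable_pi_apply _)
  have hU' := mem_unitaryGroup_iff'.1 hU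
  simp only [chordalSq_unitary_mul hU'] at h1
  exact h1.symm

theorem integral_iInf_chordalSq_congr_user (hsys : IsRVQSystem P H C) (k k' : Fin K)
    (h : Matrix (Fin (N * K)) (Fin N) ℂ) :
    ∫ ω, ⨅ i, chordalSq h (C k i ω) ∂P = ∫ ω, ⨅ i, chordalSq h (C k' i ω) ∂P := by
  have hlaw : ∀ k, P.map (fun ω i => C k i ω) = Measure.pi fun i => P.map (C k i) := fun k =>
    (hsys.indep.precomp (g := fun i => Sum.inr (k, i)) fun i j h => by
      simpa using h).map_fun_eq_pi_map fun i => (hsys.measurable_codeword k i).aemeasurable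
  have hF : Measurable fun c : Fin (2 ^ B) → Matrix (Fin (N * K)) (Fin N) ℂ =>
      ⨅ i, chordalSq h (c i) :=
    measurable_iInf_chordalSq measurable_const fun i => measurable_pi_apply i
  have hm : ∀ k, AEMeasurable (fun ω i => C k i ω) P := fun k =>
    (measurable_pi_iff.2 fun i => hsys.measurable_codeword k i).aemeasurable
  have h1 : ∀ k, ∫ ω, ⨅ i, chordalSq h (C k i ω) ∂P
      = ∫ c, ⨅ i, chordalSq h (c i) ∂(Measure.pi fun i => P.map (C k i)) := fun k => by
    rw [← hlaw, integral_map (hm k) hF.aestronglyMeasurable]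
  rw [h1 k, h1 k', show (fun i => P.map (C k i)) = fun i => P.map (C k' i) from
    funext fun i => hsys.codeword_identDistrib k i k' i]

/-- The expected distortion of a fixed channel does not depend on the channel: unitaries act
transitively on column spaces and preserve the law of the codebook. Codebooks of different users
have the same law as well. -/
theorem integral_iInf_chordalSq_eq (hsys : IsRVQSystem P H C) (k k' : Fin K)
    {h h' : Matrix (Fin (N * K)) (Fin N) ℂ} (hh : IsUnit (hᴴ * h).det)
    (hh' : IsUnit (h'ᴴ * h').det) :
    ∫ ω, ⨅ i, chordalSq h (C k i ω) ∂P = ∫ ω, ⨅ i, chordalSq h' (C k' i ω) ∂P := by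
  obtain ⟨V, hV, hVh⟩ := exists_colProj_eq hh
  obtain ⟨V', hV', hVh'⟩ := exists_colProj_eq hh'
  rw [← colProj_of_orthonormal hV] at hVh
  rw [← colProj_of_orthonormal hV'] at hVh'
  obtain ⟨U, hU, hUV⟩ := exists_unitary_mul_eq hV hV'
  simp only [chordalSq_congr hVh, chordalSq_congr hVh']
  rw [← hUV, hsys.integral_iInf_chordalSq_unitary_mul k' hU,
    hsys.integral_iInf_chordalSq_congr_user k k']

theorem integral_iInf_chordalSq_eq_mul_distortion (hsys : IsRVQSystem P H C) (hN : 1 ≤ N)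
    (k k' : Fin K) {h : Matrix (Fin (N * K)) (Fin N) ℂ} (hh : IsUnit (hᴴ * h).det) :
    ∫ ω, ⨅ i, chordalSq h (C k i ω) ∂P = N * distortion P H C k' := by
  have hN' : (N : ℝ) ≠ 0 := by positivity
  rw [distortion, mul_div_cancel₀ _ hN']
  have hmeas : Measurable fun x : Idx K B → Matrix (Fin (N * K)) (Fin N) ℂ =>
      ⨅ i, chordalSq (x (Sum.inl k')) (x (Sum.inr (k', i))) :=
    measurable_iInf_chordalSq (measurable_pi_apply _) fun i => measurable_pi_apply _
  have h1 := integral_mix (fun s => s = Sum.inl k') hsys.measurable_allMat hsys.iIndepFun_allMat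
    (F := fun x : Idx K B → Matrix (Fin (N * K)) (Fin N) ℂ =>
      ⨅ i, chordalSq (x (Sum.inl k')) (x (Sum.inr (k', i)))) hmeas
    (Integrable.of_bound (hmeas.comp hsys.measurable_allMat).aestronglyMeasurable (N : ℝ)
      (ae_of_all _ fun ω => abs_iInf_chordalSq_le _ fun i => hsys.codeword_semiunitary k' i ω))
  simp only [mix, if_true, reduceCtorEq, if_false, allMat] at h1
  rw [h1]
  have h2 : ∀ᵐ ω' ∂P, ∫ ω, ⨅ i, chordalSq (H k' ω') (C k' i ω) ∂P
      = ∫ ω, ⨅ i, chordalSq h (C k i ω) ∂P := by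
    filter_upwards [hsys.ae_isUnit_gram_channel k'] with ω' hω'
    exact hsys.integral_iInf_chordalSq_eq k' k hω' hh
  rw [integral_congr_ae h2]
  simp

theorem distortion_eq (hsys : IsRVQSystem P H C) (hN : 1 ≤ N) (k k' : Fin K) :
    distortion P H C k = distortion P H C k' := by
  obtain ⟨ω, hω⟩ := (hsys.ae_isUnit_gram_channel k).exists
  have hN' : (N : ℝ) ≠ 0 := by positivity
  exact mul_left_cancel₀ hN' ((hsys.integral_iInf_chordalSq_eq_mul_distortion hN k k hω).symm.trans
    (hsys.integral_iInf_chordalSq_eq_mul_distortion hN k k' hω))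

theorem integrable_iInf_chordalSq (hsys : IsRVQSystem P H C) (k : Fin K) :
    Integrable (fun ω => ⨅ i, chordalSq (H k ω) (C k i ω)) P :=
  Integrable.of_bound (measurable_iInf_chordalSq (hsys.measurable_channel k) fun i =>
    hsys.measurable_codeword k i).aestronglyMeasurable (N : ℝ)
    (ae_of_all _ fun ω => abs_iInf_chordalSq_le _ fun i => hsys.codeword_semiunitary k i ω)

theorem integral_pos_of_ae_pos {f : Ω → ℝ} (hf : Integrable f P) (h : ∀ᵐ ω ∂P, 0 < f ω) :
    0 < ∫ ω, f ω ∂P := by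
  have h0 : 0 ≤ᵐ[P] f := h.mono fun _ => le_of_lt
  refine lt_of_le_of_ne (integral_nonneg_of_ae h0) fun he => ?_
  obtain ⟨ω, h1, h2⟩ := (h.and ((integral_eq_zero_iff_of_nonneg_ae h0 hf).1 he.symm)).exists
  exact h1.ne' h2

theorem distortion_pos (hsys : IsRVQSystem P H C) (hN : 1 ≤ N) (hK : 2 ≤ K) (k : Fin K) :
    0 < distortion P H C k := by
  refine div_pos (integral_pos_of_ae_pos (hsys.integrable_iInf_chordalSq k) ?_) (by positivity)
  filter_upwards [ae_all_iff.2 fun i => hsys.ae_det_channel_compl_ne_zero hK k i] with ω hω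
  rw [iInf_eq_argminIdx]
  exact chordalSq_pos hN (hsys.codeword_semiunitary _ _ _) (hω _)

theorem distortion_lt_one (hsys : IsRVQSystem P H C) (hN : 1 ≤ N) (k : Fin K) :
    distortion P H C k < 1 := by
  have hi := hsys.integrable_iInf_chordalSq k
  have h : 0 < ∫ ω, ((N : ℝ) - ⨅ i, chordalSq (H k ω) (C k i ω)) ∂P := by
    refine integral_pos_of_ae_pos ((integrable_const _).sub hi) ?_
    filter_upwards [ae_all_iff.2 fun i => hsys.ae_det_codeword_mul_channel_ne_zero k (k, i)]
      with ω hω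
    rw [iInf_eq_argminIdx]
    exact sub_pos.2 (chordalSq_lt hN (hω _))
  rw [integral_sub (integrable_const _) hi] at h
  rw [distortion, div_lt_one (by positivity)]
  simpa using h

end IsRVQSystem

end Quantized

end LimitedFeedback

namespace LimitedFeedback

open scoped ENNReal ComplexOrder

set_option linter.unusedSectionVars false

/-! ### Block diagonalization as zero forcing. -/

section BlockDiagonalization

variable {N K : ℕ}

theorem colProj_mul_colProj_of_orthogonal {m n l : Type*} [Fintype m] [Fintype n] [Fintype l]
    [DecidableEq n] [DecidableEq l] {A : Matrix m n ℂ} {A' : Matrix m l ℂ} (h : Aᴴ * A' = 0) :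
    colProj A * colProj A' = 0 := by
  simp only [colProj, Matrix.mul_assoc]
  rw [← Matrix.mul_assoc Aᴴ, h]
  simp

theorem bd_unitary_mul {U : Matrix (Fin (N * K)) (Fin (N * K)) ℂ} (hU : Uᴴ * U = 1) (ρ : ℝ)
    (c : Fin K → Matrix (Fin (N * K)) (Fin N) ℂ) (k : Fin K) :
    bd ρ (fun j => U * c j) k = U * bd ρ c k * Uᴴ := by
  have h : (Matrix.of fun a (p : {j : Fin K // j ≠ k} × Fin N) => (U * c p.1) a p.2)
      = U * Matrix.of fun a (p : {j : Fin K // j ≠ k} × Fin N) => c p.1 a p.2 := by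
    ext a p
    simp [mul_apply]
  rw [bd, bd, h, colProj_isometry_mul hU, Matrix.mul_sub, Matrix.sub_mul, Matrix.mul_one,
    mul_eq_one_comm.1 hU]

theorem bd_congr (ρ ρ' : ℝ) {c c' : Fin K → Matrix (Fin (N * K)) (Fin N) ℂ} {k : Fin K}
    (h : ∀ j, j ≠ k → c j = c' j) : bd ρ c k = bd ρ' c' k := by
  have : (Matrix.of fun a (p : {j : Fin K // j ≠ k} × Fin N) => c p.1 a p.2)
      = Matrix.of fun a (p : {j : Fin K // j ≠ k} × Fin N) => c' p.1 a p.2 := by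
    ext a p
    simp only [of_apply, h p.1 p.1.2]
  rw [bd, bd, this]

theorem bd_conjTranspose (ρ : ℝ) (c : Fin K → Matrix (Fin (N * K)) (Fin N) ℂ) (k : Fin K) :
    (bd ρ c k)ᴴ = bd ρ c k := by
  rw [bd, conjTranspose_sub, conjTranspose_one, colProj_conjTranspose]

theorem bd_mul_self (ρ : ℝ) (c : Fin K → Matrix (Fin (N * K)) (Fin N) ℂ) (k : Fin K) :
    bd ρ c k * bd ρ c k = bd ρ c k := by
  rw [bd, Matrix.sub_mul, Matrix.mul_sub, Matrix.mul_sub, colProj_mul_self]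
  simp

theorem isHermitian_gramSum (c : Fin K → Matrix (Fin (N * K)) (Fin N) ℂ) :
    (∑ j, c j * (c j)ᴴ)ᴴ = ∑ j, c j * (c j)ᴴ :=
  (posSemidef_sum_mul_conjTranspose c).1

/-- In general position, the block diagonalization precoder is zero forcing. -/
theorem bd_eq_colProj (ρ : ℝ) {c : Fin K → Matrix (Fin (N * K)) (Fin N) ℂ}
    (hS : IsUnit (∑ j, c j * (c j)ᴴ).det) (k : Fin K) :
    bd ρ c k = colProj ((∑ j, c j * (c j)ᴴ)⁻¹ * c k) := by
  have hcard : Fintype.card (Fin (N * K)) = Fintype.card (Fin K) * Fintype.card (Fin N) := by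
    simp [mul_comm]
  have hb := conjTranspose_mul_inv_mul hcard hS
  set S := ∑ j, c j * (c j)ᴴ with hSdef
  have hSh : Sᴴ = S := isHermitian_gramSum c
  set W := S⁻¹ * c k
  let E : Matrix (Fin (N * K)) ({j : Fin K // j ≠ k} × Fin N) ℂ := of fun a p => c p.1 a p.2
  let L : Matrix ({j : Fin K // j ≠ k} × Fin N) (Fin (N * K)) ℂ :=
    of fun p a => (S⁻¹ * c p.1)ᴴ p.2 a
  have hLE : L * E = 1 := by
    ext p q
    have h1 : (L * E) p q = ((S⁻¹ * c p.1)ᴴ * c q.1) p.2 q.2 := by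
      simp only [L, E, mul_apply, of_apply]
    have h2 : (S⁻¹ * c p.1)ᴴ * c q.1 = if (p.1 : Fin K) = q.1 then 1 else 0 := by
      rw [conjTranspose_mul, conjTranspose_nonsing_inv, hSh, Matrix.mul_assoc, hb]
    have h3 : p = q ↔ (p.1 : Fin K) = q.1 ∧ p.2 = q.2 := by
      rw [Prod.ext_iff, Subtype.ext_iff]
    rw [h1, h2]
    by_cases h : (p.1 : Fin K) = q.1 <;> simp [h, h3, one_apply]
  have hE := isUnit_det_gram_of_leftInverse hLE
  have hW : IsUnit (Wᴴ * W).det :=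
    isUnit_det_gram_of_leftInverse (L := (c k)ᴴ) (by rw [hb, if_pos rfl])
  have hEW : Eᴴ * W = 0 := by
    ext p b
    have h1 : (Eᴴ * W) p b = ((c p.1)ᴴ * W) p.2 b := by
      simp only [E, mul_apply, conjTranspose_apply, of_apply]
    rw [h1, hb, if_neg p.1.2]
    rfl
  have hWE : Wᴴ * E = 0 := by
    have := congrArg conjTranspose hEW
    rwa [conjTranspose_mul, conjTranspose_conjTranspose, conjTranspose_zero] at this
  have h1 : colProj E * colProj W = 0 := colProj_mul_colProj_of_orthogonal hEW
  have h2 : colProj W * colProj E = 0 := colProj_mul_colProj_of_orthogonal hWE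
  -- The two projectors are orthogonal, so this difference is itself a projector. Its trace is `N K
  -- - (K - 1) N - N = 0`, hence so is its Frobenius norm.
  have h3 : 1 - (colProj E + colProj W) = 0 := by
    refine eq_zero_of_frobSq_eq_zero ?_
    have hh : (1 - (colProj E + colProj W))ᴴ = 1 - (colProj E + colProj W) := by
      simp only [conjTranspose_sub, conjTranspose_add, conjTranspose_one, colProj_conjTranspose]
    have hm : (1 - (colProj E + colProj W)) * (1 - (colProj E + colProj W))
        = 1 - (colProj E + colProj W) := by
      simp only [Matrix.sub_mul, Matrix.mul_sub, Matrix.add_mul, Matrix.mul_add, Matrix.one_mul,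
        Matrix.mul_one, colProj_mul_self, h1, h2]
      abel
    have ht := trace_mul_conjTranspose_eq_frobSq (1 - (colProj E + colProj W))
    rw [hh, hm, trace_sub, trace_add, trace_one, trace_colProj hE, trace_colProj hW] at ht
    have hc : (Fintype.card ({j : Fin K // j ≠ k} × Fin N) : ℂ) + N = (N * K : ℕ) := by
      rw [Fintype.card_prod, Fintype.card_subtype_compl, Fintype.card_subtype_eq]
      have : 1 ≤ K := k.pos
      simp only [Fintype.card_fin]
      push_cast [Nat.cast_sub this]
      ring
    rw [Fintype.card_fin, Fintype.card_fin, hc, sub_self] at ht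
    exact_mod_cast ht.symm
  have h4 : colProj W = 1 - colProj E := by
    rw [sub_eq_zero] at h3
    rw [h3, add_sub_cancel_left]
  rw [h4]
  rfl

theorem isUnit_gram_zeroForcing {c : Fin K → Matrix (Fin (N * K)) (Fin N) ℂ}
    (hS : IsUnit (∑ j, c j * (c j)ᴴ).det) (k : Fin K) :
    IsUnit (((∑ j, c j * (c j)ᴴ)⁻¹ * c k)ᴴ * ((∑ j, c j * (c j)ᴴ)⁻¹ * c k)).det :=
  isUnit_det_gram_of_leftInverse (L := (c k)ᴴ)
    (by rw [conjTranspose_mul_inv_mul (by simp [mul_comm]) hS, if_pos rfl])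

theorem trace_bd (ρ : ℝ) {c : Fin K → Matrix (Fin (N * K)) (Fin N) ℂ}
    (hS : IsUnit (∑ j, c j * (c j)ᴴ).det) (k : Fin K) : (bd ρ c k).trace = N := by
  rw [bd_eq_colProj ρ hS, trace_colProj (isUnit_gram_zeroForcing hS k), Fintype.card_fin]

theorem bd_mul_of_ne (ρ : ℝ) {c : Fin K → Matrix (Fin (N * K)) (Fin N) ℂ}
    (hS : IsUnit (∑ j, c j * (c j)ᴴ).det) {k j : Fin K} (hj : j ≠ k) : bd ρ c k * c j = 0 := by
  have hb := conjTranspose_mul_inv_mul (by simp [mul_comm]) hS k j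
  rw [if_neg hj.symm] at hb
  have : ((∑ j, c j * (c j)ᴴ)⁻¹ * c k)ᴴ * c j = 0 := by
    rw [conjTranspose_mul, conjTranspose_nonsing_inv, isHermitian_gramSum, Matrix.mul_assoc, hb]
  rw [bd_eq_colProj ρ hS, colProj, Matrix.mul_assoc, this, Matrix.mul_zero]

theorem measurable_bd (ρ : ℝ) (k : Fin K) :
    Measurable fun c : Fin K → Matrix (Fin (N * K)) (Fin N) ℂ => bd ρ c k :=
  measurable_const.matrix_sub (Measurable.colProj (measurable_matrix_iff.2 fun a p =>
    (measurable_pi_apply (p.1 : Fin K)).matrix_apply a p.2))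

theorem norm_bd_apply_le (ρ : ℝ) (c : Fin K → Matrix (Fin (N * K)) (Fin N) ℂ) (k : Fin K)
    (a b : Fin (N * K)) : ‖bd ρ c k a b‖ ≤ 1 :=
  norm_apply_le_one_of_proj (bd_conjTranspose ρ c k) (bd_mul_self ρ c k) a b

end BlockDiagonalization

/-! ### Correlations between channels and precoder projectors. -/

section Correlations

variable {N K B : ℕ} {Ω : Type*} [MeasurableSpace Ω] {P : Measure Ω} [IsProbabilityMeasure P]
  {H : Fin K → Ω → Matrix (Fin (N * K)) (Fin N) ℂ}
  {C : Fin K → Fin (2 ^ B) → Ω → Matrix (Fin (N * K)) (Fin N) ℂ}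

/-- The channel and the codebook of user `k`. -/
def userBlock (k : Fin K) (s : Idx K B) : Prop := Sum.elim id Prod.fst s = k

instance (k : Fin K) : DecidablePred (userBlock (B := B) k) := fun _ =>
  inferInstanceAs (Decidable (_ = _))

theorem quantizedOf_mix_self (k : Fin K) (x y : Idx K B → Matrix (Fin (N * K)) (Fin N) ℂ) :
    quantizedOf (mix (userBlock k) x y) k = quantizedOf x k :=
  quantizedOf_congr (by simp [mix, userBlock]) fun i => by simp [mix, userBlock]

theorem quantizedOf_mix_of_ne {k j : Fin K} (h : j ≠ k)
    (x y : Idx K B → Matrix (Fin (N * K)) (Fin N) ℂ) :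
    quantizedOf (mix (userBlock k) x y) j = quantizedOf y j :=
  quantizedOf_congr (by simp [mix, userBlock, h]) fun i => by simp [mix, userBlock, h]

theorem measurable_quantizedOf_family :
    Measurable fun (x : Idx K B → Matrix (Fin (N * K)) (Fin N) ℂ) => quantizedOf x :=
  measurable_pi_iff.2 fun j => measurable_quantizedOf j

theorem measurable_outer_quantizedOf (k : Fin K) :
    Measurable fun x : Idx K B → Matrix (Fin (N * K)) (Fin N) ℂ =>
      quantizedOf x k * (quantizedOf x k)ᴴ :=
  (measurable_quantizedOf k).matrix_mul (measurable_quantizedOf k).matrix_conjTranspose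

/-- The power argument of `bd` is a dummy; `0` is the representative chosen from here on. -/
theorem measurable_bd_quantizedOf (k : Fin K) :
    Measurable fun x : Idx K B → Matrix (Fin (N * K)) (Fin N) ℂ => bd 0 (quantizedOf x) k :=
  (measurable_bd 0 k).comp measurable_quantizedOf_family

theorem measurable_channelGram (k : Fin K) :
    Measurable fun x : Idx K B → Matrix (Fin (N * K)) (Fin N) ℂ =>
      x (Sum.inl k) * (x (Sum.inl k))ᴴ :=
  (measurable_pi_apply _).matrix_mul (measurable_pi_apply _).matrix_conjTranspose

namespace IsRVQSystem

theorem quantizedOf_mix_semiunitary (hsys : IsRVQSystem P H C) (T : Idx K B → Prop)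
    [DecidablePred T] (k : Fin K) (ω' ω : Ω) :
    (quantizedOf (mix T (allMat H C ω') (allMat H C ω)) k)ᴴ
      * quantizedOf (mix T (allMat H C ω') (allMat H C ω)) k = 1 := by
  have h : ∀ i, (mix T (allMat H C ω') (allMat H C ω) (Sum.inr (k, i)))ᴴ
      * mix T (allMat H C ω') (allMat H C ω) (Sum.inr (k, i)) = 1 := fun i => by
    simp only [mix]
    split_ifs
    · exact hsys.codeword_semiunitary _ _ _
    · exact hsys.codeword_semiunitary _ _ _
  exact h _

theorem integrable_frobSq_channel (hsys : IsRVQSystem P H C) (k : Fin K) :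
    Integrable (fun ω => frobSq (H k ω)) P ∧ ∫ ω, frobSq (H k ω) ∂P = (N * K : ℕ) * N := by
  have h0 := integrable_norm_sq_stdComplexGaussian
  have hm : ∀ a b, AEMeasurable (fun ω => H k ω a b) P := fun a b =>
    ((hsys.measurable_channel k).matrix_apply a b).aemeasurable
  have hi : ∀ a b, Integrable (fun ω => ‖H k ω a b‖ ^ 2) P := fun a b => by
    have h1 := h0.1
    rw [← hsys.channel_entry_law k a b] at h1
    exact (integrable_map_measure (by fun_prop) (hm a b)).1 h1
  have hv : ∀ a b, ∫ ω, ‖H k ω a b‖ ^ 2 ∂P = 1 := fun a b => by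
    rw [← h0.2, ← hsys.channel_entry_law k a b,
      integral_map (f := fun z : ℂ => ‖z‖ ^ 2) (hm a b) (by fun_prop)]
  refine ⟨integrable_finsetSum _ fun a _ => integrable_finsetSum _ fun b _ => hi a b, ?_⟩
  simp only [frobSq]
  rw [integral_finsetSum _ fun a _ => integrable_finsetSum _ fun b _ => hi a b]
  simp only [integral_finsetSum _ fun b _ => hi _ b, hv]
  simp

theorem integrable_channelGram (hsys : IsRVQSystem P H C) (k : Fin K) (i j : Fin (N * K)) :
    Integrable (fun ω => (H k ω * (H k ω)ᴴ) i j) P := by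
  refine (hsys.integrable_frobSq_channel k).1.mono' ?_
    (ae_of_all _ fun ω => norm_mul_conjTranspose_apply_le _ i j)
  exact (((hsys.measurable_channel k).matrix_mul
    (hsys.measurable_channel k).matrix_conjTranspose).matrix_apply i j).aestronglyMeasurable

theorem integral_trace_channelGram (hsys : IsRVQSystem P H C) (k : Fin K) :
    ∫ ω, (H k ω * (H k ω)ᴴ).trace ∂P = (N * K : ℕ) * N := by
  simp only [trace_mul_conjTranspose_eq_frobSq]
  rw [integral_complex_ofReal, (hsys.integrable_frobSq_channel k).2]
  push_cast
  ring

/-- An equivariant random matrix with almost surely constant trace has scalar mean. -/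
theorem matExp_eq_smul_one (hsys : IsRVQSystem P H C) (hNK : N * K ≠ 0)
    {F : (Idx K B → Matrix (Fin (N * K)) (Fin N) ℂ) → Matrix (Fin (N * K)) (Fin (N * K)) ℂ}
    (hF : Measurable F) {c : ℝ} (hFc : ∀ ω i j, ‖F (allMat H C ω) i j‖ ≤ c)
    (hFU : ∀ U ∈ unitaryGroup (Fin (N * K)) ℂ, ∀ x, F (fun s => U * x s) = U * F x * Uᴴ)
    {τ : ℂ} (hτ : ∀ᵐ ω ∂P, (F (allMat H C ω)).trace = τ) :
    matExp P (fun ω => F (allMat H C ω)) = (τ / (N * K : ℕ)) • 1 := by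
  obtain ⟨a, ha⟩ := exists_matExp_mul_eq_smul (P := P) (X := fun ω => F (allMat H C ω))
    (Q := 1) (Matrix.mul_one 1) conjTranspose_one
    fun U hU _ _ => hsys.matExp_eq_conj hF hFc hU fun ω => hFU U hU _
  rw [Matrix.mul_one] at ha
  have hint : ∀ i j, Integrable (fun ω => F (allMat H C ω) i j) P := fun i j =>
    integrable_of_bounded ((hF.comp hsys.measurable_allMat).matrix_apply i j) fun ω => hFc ω i j
  have ht := trace_matExp hint
  rw [ha, trace_smul, trace_one, integral_congr_ae hτ, Fintype.card_fin] at ht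
  have hne : ((N * K : ℕ) : ℂ) ≠ 0 := Nat.cast_ne_zero.2 hNK
  rw [ha]
  congr 1
  rw [eq_div_iff hne, ← smul_eq_mul, ht]
  simp

/-- Correlation of a user's channel with an equivariant random matrix independent of that user. -/
theorem integral_trace_mul_channelGram_of_indep (hsys : IsRVQSystem P H C) (hNK : N * K ≠ 0)
    (k : Fin K)
    {F : (Idx K B → Matrix (Fin (N * K)) (Fin N) ℂ) → Matrix (Fin (N * K)) (Fin (N * K)) ℂ}
    (hF : Measurable F) {c : ℝ} (hFc : ∀ ω i j, ‖F (allMat H C ω) i j‖ ≤ c)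
    (hFU : ∀ U ∈ unitaryGroup (Fin (N * K)) ℂ, ∀ x, F (fun s => U * x s) = U * F x * Uᴴ)
    (hFk : ∀ x y, F (mix (userBlock k) x y) = F y)
    (hτ : ∀ᵐ ω ∂P, (F (allMat H C ω)).trace = N) :
    ∫ ω, (F (allMat H C ω) * (H k ω * (H k ω)ᴴ)).trace ∂P = N * N := by
  have h1 := integral_trace_mul_mix (userBlock k) hsys.measurable_allMat hsys.iIndepFun_allMat
    (F := F) (b := fun x => x (Sum.inl k) * (x (Sum.inl k))ᴴ) hF (measurable_channelGram k)
    (c := c) (fun ω' ω i j => by rw [hFk]; exact hFc ω i j)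
    (fun ω' ω => by simp [mix, userBlock]) (hsys.integrable_channelGram k)
  simp only [hFk, hsys.matExp_eq_smul_one hNK hF hFc hFU hτ, allMat] at h1
  rw [h1]
  simp only [Matrix.smul_mul, Matrix.one_mul, trace_smul, smul_eq_mul]
  rw [integral_const_mul, hsys.integral_trace_channelGram k]
  have hne : ((N * K : ℕ) : ℂ) ≠ 0 := Nat.cast_ne_zero.2 hNK
  field_simp

theorem integral_trace_outer_mul_channelGram_of_ne (hsys : IsRVQSystem P H C) (hNK : N * K ≠ 0)
    {k j : Fin K} (hj : j ≠ k) :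
    ∫ ω, (quantizedOf (allMat H C ω) j * (quantizedOf (allMat H C ω) j)ᴴ
      * (H k ω * (H k ω)ᴴ)).trace ∂P = N * N := by
  refine hsys.integral_trace_mul_channelGram_of_indep hNK k
    (F := fun x => quantizedOf x j * (quantizedOf x j)ᴴ) (measurable_outer_quantizedOf j) (c := 1)
    (fun ω => norm_outer_apply_le (hsys.quantizedOf_semiunitary j ω)) (fun U hU x => ?_)
    (fun x y => by simp only [quantizedOf_mix_of_ne hj]) (ae_of_all _ fun ω => ?_)
  · simp only [quantizedOf_unitary_mul (mem_unitaryGroup_iff'.1 hU), conjTranspose_mul,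
      Matrix.mul_assoc]
  · rw [trace_outer_of_orthonormal (hsys.quantizedOf_semiunitary j ω), Fintype.card_fin]

theorem ae_isUnit_gramSum (hsys : IsRVQSystem P H C) :
    ∀ᵐ ω ∂P, IsUnit (∑ j, quantizedOf (allMat H C ω) j * (quantizedOf (allMat H C ω) j)ᴴ).det := by
  filter_upwards [hsys.ae_det_gramSum_ne_zero] with ω h
  exact isUnit_iff_ne_zero.2 (h _)

/-- The BD projector of user `k` is built from the other users only, so it is independent of `H_k`,
equivariant, and almost surely of trace `N`. -/
theorem integral_trace_bd_mul_channelGram (hsys : IsRVQSystem P H C) (hNK : N * K ≠ 0)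
    (k : Fin K) :
    ∫ ω, (bd 0 (quantizedOf (allMat H C ω)) k * (H k ω * (H k ω)ᴴ)).trace ∂P = N * N := by
  have hb : ∀ ω i j, ‖bd 0 (quantizedOf (allMat H C ω)) k i j‖ ≤ 1 := fun ω =>
    norm_bd_apply_le 0 _ k
  have hU : ∀ U ∈ unitaryGroup (Fin (N * K)) ℂ,
      ∀ x : Idx K B → Matrix (Fin (N * K)) (Fin N) ℂ,
      bd 0 (quantizedOf fun s => U * x s) k = U * bd 0 (quantizedOf x) k * Uᴴ := fun U hU x => by
    have hU' := mem_unitaryGroup_iff'.1 hU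
    have h : (quantizedOf fun s => U * x s) = fun j => U * quantizedOf x j :=
      funext fun j => quantizedOf_unitary_mul hU' x j
    rw [h, bd_unitary_mul hU']
  have hk : ∀ x y : Idx K B → Matrix (Fin (N * K)) (Fin N) ℂ,
      bd 0 (quantizedOf (mix (userBlock k) x y)) k = bd 0 (quantizedOf y) k := fun x y =>
    bd_congr _ _ fun j hj => quantizedOf_mix_of_ne hj x y
  refine hsys.integral_trace_mul_channelGram_of_indep hNK k
    (F := fun x => bd 0 (quantizedOf x) k) (measurable_bd_quantizedOf k) (c := 1) hb hU hk ?_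
  filter_upwards [hsys.ae_isUnit_gramSum] with ω hω
  exact trace_bd 0 hω k

/-- With `H_k` frozen, rotating the codebook by a unitary commuting with the projector onto its
columns changes neither the chordal distances nor the law. Schur's argument makes the mean of `Ĥ_k
Ĥ_kᴴ` a scalar on that column space. -/
theorem matExp_outer_mul_colProj (hsys : IsRVQSystem P H C) (hN : 1 ≤ N) (k : Fin K) {ω' : Ω}
    (hω' : IsUnit ((H k ω')ᴴ * H k ω').det) :
    matExp P (fun ω => quantizedOf (mix (fun s => s = Sum.inl k) (allMat H C ω') (allMat H C ω)) k
        * (quantizedOf (mix (fun s => s = Sum.inl k) (allMat H C ω') (allMat H C ω)) k)ᴴ)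
      * colProj (H k ω') = ((1 - distortion P H C k : ℝ) : ℂ) • colProj (H k ω') := by
  set h := H k ω'
  obtain ⟨G, hG, hGm⟩ : ∃ G : (Idx K B → Matrix (Fin (N * K)) (Fin N) ℂ) →
      Matrix (Fin (N * K)) (Fin N) ℂ,
      (∀ y, quantizedOf (mix (fun s => s = Sum.inl k) (allMat H C ω') y) k = G y) ∧
        Measurable G := by
    refine ⟨fun y => quantizedOf (mix (fun s => s = Sum.inl k) (allMat H C ω') y) k,
      fun _ => rfl, ?_⟩
    have h1 : Measurable fun y : Idx K B → Matrix (Fin (N * K)) (Fin N) ℂ =>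
        mix (fun s => s = Sum.inl k) (allMat H C ω') y :=
      (measurable_mix (X := Matrix (Fin (N * K)) (Fin N) ℂ)
        fun s : Idx K B => s = Sum.inl k).comp measurable_prodMk_left
    exact (measurable_quantizedOf k).comp h1
  simp only [hG]
  have hFm : Measurable fun y => G y * (G y)ᴴ := hGm.matrix_mul hGm.matrix_conjTranspose
  have hG1 : ∀ ω, (G (allMat H C ω))ᴴ * G (allMat H C ω) = 1 := fun ω => by
    rw [← hG]
    exact hsys.quantizedOf_mix_semiunitary _ k ω' ω
  have hFc : ∀ ω i j, ‖(G (allMat H C ω) * (G (allMat H C ω))ᴴ) i j‖ ≤ 1 := fun ω =>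
    norm_outer_apply_le (hG1 ω)
  obtain ⟨a, ha⟩ := exists_matExp_mul_eq_smul (P := P)
    (X := fun ω => G (allMat H C ω) * (G (allMat H C ω))ᴴ) (colProj_mul_self h)
    (colProj_conjTranspose h) fun U hU _ hcomm => by
      have hU' : Uᴴ * U = 1 := mem_unitaryGroup_iff'.1 hU
      refine hsys.matExp_eq_conj (F := fun y => G y * (G y)ᴴ) hFm hFc hU fun ω => ?_
      have : G (fun s => U * allMat H C ω s) = U * G (allMat H C ω) := by
        rw [← hG, ← hG]
        exact quantizedOf_eq_mul (fun i => by
          simp only [mix, if_true, reduceCtorEq, if_false]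
          exact chordalSq_mul_of_commute hU' hcomm _) fun i => by simp [mix]
      rw [this, conjTranspose_mul]
      simp only [Matrix.mul_assoc]
  have hint : ∀ i j, Integrable (fun ω => (G (allMat H C ω) * (G (allMat H C ω))ᴴ) i j) P :=
    fun i j => integrable_of_bounded ((hFm.comp hsys.measurable_allMat).matrix_apply i j)
      fun ω => hFc ω i j
  -- The trace identifies the scalar: `N a` is `N` minus the expected minimal distance `N γ`.
  have ht := congrArg trace ha
  rw [← matExp_mul_right hint, trace_matExp (integrable_mul_right hint _), trace_smul,
    trace_colProj hω', Fintype.card_fin] at ht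
  have hval : ∀ ω, (G (allMat H C ω) * (G (allMat H C ω))ᴴ * colProj h).trace
      = ((N - ⨅ i, chordalSq h (C k i ω) : ℝ) : ℂ) := fun ω => by
    have h1 : ⨅ i, chordalSq h (C k i ω) = chordalSq h (G (allMat H C ω)) := by
      rw [iInf_eq_argminIdx]
      rw [← hG]
      simp only [quantizedOf, mix, if_true, reduceCtorEq, if_false]
      rfl
    rw [h1, chordalSq_eq_sub_frobSq, sub_sub_cancel, trace_mul_comm,
      trace_proj_mul_outer (colProj_conjTranspose h) (colProj_mul_self h)]
  simp only [hval] at ht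
  rw [integral_complex_ofReal, integral_sub (integrable_const _)
    (Integrable.of_bound (measurable_iInf_chordalSq measurable_const fun i =>
      hsys.measurable_codeword k i).aestronglyMeasurable (N : ℝ)
      (ae_of_all _ fun ω => abs_iInf_chordalSq_le h fun i => hsys.codeword_semiunitary k i ω)),
    hsys.integral_iInf_chordalSq_eq_mul_distortion hN k k hω'] at ht
  have hN' : (N : ℂ) ≠ 0 := Nat.cast_ne_zero.2 (by omega)
  have hav : a = ((1 - distortion P H C k : ℝ) : ℂ) := by
    refine mul_right_cancel₀ hN' ?_
    rw [← smul_eq_mul, ← ht]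
    simp
    ring
  rw [← hav]
  exact ha

theorem integral_trace_outer_mul_channelGram (hsys : IsRVQSystem P H C) (hN : 1 ≤ N)
    (k : Fin K) :
    ∫ ω, (quantizedOf (allMat H C ω) k * (quantizedOf (allMat H C ω) k)ᴴ
      * (H k ω * (H k ω)ᴴ)).trace ∂P
      = ((1 - distortion P H C k : ℝ) : ℂ) * ((N * K : ℕ) * N) := by
  have h1 := integral_trace_mul_mix (fun s => s = Sum.inl k) hsys.measurable_allMat
    hsys.iIndepFun_allMat (F := fun x => quantizedOf x k * (quantizedOf x k)ᴴ)
    (b := fun x => x (Sum.inl k) * (x (Sum.inl k))ᴴ) (measurable_outer_quantizedOf k)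
    (measurable_channelGram k) (c := 1)
    (fun ω' ω => norm_outer_apply_le (hsys.quantizedOf_mix_semiunitary _ k ω' ω))
    (fun ω' ω => by simp [mix]) (hsys.integrable_channelGram k)
  refine h1.trans ?_
  rw [← hsys.integral_trace_channelGram k, ← integral_const_mul]
  refine integral_congr_ae ?_
  filter_upwards [hsys.ae_isUnit_gram_channel k] with ω' hω'
  change (_ * (H k ω' * (H k ω')ᴴ)).trace = _
  rw [← smul_eq_mul (a := ((1 - distortion P H C k : ℝ) : ℂ)), ← trace_smul]
  congr 1
  rw [← colProj_mul_cancel hω', Matrix.mul_assoc (colProj (H k ω')), ← Matrix.mul_assoc,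
    colProj_mul_cancel hω', hsys.matExp_outer_mul_colProj hN k hω', Matrix.smul_mul]

/-- With user `k` frozen, the remaining symmetry consists of the unitaries fixing the columns of
`Ĥ_k`, so the mean is a scalar on their orthogonal complement. Zero forcing makes it vanish on the
columns themselves, and trace `N` over dimension `(K - 1) N` gives `1 / (K - 1)`. -/
theorem matExp_bd_of_ne (hsys : IsRVQSystem P H C) (hN : 1 ≤ N) (hK : 2 ≤ K) {k j : Fin K}
    (hj : j ≠ k) {ω' : Ω}
    (hω' : ∀ᵐ ω ∂P, IsUnit (∑ l, quantizedOf (mix (userBlock k) (allMat H C ω') (allMat H C ω)) l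
      * (quantizedOf (mix (userBlock k) (allMat H C ω') (allMat H C ω)) l)ᴴ).det) :
    matExp P (fun ω => bd 0 (quantizedOf (mix (userBlock k) (allMat H C ω') (allMat H C ω))) j)
      = (1 / (K - 1 : ℂ)) •
        (1 - quantizedOf (allMat H C ω') k * (quantizedOf (allMat H C ω') k)ᴴ) := by
  set c := quantizedOf (allMat H C ω') k with hc
  have hc1 : cᴴ * c = 1 := hsys.quantizedOf_semiunitary k ω'
  let F : (Idx K B → Matrix (Fin (N * K)) (Fin N) ℂ) → Matrix (Fin (N * K)) (Fin (N * K)) ℂ :=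
    fun y => bd 0 (quantizedOf (mix (userBlock k) (allMat H C ω') y)) j
  have hFm : Measurable F := (measurable_bd_quantizedOf j).comp
    ((measurable_mix _).comp measurable_prodMk_left)
  have hFc : ∀ ω a b, ‖F (allMat H C ω) a b‖ ≤ 1 := fun ω => norm_bd_apply_le 0 _ j
  obtain ⟨r, hr⟩ := exists_matExp_mul_eq_smul (P := P) (X := fun ω => F (allMat H C ω))
    (one_sub_outer_mul_self hc1) (one_sub_outer_conjTranspose c) fun U hU hUv _ => by
      have hU' : Uᴴ * U = 1 := mem_unitaryGroup_iff'.1 hU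
      refine hsys.matExp_eq_conj (F := F) hFm hFc hU fun ω => ?_
      have hUc : U * c = c := by
        ext a b
        have h0 : (1 - c * cᴴ) *ᵥ (fun i => c i b) = 0 := by
          ext i
          have := congrFun (congrFun (one_sub_outer_mul hc1) i) b
          simpa [mul_apply, mulVec, dotProduct] using this
        have := congrFun (hUv _ h0) a
        simpa [mul_apply, mulVec, dotProduct] using this
      rw [← bd_unitary_mul hU']
      simp only [F]
      congr 1
      funext l
      by_cases hl : l = k
      · subst hl
        rw [quantizedOf_mix_self, quantizedOf_mix_self, ← hc, hUc]
      · rw [quantizedOf_mix_of_ne hl, quantizedOf_mix_of_ne hl, quantizedOf_unitary_mul hU']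
  have hint : ∀ a b, Integrable (fun ω => F (allMat H C ω) a b) P :=
    fun a b => integrable_of_bounded ((hFm.comp hsys.measurable_allMat).matrix_apply a b)
      fun ω => hFc ω a b
  -- User `j` nulls its signal on `Ĥ_k` almost surely, so the projector off `Ĥ_k` is absorbed.
  have hR : matExp P (fun ω => F (allMat H C ω)) * (1 - c * cᴴ)
      = matExp P (fun ω => F (allMat H C ω)) := by
    rw [← matExp_mul_right hint]
    ext a b
    simp only [matExp, of_apply]
    refine integral_congr_ae ?_
    filter_upwards [hω'] with ω hω
    have h0 := bd_mul_of_ne 0 hω hj.symm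
    rw [quantizedOf_mix_self, ← hc] at h0
    have : F (allMat H C ω) * (1 - c * cᴴ) = F (allMat H C ω) := by
      rw [Matrix.mul_sub, Matrix.mul_one, ← Matrix.mul_assoc]
      simp only [F]
      rw [h0, Matrix.zero_mul, sub_zero]
    exact congrFun (congrFun this a) b
  rw [hR] at hr
  have ht := congrArg trace hr
  have hτ : ∫ ω, (F (allMat H C ω)).trace ∂P = N := by
    have : ∀ᵐ ω ∂P, (F (allMat H C ω)).trace = N := hω'.mono fun ω hω => trace_bd 0 hω j
    rw [integral_congr_ae this]
    simp
  rw [trace_matExp hint, hτ, trace_smul, trace_sub, trace_one, trace_outer_of_orthonormal hc1,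
    Fintype.card_fin, Fintype.card_fin, smul_eq_mul] at ht
  have hN' : (N : ℂ) ≠ 0 := Nat.cast_ne_zero.2 (by omega)
  have hK' : (K - 1 : ℂ) ≠ 0 := by
    rw [sub_ne_zero]
    exact_mod_cast (by omega : K ≠ 1)
  have hrv : r = 1 / (K - 1 : ℂ) := by
    rw [eq_div_iff hK']
    refine mul_left_cancel₀ hN' ?_
    rw [mul_one]
    conv_rhs => rw [ht]
    push_cast
    ring
  rw [← hrv]
  exact hr

/-- The leaked power is what the quantization misses: the total channel power minus its fraction `1
- γ` along `Ĥ_k`, divided by `K - 1`. -/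
theorem integral_trace_bd_mul_channelGram_of_ne (hsys : IsRVQSystem P H C) (hN : 1 ≤ N)
    (hK : 2 ≤ K) {k j : Fin K} (hj : j ≠ k) :
    ∫ ω, (bd 0 (quantizedOf (allMat H C ω)) j * (H k ω * (H k ω)ᴴ)).trace ∂P
      = (1 / (K - 1 : ℂ)) * (distortion P H C k * ((N * K : ℕ) * N)) := by
  have h1 := integral_trace_mul_mix (userBlock k) hsys.measurable_allMat hsys.iIndepFun_allMat
    (F := fun x => bd 0 (quantizedOf x) j) (b := fun x => x (Sum.inl k) * (x (Sum.inl k))ᴴ)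
    (measurable_bd_quantizedOf j) (measurable_channelGram k) (c := 1)
    (fun ω' ω => norm_bd_apply_le 0 _ j)
    (fun ω' ω => by simp [mix, userBlock]) (hsys.integrable_channelGram k)
  refine h1.trans ?_
  have hset : MeasurableSet {x : Idx K B → Matrix (Fin (N * K)) (Fin N) ℂ |
      IsUnit (∑ l, quantizedOf x l * (quantizedOf x l)ᴴ).det} := by
    simp only [isUnit_iff_ne_zero]
    exact ((Measurable.matrix_sum fun l => measurable_outer_quantizedOf l).matrix_det)
      (measurableSet_singleton 0).compl
  have h2 := ae_mix_of_ae (userBlock k) hsys.measurable_allMat hsys.iIndepFun_allMat hset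
    hsys.ae_isUnit_gramSum
  have h3 : ∀ᵐ ω' ∂P, (matExp P (fun ω => bd 0
      (quantizedOf (mix (userBlock k) (allMat H C ω') (allMat H C ω))) j)
      * (allMat H C ω' (Sum.inl k) * (allMat H C ω' (Sum.inl k))ᴴ)).trace
      = (1 / (K - 1 : ℂ)) * ((H k ω' * (H k ω')ᴴ).trace -
        (quantizedOf (allMat H C ω') k * (quantizedOf (allMat H C ω') k)ᴴ
          * (H k ω' * (H k ω')ᴴ)).trace) := by
    filter_upwards [h2] with ω' hω'
    rw [hsys.matExp_bd_of_ne hN hK hj hω', Matrix.smul_mul, trace_smul, smul_eq_mul,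
      Matrix.sub_mul, Matrix.one_mul, trace_sub]
    rfl
  rw [integral_congr_ae h3, integral_const_mul]
  have hi1 : Integrable (fun ω => (H k ω * (H k ω)ᴴ).trace) P :=
    integrable_finsetSum _ fun i _ => hsys.integrable_channelGram k i i
  have hi2 : Integrable (fun ω => (quantizedOf (allMat H C ω) k * (quantizedOf (allMat H C ω) k)ᴴ
      * (H k ω * (H k ω)ᴴ)).trace) P := by
    refine integrable_finsetSum _ fun i _ => ?_
    change Integrable (fun ω => ∑ l, (quantizedOf (allMat H C ω) k
      * (quantizedOf (allMat H C ω) k)ᴴ) i l * (H k ω * (H k ω)ᴴ) l i) P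
    refine integrable_finsetSum _ fun l _ => ?_
    exact (hsys.integrable_channelGram k l i).bdd_mul (c := 1)
      (((measurable_outer_quantizedOf k).comp
        hsys.measurable_allMat).matrix_apply i l).aestronglyMeasurable
      (ae_of_all _ fun ω => norm_outer_apply_le (hsys.quantizedOf_semiunitary k ω) i l)
  rw [integral_sub hi1 hi2, hsys.integral_trace_channelGram,
    hsys.integral_trace_outer_mul_channelGram hN]
  push_cast
  ring

end IsRVQSystem

end Correlations

end LimitedFeedback

namespace LimitedFeedback

open scoped ENNReal ComplexOrder

set_option linter.unusedSectionVars false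

/-! ### Mean gains and the log-det of expectations. -/

section Means

variable {N K B : ℕ} {Ω : Type*} [MeasurableSpace Ω] {P : Measure Ω} [IsProbabilityMeasure P]
  {H : Fin K → Ω → Matrix (Fin (N * K)) (Fin N) ℂ}
  {C : Fin K → Fin (2 ^ B) → Ω → Matrix (Fin (N * K)) (Fin N) ℂ}

/-- A precoder given by measurable orthogonal projectors. -/
structure IsProjPrecoder (pre : ℝ → (Fin K → Matrix (Fin (N * K)) (Fin N) ℂ) → Fin K →
    Matrix (Fin (N * K)) (Fin (N * K)) ℂ) : Prop where
  measurable : ∀ ρ j, Measurable fun c => pre ρ c j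
  conjTranspose : ∀ ρ c j, (pre ρ c j)ᴴ = pre ρ c j
  mul_self : ∀ ρ c j, pre ρ c j * pre ρ c j = pre ρ c j

theorem isProjPrecoder_bd : IsProjPrecoder (N := N) (K := K) bd :=
  ⟨measurable_bd, bd_conjTranspose, bd_mul_self⟩

theorem isProjPrecoder_mrt : IsProjPrecoder (N := N) (K := K) mrt :=
  ⟨fun _ j => (measurable_pi_apply j).colProj, fun _ _ _ => colProj_conjTranspose _,
    fun _ _ _ => colProj_mul_self _⟩

theorem isProjPrecoder_mmse : IsProjPrecoder (N := N) (K := K) mmse := by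
  refine ⟨fun ρ j => Measurable.colProj ?_, fun _ _ _ => colProj_conjTranspose _,
    fun _ _ _ => colProj_mul_self _⟩
  have h : ∀ j, Measurable fun c : Fin K → Matrix (Fin (N * K)) (Fin N) ℂ =>
      ((Real.sqrt ((N * K : ℕ) : ℝ) : ℝ) : ℂ) • c j := fun j =>
    (measurable_pi_apply j).matrix_smul _
  exact (((Measurable.matrix_sum fun j => (h j).matrix_mul (h j).matrix_conjTranspose).matrix_add
    measurable_const).matrix_inv).matrix_mul (h j)

/-- `H_kᴴ P̄_j P̄_jᴴ H_k`, the received covariance at unit power per stream. -/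
noncomputable def gain (pre : ℝ → (Fin K → Matrix (Fin (N * K)) (Fin N) ℂ) → Fin K →
      Matrix (Fin (N * K)) (Fin (N * K)) ℂ)
    (ρ : ℝ) (k j : Fin K) (x : Idx K B → Matrix (Fin (N * K)) (Fin N) ℂ) :
    Matrix (Fin N) (Fin N) ℂ :=
  (x (Sum.inl k))ᴴ * pre ρ (quantizedOf x) j * x (Sum.inl k)

variable {pre : ℝ → (Fin K → Matrix (Fin (N * K)) (Fin N) ℂ) → Fin K →
      Matrix (Fin (N * K)) (Fin (N * K)) ℂ}

theorem rxCov_eq (ρ : ℝ) (k j : Fin K) (ω : Ω) :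
    rxCov pre H C ρ k j ω
      = ((ρ / ((N * K : ℕ) : ℝ) : ℝ) : ℂ) • gain pre ρ k j (allMat H C ω) := rfl

/-- Mean received power per antenna. -/
noncomputable def meanGain (P : Measure Ω)
    (pre : ℝ → (Fin K → Matrix (Fin (N * K)) (Fin N) ℂ) → Fin K →
      Matrix (Fin (N * K)) (Fin (N * K)) ℂ)
    (H : Fin K → Ω → Matrix (Fin (N * K)) (Fin N) ℂ)
    (C : Fin K → Fin (2 ^ B) → Ω → Matrix (Fin (N * K)) (Fin N) ℂ)
    (ρ : ℝ) (k j : Fin K) : ℝ :=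
  (∫ ω, (gain pre ρ k j (allMat H C ω)).trace.re ∂P) / N

namespace IsProjPrecoder

theorem norm_apply_le (hpre : IsProjPrecoder pre) (ρ : ℝ)
    (c : Fin K → Matrix (Fin (N * K)) (Fin N) ℂ) (j : Fin K) (a b : Fin (N * K)) :
    ‖pre ρ c j a b‖ ≤ 1 :=
  norm_apply_le_one_of_proj (hpre.conjTranspose ρ c j) (hpre.mul_self ρ c j) a b

theorem posSemidef (hpre : IsProjPrecoder pre) (ρ : ℝ)
    (c : Fin K → Matrix (Fin (N * K)) (Fin N) ℂ) (j : Fin K) : (pre ρ c j).PosSemidef :=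
  posSemidef_of_proj (hpre.conjTranspose ρ c j) (hpre.mul_self ρ c j)

theorem posSemidef_gain (hpre : IsProjPrecoder pre) (ρ : ℝ) (k j : Fin K)
    (x : Idx K B → Matrix (Fin (N * K)) (Fin N) ℂ) : (gain pre ρ k j x).PosSemidef :=
  (hpre.posSemidef ρ _ j).conjTranspose_mul_mul_same _

theorem measurable_gain (hpre : IsProjPrecoder pre) (ρ : ℝ) (k j : Fin K) :
    Measurable (gain (B := B) pre ρ k j) :=
  ((measurable_pi_apply (Sum.inl k)).matrix_conjTranspose.matrix_mul
    ((hpre.measurable ρ j).comp measurable_quantizedOf_family)).matrix_mul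
      (measurable_pi_apply (Sum.inl k))

theorem norm_gain_apply_le (hpre : IsProjPrecoder pre) (ρ : ℝ) (k j : Fin K)
    (x : Idx K B → Matrix (Fin (N * K)) (Fin N) ℂ) (a b : Fin N) :
    ‖gain pre ρ k j x a b‖ ≤ (N * K : ℕ) * frobSq (x (Sum.inl k)) := by
  have := norm_conj_apply_le (x (Sum.inl k)) (fun i l => hpre.norm_apply_le ρ (quantizedOf x) j i l)
    a b
  rwa [one_mul, Fintype.card_fin] at this

theorem norm_trace_gain_le (hpre : IsProjPrecoder pre) (ρ : ℝ) (k j : Fin K)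
    (x : Idx K B → Matrix (Fin (N * K)) (Fin N) ℂ) :
    ‖(gain pre ρ k j x).trace‖ ≤ N * ((N * K : ℕ) * frobSq (x (Sum.inl k))) := by
  refine (norm_sum_le_of_le _ fun a _ => hpre.norm_gain_apply_le ρ k j x a a).trans (le_of_eq ?_)
  simp

theorem integrable_gain_apply (hpre : IsProjPrecoder pre) (hsys : IsRVQSystem P H C) (ρ : ℝ)
    (k j : Fin K) (a b : Fin N) :
    Integrable (fun ω => gain pre ρ k j (allMat H C ω) a b) P :=
  ((hsys.integrable_frobSq_channel k).1.const_mul ((N * K : ℕ) : ℝ)).mono'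
    (((hpre.measurable_gain ρ k j).comp hsys.measurable_allMat).matrix_apply a
      b).aestronglyMeasurable
    (ae_of_all _ fun ω => hpre.norm_gain_apply_le ρ k j (allMat H C ω) a b)

theorem trace_gain_eq (hpre : IsProjPrecoder pre) (ρ : ℝ) (k j : Fin K)
    (x : Idx K B → Matrix (Fin (N * K)) (Fin N) ℂ) :
    (gain pre ρ k j x).trace = ((gain pre ρ k j x).trace.re : ℂ) := by
  have := (Complex.nonneg_iff.1 (hpre.posSemidef_gain ρ k j x).trace_nonneg).2
  exact Complex.ext (by simp) (by simp [← this])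

theorem meanGain_nonneg (hpre : IsProjPrecoder pre) (ρ : ℝ) (k j : Fin K) :
    0 ≤ meanGain P pre H C ρ k j :=
  div_nonneg (integral_nonneg fun ω =>
    (Complex.nonneg_iff.1 (hpre.posSemidef_gain ρ k j (allMat H C ω)).trace_nonneg).1)
    (Nat.cast_nonneg _)

end IsProjPrecoder

/-- Right multiplication of one channel by a matrix. -/
noncomputable def channelMulRight (k : Fin K) (V : Matrix (Fin N) (Fin N) ℂ) (s : Idx K B)
    (A : Matrix (Fin (N * K)) (Fin N) ℂ) : Matrix (Fin (N * K)) (Fin N) ℂ :=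
  if s = Sum.inl k then A * V else A

theorem measurable_channelMulRight (k : Fin K) (V : Matrix (Fin N) (Fin N) ℂ) (s : Idx K B) :
    Measurable (channelMulRight k V s) := by
  unfold channelMulRight
  split_ifs
  · exact measurable_id.matrix_mul measurable_const
  · exact measurable_id

/-- The quantizer sees a channel only through its column space. -/
theorem quantizedOf_channelMulRight (k : Fin K) {V : Matrix (Fin N) (Fin N) ℂ}
    (hV : IsUnit V.det) (x : Idx K B → Matrix (Fin (N * K)) (Fin N) ℂ) :
    quantizedOf (fun s => channelMulRight k V s (x s)) = quantizedOf x := by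
  funext j
  have h := quantizedOf_eq_mul (x := x) (y := fun s => channelMulRight k V s (x s)) (k := j)
    (U := 1) (fun i => ?_) fun i => by simp [channelMulRight]
  · rw [h, Matrix.one_mul]
  · simp only [channelMulRight, reduceCtorEq, if_false]
    split_ifs with hj
    · exact chordalSq_congr (colProj_mul_of_isUnit _ hV) _
    · rfl

theorem gain_channelMulRight (ρ : ℝ) (k j : Fin K) {V : Matrix (Fin N) (Fin N) ℂ}
    (hV : IsUnit V.det) (x : Idx K B → Matrix (Fin (N * K)) (Fin N) ℂ) :
    gain pre ρ k j (fun s => channelMulRight k V s (x s)) = Vᴴ * gain pre ρ k j x * V := by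
  rw [gain, quantizedOf_channelMulRight k hV]
  simp only [channelMulRight, if_true, conjTranspose_mul, gain, Matrix.mul_assoc]

namespace IsRVQSystem

theorem map_channelMulRight (hsys : IsRVQSystem P H C) (k : Fin K)
    {V : Matrix (Fin N) (Fin N) ℂ} (hV : V ∈ unitaryGroup (Fin N) ℂ) (s : Idx K B) :
    (P.map fun ω => allMat H C ω s).map (channelMulRight k V s)
      = P.map fun ω => allMat H C ω s := by
  unfold channelMulRight
  split_ifs with hs
  · subst hs
    change (P.map (H k)).map _ = P.map (H k)
    rw [hsys.map_channel, map_mul_unitary_gaussianMatrix hV]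
  · exact Measure.map_id

/-- Multiplying `H_k` on the right by a unitary preserves its law and all quantized channels, but
conjugates the gain matrix. The mean therefore commutes with all reflections, hence is scalar. -/
theorem matExp_gain (hsys : IsRVQSystem P H C) (hpre : IsProjPrecoder pre) (hN : 1 ≤ N) (ρ : ℝ)
    (k j : Fin K) :
    matExp P (fun ω => gain pre ρ k j (allMat H C ω))
      = ((meanGain P pre H C ρ k j : ℝ) : ℂ) • (1 : Matrix (Fin N) (Fin N) ℂ) := by
  have hint := hpre.integrable_gain_apply hsys ρ k j
  obtain ⟨a, ha⟩ := exists_matExp_mul_eq_smul (P := P)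
    (X := fun ω => gain pre ρ k j (allMat H C ω)) (Q := 1) (Matrix.mul_one 1) conjTranspose_one
    fun U hU _ _ => by
      have hU' : Uᴴ ∈ unitaryGroup (Fin N) ℂ := Unitary.star_mem hU
      have hdet : IsUnit (Uᴴ).det := by
        rw [← isUnit_iff_isUnit_det]
        exact ⟨⟨Uᴴ, Uᴴᴴ, mem_unitaryGroup_iff.1 hU', mem_unitaryGroup_iff'.1 hU'⟩, rfl⟩
      rw [← matExp_conj hint]
      ext b c
      simp only [matExp, of_apply]
      rw [← integral_coordinatewise hsys.measurable_allMat hsys.iIndepFun_allMat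
        (φ := channelMulRight k Uᴴ) (measurable_channelMulRight k Uᴴ)
        (hsys.map_channelMulRight k hU') (F := fun x => gain pre ρ k j x b c)
        ((hpre.measurable_gain ρ k j).matrix_apply b c)]
      simp only [gain_channelMulRight ρ k j hdet, conjTranspose_conjTranspose]
  rw [Matrix.mul_one] at ha
  have ht := trace_matExp hint
  rw [ha, trace_smul, trace_one, Fintype.card_fin, smul_eq_mul] at ht
  rw [integral_congr_ae (ae_of_all _ fun ω => hpre.trace_gain_eq ρ k j (allMat H C ω))] at ht
  rw [integral_complex_ofReal] at ht
  rw [ha]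
  congr 1
  have hN' : (N : ℂ) ≠ 0 := Nat.cast_ne_zero.2 (by omega)
  rw [meanGain, Complex.ofReal_div, Complex.ofReal_natCast, eq_div_iff hN', ht]

theorem expMat_rxCov (hsys : IsRVQSystem P H C) (hpre : IsProjPrecoder pre) (hN : 1 ≤ N) (ρ : ℝ)
    (k j : Fin K) :
    expMat P (fun ω => rxCov pre H C ρ k j ω)
      = ((ρ / (N * K : ℕ) * meanGain P pre H C ρ k j : ℝ) : ℂ) •
        (1 : Matrix (Fin N) (Fin N) ℂ) := by
  rw [Complex.ofReal_mul, mul_smul, ← hsys.matExp_gain hpre hN]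
  ext a b
  simp only [expMat, of_apply, rxCov_eq, Matrix.smul_apply, matExp, smul_eq_mul]
  rw [integral_const_mul]

theorem expMat_intCov (hsys : IsRVQSystem P H C) (hpre : IsProjPrecoder pre) (hN : 1 ≤ N) (ρ : ℝ)
    (k : Fin K) :
    expMat P (fun ω => intCov pre H C ρ k ω)
      = ((1 + ρ / (N * K : ℕ) * ∑ j ∈ Finset.univ.erase k, meanGain P pre H C ρ k j : ℝ) : ℂ) •
        (1 : Matrix (Fin N) (Fin N) ℂ) := by
  have hint : ∀ j a b, Integrable (fun ω => rxCov pre H C ρ k j ω a b) P := fun j a b =>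
    (hpre.integrable_gain_apply hsys ρ k j a b).const_mul _
  have h : expMat P (fun ω => intCov pre H C ρ k ω)
      = (∑ j ∈ Finset.univ.erase k, expMat P fun ω => rxCov pre H C ρ k j ω) + 1 := by
    ext a b
    simp only [expMat, of_apply, intCov, Matrix.add_apply, Matrix.sum_apply]
    rw [integral_add (integrable_finsetSum _ fun j _ => hint j a b) (integrable_const _),
      integral_finsetSum _ fun j _ => hint j a b]
    simp
  rw [h]
  simp only [hsys.expMat_rxCov hpre hN]
  rw [← Finset.sum_smul, ← Complex.ofReal_sum, ← Finset.mul_sum, Complex.ofReal_add, add_smul,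
    Complex.ofReal_one, one_smul, add_comm]

end IsRVQSystem

theorem logDet_smul_one (x y : ℝ) (hy : y ≠ 0) :
    logDet ((x : ℂ) • (1 : Matrix (Fin N) (Fin N) ℂ)) ((y : ℂ) • 1)
      = N * Real.logb 2 (1 + x / y) := by
  have hy' : (y : ℂ) ≠ 0 := Complex.ofReal_ne_zero.2 hy
  have h1 : ((y : ℂ) • (1 : Matrix (Fin N) (Fin N) ℂ))⁻¹ = (y : ℂ)⁻¹ • 1 := by
    refine inv_eq_right_inv ?_
    rw [Matrix.smul_mul, Matrix.mul_smul, smul_smul, mul_inv_cancel₀ hy']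
    simp
  have h2 : (1 + (x : ℂ) • (1 : Matrix (Fin N) (Fin N) ℂ) * ((y : ℂ) • 1)⁻¹)
      = ((1 + x / y : ℝ) : ℂ) • 1 := by
    rw [h1, Matrix.smul_mul, Matrix.mul_smul, smul_smul, Matrix.one_mul, Complex.ofReal_add,
      add_smul, Complex.ofReal_one, one_smul, Complex.ofReal_div, div_eq_mul_inv]
  rw [logDet, h2, det_smul, det_one, mul_one, Fintype.card_fin, ← Complex.ofReal_pow,
    Complex.ofReal_re, Real.logb_pow]

theorem IsRVQSystem.rateOfMeans_eq (hsys : IsRVQSystem P H C) (hpre : IsProjPrecoder pre)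
    (hN : 1 ≤ N) {ρ : ℝ} (hρ : 0 < ρ) (k : Fin K) :
    rateOfMeans P pre H C ρ k = N * Real.logb 2 (1 +
      ρ / (N * K : ℕ) * meanGain P pre H C ρ k k /
        (1 + ρ / (N * K : ℕ) * ∑ j ∈ Finset.univ.erase k, meanGain P pre H C ρ k j)) := by
  have h : 0 ≤ ∑ j ∈ Finset.univ.erase k, meanGain P pre H C ρ k j :=
    Finset.sum_nonneg fun j _ => hpre.meanGain_nonneg ρ k j
  rw [rateOfMeans, hsys.expMat_rxCov hpre hN, hsys.expMat_intCov hpre hN, logDet_smul_one]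
  positivity

theorem meanGain_eq (hpre : IsProjPrecoder pre) (ρ : ℝ) (k j : Fin K) {t : ℝ}
    (h : ∫ ω, (pre ρ (quantizedOf (allMat H C ω)) j * (H k ω * (H k ω)ᴴ)).trace ∂P = t) :
    meanGain P pre H C ρ k j = t / N := by
  have h1 : ∀ ω, (pre ρ (quantizedOf (allMat H C ω)) j * (H k ω * (H k ω)ᴴ)).trace
      = ((gain pre ρ k j (allMat H C ω)).trace.re : ℂ) := fun ω => by
    rw [← hpre.trace_gain_eq, gain, ← Matrix.mul_assoc, trace_mul_comm, ← Matrix.mul_assoc]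
    rfl
  simp only [h1] at h
  rw [integral_complex_ofReal] at h
  rw [meanGain, Complex.ofReal_injective h]

namespace IsRVQSystem

theorem meanGain_mrt_self (hsys : IsRVQSystem P H C) (hN : 1 ≤ N) (ρ : ℝ) (k : Fin K) :
    meanGain P mrt H C ρ k k = (1 - distortion P H C k) * (N * K : ℕ) := by
  have h := hsys.integral_trace_outer_mul_channelGram hN k
  rw [meanGain_eq (t := (1 - distortion P H C k) * ((N * K : ℕ) * N)) isProjPrecoder_mrt ρ k k]
  · have : (N : ℝ) ≠ 0 := by positivity
    field_simp
  · simp only [mrt, colProj_of_orthonormal (hsys.quantizedOf_semiunitary k _)]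
    rw [h]
    push_cast
    ring

theorem meanGain_mrt_of_ne (hsys : IsRVQSystem P H C) (hN : 1 ≤ N) (hNK : N * K ≠ 0) (ρ : ℝ)
    {k j : Fin K} (hj : j ≠ k) : meanGain P mrt H C ρ k j = N := by
  have h := hsys.integral_trace_outer_mul_channelGram_of_ne hNK hj
  rw [meanGain_eq (t := N * N) isProjPrecoder_mrt ρ k j]
  · have : (N : ℝ) ≠ 0 := by positivity
    field_simp
  · simp only [mrt, colProj_of_orthonormal (hsys.quantizedOf_semiunitary j _)]
    rw [h]
    push_cast
    ring

theorem meanGain_bd_self (hsys : IsRVQSystem P H C) (hN : 1 ≤ N) (hNK : N * K ≠ 0) (ρ : ℝ)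
    (k : Fin K) : meanGain P bd H C ρ k k = N := by
  have h := hsys.integral_trace_bd_mul_channelGram hNK k
  rw [meanGain_eq (t := N * N) isProjPrecoder_bd ρ k k]
  · have : (N : ℝ) ≠ 0 := by positivity
    field_simp
  · refine Eq.trans h ?_
    push_cast
    ring

theorem meanGain_bd_of_ne (hsys : IsRVQSystem P H C) (hN : 1 ≤ N) (hK : 2 ≤ K) (ρ : ℝ)
    {k j : Fin K} (hj : j ≠ k) :
    meanGain P bd H C ρ k j = distortion P H C k * (N * K : ℕ) / (K - 1) := by
  have h := hsys.integral_trace_bd_mul_channelGram_of_ne hN hK hj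
  rw [meanGain_eq (t := 1 / (K - 1) * (distortion P H C k * ((N * K : ℕ) * N)))
    isProjPrecoder_bd ρ k j]
  · have : (N : ℝ) ≠ 0 := by positivity
    field_simp
  · refine Eq.trans h ?_
    push_cast
    ring

theorem sum_meanGain_bd (hsys : IsRVQSystem P H C) (hN : 1 ≤ N) (hK : 2 ≤ K) (ρ : ℝ)
    (k : Fin K) :
    ∑ j ∈ Finset.univ.erase k, meanGain P bd H C ρ k j = distortion P H C k * (N * K : ℕ) := by
  rw [Finset.sum_congr rfl fun j hj => hsys.meanGain_bd_of_ne hN hK ρ (Finset.ne_of_mem_erase hj),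
    Finset.sum_const, Finset.card_erase_of_mem (Finset.mem_univ k), Finset.card_univ,
    Fintype.card_fin, nsmul_eq_mul, Nat.cast_sub (by omega), Nat.cast_one]
  have : (K : ℝ) - 1 ≠ 0 := by
    have : (2 : ℝ) ≤ K := by exact_mod_cast hK
    linarith
  field_simp

theorem sum_meanGain_mrt (hsys : IsRVQSystem P H C) (hN : 1 ≤ N) (hK : 2 ≤ K) (ρ : ℝ)
    (k : Fin K) :
    ∑ j ∈ Finset.univ.erase k, meanGain P mrt H C ρ k j = (K - 1) * N := by
  have hNK : N * K ≠ 0 := by positivity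
  rw [Finset.sum_congr rfl fun j hj =>
      hsys.meanGain_mrt_of_ne hN hNK ρ (Finset.ne_of_mem_erase hj),
    Finset.sum_const, Finset.card_erase_of_mem (Finset.mem_univ k), Finset.card_univ,
    Fintype.card_fin, nsmul_eq_mul, Nat.cast_sub (by omega), Nat.cast_one]

theorem rateOfMeans_mrt (hsys : IsRVQSystem P H C) (hN : 1 ≤ N) (hK : 2 ≤ K) {ρ : ℝ}
    (hρ : 0 < ρ) (k : Fin K) :
    rateOfMeans P mrt H C ρ k = rLow N K (distortion P H C k) ρ := by
  rw [hsys.rateOfMeans_eq isProjPrecoder_mrt hN hρ, hsys.meanGain_mrt_self hN,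
    hsys.sum_meanGain_mrt hN hK, rLow]
  have hN' : (0 : ℝ) < N := by exact_mod_cast hN
  have hK' : (2 : ℝ) ≤ K := by exact_mod_cast hK
  have h1 : (0 : ℝ) < ρ * K - ρ + K := by nlinarith
  have h2 : 1 + ρ / ((N * K : ℕ) : ℝ) * ((K - 1) * N) = (ρ * K - ρ + K) / K := by
    push_cast
    field_simp
    ring
  rw [h2]
  congr 3
  push_cast
  field_simp

theorem rateOfMeans_bd (hsys : IsRVQSystem P H C) (hN : 1 ≤ N) (hK : 2 ≤ K) {ρ : ℝ}
    (hρ : 0 < ρ) (k : Fin K) :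
    rateOfMeans P bd H C ρ k = rHigh N K (distortion P H C k) ρ := by
  have hNK : N * K ≠ 0 := by positivity
  rw [hsys.rateOfMeans_eq isProjPrecoder_bd hN hρ, hsys.meanGain_bd_self hN hNK,
    hsys.sum_meanGain_bd hN hK, rHigh]
  have hN' : (0 : ℝ) < N := by exact_mod_cast hN
  have hK' : (0 : ℝ) < K := by exact_mod_cast (by omega : 0 < K)
  have hγ := hsys.distortion_pos hN hK k
  have h2 : 1 + ρ / ((N * K : ℕ) : ℝ) * (distortion P H C k * (N * K : ℕ))
      = (K + ρ * K * distortion P H C k) / K := by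
    push_cast
    field_simp
  rw [h2]
  congr 3
  push_cast
  field_simp

end IsRVQSystem

end Means

end LimitedFeedback

namespace LimitedFeedback

open scoped ENNReal ComplexOrder

set_option linter.unusedSectionVars false

/-! ### Expansion of a regularized projector. -/

section Regularized

variable {m n : Type*} [Fintype m] [Fintype n] [DecidableEq m] [DecidableEq n]

theorem inv_smul_of_ne_zero {A : Matrix m m ℂ} {a : ℂ} (ha : a ≠ 0) (hA : IsUnit A.det) :
    (a • A)⁻¹ = a⁻¹ • A⁻¹ := by
  refine inv_eq_right_inv ?_
  rw [Matrix.smul_mul, Matrix.mul_smul, smul_smul, mul_inv_cancel₀ ha, mul_nonsing_inv _ hA,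
    one_smul]

theorem norm_mul_apply_le {l : Type*} {A : Matrix l m ℂ} {A' : Matrix m n ℂ} {a b : ℝ}
    (hA : ∀ i j, ‖A i j‖ ≤ a) (hA' : ∀ i j, ‖A' i j‖ ≤ b) (i : l) (j : n) :
    ‖(A * A') i j‖ ≤ Fintype.card m * (a * b) := by
  rw [mul_apply]
  refine (norm_sum_le_of_le (f := fun x => A i x * A' x j) Finset.univ (n := fun _ => a * b)
    fun x _ => ?_).trans (by simp)
  rw [norm_mul]
  exact mul_le_mul (hA _ _) (hA' _ _) (norm_nonneg _) ((norm_nonneg _).trans (hA i x))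

theorem posDef_one_add_smul {S : Matrix m m ℂ} (hS : S.PosSemidef) {ρ : ℝ} (hρ : 0 ≤ ρ) :
    (1 + (ρ : ℂ) • S).PosDef :=
  PosDef.one.add_posSemidef (hS.smul (by exact_mod_cast hρ : (0 : ℂ) ≤ ρ))

theorem isUnit_det_one_add_smul {S : Matrix m m ℂ} (hS : S.PosSemidef) {ρ : ℝ} (hρ : 0 ≤ ρ) :
    IsUnit (1 + (ρ : ℂ) • S).det :=
  (posDef_one_add_smul hS hρ).isUnit.map detMonoidHom

theorem norm_inv_one_add_smul_apply_le {S : Matrix m m ℂ} (hS : S.PosSemidef) {ρ : ℝ}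
    (hρ : 0 ≤ ρ) (i j : m) : ‖(1 + (ρ : ℂ) • S)⁻¹ i j‖ ≤ 1 := by
  have hu := isUnit_det_one_add_smul hS hρ
  have hh := (posDef_one_add_smul hS hρ).inv.1
  refine norm_apply_le_one_of_contraction hh ?_ i j
  have hps := (hS.smul (by exact_mod_cast hρ : (0 : ℂ) ≤ ρ)).conjTranspose_mul_mul_same
    (1 + (ρ : ℂ) • S)⁻¹
  rw [hh] at hps
  set R := 1 + (ρ : ℂ) • S with hR
  have hRS : (ρ : ℂ) • S = R - 1 := by rw [hR, add_sub_cancel_left]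
  rwa [hRS, Matrix.mul_sub, Matrix.sub_mul, Matrix.mul_one, nonsing_inv_mul _ hu,
    Matrix.one_mul] at hps

theorem isUnit_gram_inv_one_add_smul_mul {S : Matrix m m ℂ} (hS : S.PosSemidef) {ρ : ℝ}
    (hρ : 0 ≤ ρ) {c : Matrix m n ℂ} (hc : cᴴ * c = 1) :
    IsUnit (((1 + (ρ : ℂ) • S)⁻¹ * c)ᴴ * ((1 + (ρ : ℂ) • S)⁻¹ * c)).det :=
  isUnit_det_gram_of_leftInverse (L := cᴴ * (1 + (ρ : ℂ) • S)) (by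
    rw [Matrix.mul_assoc, ← Matrix.mul_assoc (1 + (ρ : ℂ) • S),
      mul_nonsing_inv _ (isUnit_det_one_add_smul hS hρ), Matrix.one_mul, hc])

/-- First order expansion, with exact remainder, of the projector onto the range of
`(1 + ρ S)⁻¹ c`. -/
theorem colProj_inv_one_add_smul_mul {S : Matrix m m ℂ} (hS : S.PosSemidef) {ρ : ℝ}
    (hρ : 0 ≤ ρ) {c : Matrix m n ℂ} (hc : cᴴ * c = 1) :
    colProj ((1 + (ρ : ℂ) • S)⁻¹ * c) - c * cᴴ
      = (ρ : ℂ) • -((1 - c * cᴴ) * (S * colProj ((1 + (ρ : ℂ) • S)⁻¹ * c))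
        + c * cᴴ * ((1 + (ρ : ℂ) • S)⁻¹ * (S * (1 - colProj ((1 + (ρ : ℂ) • S)⁻¹ * c))))) := by
  have hu := isUnit_det_one_add_smul hS hρ
  have hh := (posDef_one_add_smul hS hρ).inv.1
  have hg := isUnit_gram_inv_one_add_smul_mul hS hρ hc
  set R := 1 + (ρ : ℂ) • S with hR
  set Q := colProj (R⁻¹ * c) with hQ
  -- `R` maps the range of `Q`, the columns of `R⁻¹ c`, back into the columns of `c`. Next, `h2` is
  -- the adjoint of `(1 - Q) R⁻¹ c = 0`. Expanding `R`, respectively `R⁻¹`, extracts the factor `ρ`.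
  have h1 : (1 - c * cᴴ) * (R * Q) = 0 := by
    rw [hQ, colProj]
    simp only [← Matrix.mul_assoc]
    rw [Matrix.mul_assoc _ R R⁻¹, mul_nonsing_inv _ hu, Matrix.mul_one, one_sub_outer_mul hc]
    simp
  have h2 : c * cᴴ * (R⁻¹ * (1 - Q)) = 0 := by
    have h3 : (1 - Q) * (R⁻¹ * c) = 0 := by
      rw [Matrix.sub_mul, Matrix.one_mul, hQ, colProj_mul_cancel hg, sub_self]
    have h4 := congrArg conjTranspose h3
    have hh' : (R⁻¹)ᴴ = R⁻¹ := hh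
    rw [conjTranspose_mul, conjTranspose_mul, hh', conjTranspose_sub, conjTranspose_one,
      hQ, colProj_conjTranspose, ← hQ, conjTranspose_zero, Matrix.mul_assoc] at h4
    rw [Matrix.mul_assoc, h4, Matrix.mul_zero]
  have h5 : (1 - c * cᴴ) * Q = -((ρ : ℂ) • ((1 - c * cᴴ) * (S * Q))) := by
    rw [hR, Matrix.add_mul, Matrix.one_mul, Matrix.mul_add, Matrix.smul_mul,
      Matrix.mul_smul] at h1
    exact eq_neg_of_add_eq_zero_left h1
  have h6 : c * cᴴ * (1 - Q) = (ρ : ℂ) • (c * cᴴ * (R⁻¹ * (S * (1 - Q)))) := by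
    have h7 : (1 : Matrix m m ℂ) = R⁻¹ + (ρ : ℂ) • (R⁻¹ * S) := by
      conv_lhs => rw [← nonsing_inv_mul _ hu]
      conv_lhs => rw [hR, Matrix.mul_add, Matrix.mul_one, Matrix.mul_smul]
    calc c * cᴴ * (1 - Q) = c * cᴴ * (1 * (1 - Q)) := by rw [Matrix.one_mul]
      _ = c * cᴴ * ((R⁻¹ + (ρ : ℂ) • (R⁻¹ * S)) * (1 - Q)) := by rw [← h7]
      _ = _ := by
        rw [Matrix.add_mul, Matrix.mul_add, h2, zero_add, Matrix.smul_mul, Matrix.mul_smul,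
          Matrix.mul_assoc R⁻¹]
  -- A difference of projectors splits as `Q - P = (1 - P) Q - P (1 - Q)`, and each part is of order
  -- `ρ`.
  calc Q - c * cᴴ = (1 - c * cᴴ) * Q - c * cᴴ * (1 - Q) := by
        simp only [Matrix.sub_mul, Matrix.mul_sub, Matrix.one_mul, Matrix.mul_one]
        abel
    _ = _ := by
        rw [h5, h6, smul_neg, smul_add, neg_add, sub_eq_add_neg]

end Regularized

/-! ### The MMSE precoder near zero power. -/

section Mmse

variable {N K : ℕ}

/-- The scalars `√M` and `M / ρ` come out of the resolvent and do not affect the column space. -/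
theorem mmseBlock_eq {ρ : ℝ} (hρ : 0 < ρ) (hNK : N * K ≠ 0)
    (c : Fin K → Matrix (Fin (N * K)) (Fin N) ℂ) (k : Fin K) :
    ∃ a : ℂ, a ≠ 0 ∧ mmseBlock ρ c k = a • ((1 + (ρ : ℂ) • ∑ j, c j * (c j)ᴴ)⁻¹ * c k) := by
  have hM : (0 : ℝ) < (N * K : ℕ) := by exact_mod_cast Nat.pos_of_ne_zero hNK
  have hsq : ((Real.sqrt ((N * K : ℕ) : ℝ) : ℝ) : ℂ) * ((Real.sqrt ((N * K : ℕ) : ℝ) : ℝ) : ℂ)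
      = ((N * K : ℕ) : ℂ) := by
    rw [← Complex.ofReal_mul, Real.mul_self_sqrt hM.le]; simp
  have hs : ((Real.sqrt ((N * K : ℕ) : ℝ) : ℝ) : ℂ) ≠ 0 :=
    Complex.ofReal_ne_zero.2 (Real.sqrt_pos.2 hM).ne'
  have hq : (((((N * K : ℕ) : ℝ) / ρ : ℝ)) : ℂ) ≠ 0 :=
    Complex.ofReal_ne_zero.2 (by positivity)
  refine ⟨(((((N * K : ℕ) : ℝ) / ρ : ℝ)) : ℂ)⁻¹ * ((Real.sqrt ((N * K : ℕ) : ℝ) : ℝ) : ℂ),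
    mul_ne_zero (inv_ne_zero hq) hs, ?_⟩
  have h1 : (∑ j, (((Real.sqrt ((N * K : ℕ) : ℝ) : ℝ) : ℂ) • c j)
        * (((Real.sqrt ((N * K : ℕ) : ℝ) : ℝ) : ℂ) • c j)ᴴ) +
      ((((N * K : ℕ) : ℝ) / ρ : ℝ) : ℂ) • (1 : Matrix (Fin (N * K)) (Fin (N * K)) ℂ)
      = ((((N * K : ℕ) : ℝ) / ρ : ℝ) : ℂ) • (1 + (ρ : ℂ) • ∑ j, c j * (c j)ᴴ) := by
    simp only [conjTranspose_smul, Matrix.smul_mul, Matrix.mul_smul, smul_smul, RCLike.star_def,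
      Complex.conj_ofReal, hsq]
    rw [← Finset.smul_sum, smul_add, smul_smul, add_comm, ← Complex.ofReal_mul,
      div_mul_cancel₀ _ hρ.ne', Complex.ofReal_natCast]
  rw [mmseBlock]
  simp only
  rw [h1, inv_smul_of_ne_zero hq
    (isUnit_det_one_add_smul (posSemidef_sum_mul_conjTranspose c) hρ.le), Matrix.smul_mul,
    Matrix.mul_smul, smul_smul]

theorem mmse_eq_colProj {ρ : ℝ} (hρ : 0 < ρ) (hNK : N * K ≠ 0)
    (c : Fin K → Matrix (Fin (N * K)) (Fin N) ℂ) (k : Fin K) :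
    mmse ρ c k = colProj ((1 + (ρ : ℂ) • ∑ j, c j * (c j)ᴴ)⁻¹ * c k) := by
  obtain ⟨a, ha, h⟩ := mmseBlock_eq hρ hNK c k
  rw [mmse, h, colProj_smul _ ha]

/-- The normalization suited to `ρ → ∞`, where the regularization `ρ⁻¹` disappears. -/
theorem mmse_eq_colProj_inv {ρ : ℝ} (hρ : 0 < ρ) (hNK : N * K ≠ 0)
    (c : Fin K → Matrix (Fin (N * K)) (Fin N) ℂ) (k : Fin K) :
    mmse ρ c k = colProj (((∑ j, c j * (c j)ᴴ) + ((ρ⁻¹ : ℝ) : ℂ) • 1)⁻¹ * c k) := by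
  have hρ' : (ρ : ℂ) ≠ 0 := Complex.ofReal_ne_zero.2 hρ.ne'
  have h : (∑ j, c j * (c j)ᴴ) + ((ρ⁻¹ : ℝ) : ℂ) • (1 : Matrix (Fin (N * K)) (Fin (N * K)) ℂ)
      = ((ρ⁻¹ : ℝ) : ℂ) • (1 + (ρ : ℂ) • ∑ j, c j * (c j)ᴴ) := by
    rw [smul_add, smul_smul, ← Complex.ofReal_mul, inv_mul_cancel₀ hρ.ne', Complex.ofReal_one,
      one_smul, add_comm]
  rw [h, inv_smul_of_ne_zero (by simpa using hρ')
    (isUnit_det_one_add_smul (posSemidef_sum_mul_conjTranspose c) hρ.le), Matrix.smul_mul,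
    colProj_smul _ (by simpa using hρ'), mmse_eq_colProj hρ hNK]

theorem norm_gramSum_apply_le {c : Fin K → Matrix (Fin (N * K)) (Fin N) ℂ}
    (hc : ∀ j, (c j)ᴴ * c j = 1) (a b : Fin (N * K)) : ‖(∑ j, c j * (c j)ᴴ) a b‖ ≤ K := by
  rw [Matrix.sum_apply]
  exact (norm_sum_le_of_le Finset.univ fun j _ => norm_outer_apply_le (hc j) a b).trans (by simp)

/-- Difference quotient of the MMSE precoder at zero power. -/
noncomputable def mmseSlope (ρ : ℝ) (c : Fin K → Matrix (Fin (N * K)) (Fin N) ℂ) (k : Fin K) :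
    Matrix (Fin (N * K)) (Fin (N * K)) ℂ :=
  ((ρ⁻¹ : ℝ) : ℂ) • (mmse ρ c k - mrt 0 c k)

/-- The exact remainder cancels the division by `ρ`. What is left is bounded uniformly in `ρ` and
has a limit, as dominated convergence requires. -/
theorem mmseSlope_eq {ρ : ℝ} (hρ : 0 < ρ) (hNK : N * K ≠ 0)
    {c : Fin K → Matrix (Fin (N * K)) (Fin N) ℂ} {k : Fin K} (hc : (c k)ᴴ * c k = 1) :
    mmseSlope ρ c k = -((1 - c k * (c k)ᴴ) * ((∑ j, c j * (c j)ᴴ) * mmse ρ c k)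
      + c k * (c k)ᴴ * ((1 + (ρ : ℂ) • ∑ j, c j * (c j)ᴴ)⁻¹ *
        ((∑ j, c j * (c j)ᴴ) * (1 - mmse ρ c k)))) := by
  have hS := posSemidef_sum_mul_conjTranspose c
  rw [mmseSlope, mmse_eq_colProj hρ hNK, mrt, colProj_of_orthonormal hc,
    colProj_inv_one_add_smul_mul hS hρ.le hc, smul_smul, ← Complex.ofReal_mul,
    inv_mul_cancel₀ hρ.ne', Complex.ofReal_one, one_smul]

/-- Entries of the projectors and of the resolvent are at most `1`, those of the Gram sum at most
`K`, and each matrix product costs a factor `N K`. -/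
theorem norm_mmseSlope_apply_le {ρ : ℝ} (hρ : 0 < ρ) (hNK : N * K ≠ 0)
    {c : Fin K → Matrix (Fin (N * K)) (Fin N) ℂ} (hc : ∀ j, (c j)ᴴ * c j = 1) (k : Fin K)
    (a b : Fin (N * K)) :
    ‖mmseSlope ρ c k a b‖ ≤ ((N * K : ℕ) : ℝ) * (1 * ((N * K : ℕ) * (K * 1)))
      + (N * K : ℕ) * (1 * ((N * K : ℕ) * (1 * ((N * K : ℕ) * (K * 1))))) := by
  have hS := norm_gramSum_apply_le hc
  have h1 : ∀ a b, ‖(1 - c k * (c k)ᴴ : Matrix (Fin (N * K)) (Fin (N * K)) ℂ) a b‖ ≤ 1 := norm_apply_le_one_of_proj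
    (one_sub_outer_conjTranspose (c k)) (one_sub_outer_mul_self (hc k))
  have h2 : ∀ a b, ‖(1 - mmse ρ c k : Matrix (Fin (N * K)) (Fin (N * K)) ℂ) a b‖ ≤ 1 := norm_apply_le_one_of_proj
    (by rw [conjTranspose_sub, conjTranspose_one, isProjPrecoder_mmse.conjTranspose])
    (by
      rw [Matrix.sub_mul, Matrix.mul_sub, Matrix.mul_sub, isProjPrecoder_mmse.mul_self]
      simp)
  have h3 := norm_mul_apply_le h1 (norm_mul_apply_le hS (isProjPrecoder_mmse.norm_apply_le ρ c k))
  have h4 := norm_mul_apply_le (norm_outer_apply_le (hc k)) (norm_mul_apply_le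
    (norm_inv_one_add_smul_apply_le (posSemidef_sum_mul_conjTranspose c) hρ.le)
      (norm_mul_apply_le hS h2))
  simp only [Fintype.card_fin] at h3 h4
  rw [mmseSlope_eq hρ hNK (hc k), Matrix.neg_apply, norm_neg, Matrix.add_apply]
  exact (norm_add_le _ _).trans (add_le_add (h3 a b) (h4 a b))

theorem tendsto_inv_one_add_smul (S : Matrix (Fin (N * K)) (Fin (N * K)) ℂ) :
    Tendsto (fun ρ : ℝ => (1 + (ρ : ℂ) • S)⁻¹) (𝓝[>] 0) (𝓝 1) := by
  have hρ : Tendsto (fun ρ : ℝ => (ρ : ℂ)) (𝓝[>] 0) (𝓝 0) := by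
    have : Tendsto (fun ρ : ℝ => (ρ : ℂ)) (𝓝 0) (𝓝 ((0 : ℝ) : ℂ)) :=
      Complex.continuous_ofReal.tendsto 0
    simpa using this.mono_left nhdsWithin_le_nhds
  have h1 : Tendsto (fun ρ : ℝ => 1 + (ρ : ℂ) • S) (𝓝[>] 0) (𝓝 1) := by
    have h : Tendsto (fun ρ : ℝ => 1 + (ρ : ℂ) • S) (𝓝[>] 0) (𝓝 (1 + (0 : ℂ) • S)) :=
      tendsto_const_nhds.add (hρ.smul_const S)
    simpa using h
  have h2 := tendsto_inv_of_isUnit h1 (by simp)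
  simpa using h2

theorem tendsto_mmse_zero (hNK : N * K ≠ 0) {c : Fin K → Matrix (Fin (N * K)) (Fin N) ℂ}
    {k : Fin K} (hc : (c k)ᴴ * c k = 1) :
    Tendsto (fun ρ => mmse ρ c k) (𝓝[>] 0) (𝓝 (mrt 0 c k)) := by
  have h1 := tendsto_matrix_mul (tendsto_inv_one_add_smul (∑ j, c j * (c j)ᴴ))
    (tendsto_const_nhds (x := c k))
  rw [Matrix.one_mul] at h1
  have h2 := tendsto_colProj h1 (by rw [hc]; simp)
  refine h2.congr' ?_
  filter_upwards [self_mem_nhdsWithin] with ρ hρ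
  exact (mmse_eq_colProj hρ hNK c k).symm

theorem tendsto_mmseSlope (hNK : N * K ≠ 0) {c : Fin K → Matrix (Fin (N * K)) (Fin N) ℂ}
    {k : Fin K} (hc : (c k)ᴴ * c k = 1) :
    Tendsto (fun ρ => mmseSlope ρ c k) (𝓝[>] 0)
      (𝓝 (-((1 - c k * (c k)ᴴ) * ((∑ j, c j * (c j)ᴴ) * (c k * (c k)ᴴ))
        + c k * (c k)ᴴ * ((∑ j, c j * (c j)ᴴ) * (1 - c k * (c k)ᴴ))))) := by
  have h1 := tendsto_inv_one_add_smul (∑ j, c j * (c j)ᴴ)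
  have h2 := tendsto_mmse_zero hNK hc
  rw [mrt, colProj_of_orthonormal hc] at h2
  have hS := tendsto_const_nhds (x := ∑ j, c j * (c j)ᴴ) (f := 𝓝[>] (0 : ℝ))
  have h3 := tendsto_matrix_mul (tendsto_const_nhds (x := 1 - c k * (c k)ᴴ))
    (tendsto_matrix_mul hS h2)
  have h4 := tendsto_matrix_mul (tendsto_const_nhds (x := c k * (c k)ᴴ)) (tendsto_matrix_mul h1
    (tendsto_matrix_mul hS
      ((tendsto_const_nhds (x := (1 : Matrix (Fin (N * K)) (Fin (N * K)) ℂ))).sub h2)))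
  rw [Matrix.one_mul] at h4
  refine ((h3.add h4).neg).congr' ?_
  filter_upwards [self_mem_nhdsWithin] with ρ hρ
  exact (mmseSlope_eq hρ hNK hc).symm

end Mmse

end LimitedFeedback

namespace LimitedFeedback

open scoped ENNReal ComplexOrder

set_option linter.unusedSectionVars false

/-! ### Integrability of the rate and the low SNR regime. -/

section Rates

variable {N K B : ℕ} {Ω : Type*} [MeasurableSpace Ω] {P : Measure Ω} [IsProbabilityMeasure P]
  {H : Fin K → Ω → Matrix (Fin (N * K)) (Fin N) ℂ}
  {C : Fin K → Fin (2 ^ B) → Ω → Matrix (Fin (N * K)) (Fin N) ℂ}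
  {pre : ℝ → (Fin K → Matrix (Fin (N * K)) (Fin N) ℂ) → Fin K →
      Matrix (Fin (N * K)) (Fin (N * K)) ℂ}

namespace IsProjPrecoder

theorem posSemidef_rxCov (hpre : IsProjPrecoder pre) {ρ : ℝ} (hρ : 0 ≤ ρ) (k j : Fin K) (ω : Ω) :
    (rxCov pre H C ρ k j ω).PosSemidef :=
  (hpre.posSemidef_gain ρ k j (allMat H C ω)).smul
    (Complex.zero_le_real.2 (div_nonneg hρ (Nat.cast_nonneg _)))

theorem posDef_intCov (hpre : IsProjPrecoder pre) {ρ : ℝ} (hρ : 0 ≤ ρ) (k : Fin K) (ω : Ω) :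
    (intCov pre H C ρ k ω).PosDef :=
  PosDef.posSemidef_add (posSemidef_sum _ fun j _ => hpre.posSemidef_rxCov hρ k j ω) PosDef.one

theorem instRate_nonneg (hpre : IsProjPrecoder pre) {ρ : ℝ} (hρ : 0 ≤ ρ) (k : Fin K) (ω : Ω) :
    0 ≤ instRate pre H C ρ k ω :=
  Real.logb_nonneg one_lt_two
    (one_le_re_det_one_add_mul_inv (hpre.posSemidef_rxCov hρ k k ω) (hpre.posDef_intCov hρ k ω))

/-- The bound is linear in `ρ`, so it gives both integrability of the rate and a majorant for the
rate divided by `ρ`. -/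
theorem instRate_le (hpre : IsProjPrecoder pre) {ρ : ℝ} (hρ : 0 ≤ ρ) (k : Fin K) (ω : Ω) :
    instRate pre H C ρ k ω
      ≤ ρ * ((N * (((N * K : ℕ) : ℝ) * frobSq (H k ω))) / (N * K : ℕ) / Real.log 2) := by
  have hlog : 0 < Real.log 2 := Real.log_pos one_lt_two
  have h1 := log_re_det_one_add_mul_inv_le (hpre.posSemidef_rxCov (H := H) (C := C) hρ k k ω)
    (posSemidef_sum (Finset.univ.erase k) fun j _ =>
      hpre.posSemidef_rxCov (H := H) (C := C) hρ k j ω)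
  have h2 : (rxCov pre H C ρ k k ω).trace.re
      ≤ ρ * ((N * (((N * K : ℕ) : ℝ) * frobSq (H k ω))) / (N * K : ℕ)) := by
    rw [rxCov_eq, trace_smul, smul_eq_mul, Complex.re_ofReal_mul, ← mul_div_assoc,
      div_mul_eq_mul_div]
    gcongr
    exact (Complex.re_le_norm _).trans (hpre.norm_trace_gain_le ρ k k (allMat H C ω))
  rw [instRate, logDet, Real.logb, ← mul_div_assoc]
  gcongr
  exact h1.trans h2

theorem measurable_rxCov (hpre : IsProjPrecoder pre) (hsys : IsRVQSystem P H C) (ρ : ℝ)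
    (k j : Fin K) : Measurable (rxCov pre H C ρ k j) :=
  ((hpre.measurable_gain ρ k j).comp hsys.measurable_allMat).matrix_smul _

theorem measurable_instRate (hpre : IsProjPrecoder pre) (hsys : IsRVQSystem P H C) (ρ : ℝ)
    (k : Fin K) : Measurable (instRate pre H C ρ k) := by
  have h1 : Measurable (intCov pre H C ρ k) :=
    (Measurable.matrix_sum fun j => hpre.measurable_rxCov hsys ρ k j).matrix_add measurable_const
  have h2 := (measurable_const (a := (1 : Matrix (Fin N) (Fin N) ℂ))).matrix_add
    ((hpre.measurable_rxCov hsys ρ k k).matrix_mul h1.matrix_inv)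
  have h3 := Complex.measurable_re.comp h2.matrix_det
  exact (Real.measurable_log.comp h3).div_const _

theorem integrable_instRate (hpre : IsProjPrecoder pre) (hsys : IsRVQSystem P H C) {ρ : ℝ}
    (hρ : 0 ≤ ρ) (k : Fin K) : Integrable (instRate pre H C ρ k) P := by
  refine Integrable.mono' (g := fun ω => ρ * ((N * (((N * K : ℕ) : ℝ) * frobSq (H k ω)))
    / (N * K : ℕ) / Real.log 2)) ?_
    (hpre.measurable_instRate hsys ρ k).aestronglyMeasurable (ae_of_all _ fun ω => ?_)
  · exact (((((hsys.integrable_frobSq_channel k).1.const_mul _).const_mul _).div_const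
      _).div_const _).const_mul _
  · rw [Real.norm_of_nonneg (hpre.instRate_nonneg hρ k ω)]
    exact hpre.instRate_le hρ k ω

end IsProjPrecoder

/-! ### Low SNR -/

theorem tendsto_gain_mmse_zero (hsys : IsRVQSystem P H C) (hNK : N * K ≠ 0) (k j : Fin K)
    (ω : Ω) :
    Tendsto (fun ρ => gain mmse ρ k j (allMat H C ω)) (𝓝[>] 0)
      (𝓝 (gain mrt 0 k j (allMat H C ω))) :=
  tendsto_matrix_mul (tendsto_matrix_mul tendsto_const_nhds
    (tendsto_mmse_zero hNK (hsys.quantizedOf_semiunitary j ω))) tendsto_const_nhds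

theorem tendsto_ofReal_div_nhdsGT_zero (c : ℝ) :
    Tendsto (fun ρ : ℝ => ((ρ / c : ℝ) : ℂ)) (𝓝[>] 0) (𝓝 0) := by
  have h : Tendsto (fun ρ : ℝ => ((ρ / c : ℝ) : ℂ)) (𝓝 0) (𝓝 ((0 / c : ℝ) : ℂ)) :=
    (Complex.continuous_ofReal.comp (continuous_id.div_const c)).tendsto 0
  simpa using h.mono_left nhdsWithin_le_nhds

theorem tendsto_instRate_mmse_div (hsys : IsRVQSystem P H C) (hNK : N * K ≠ 0) (k : Fin K)
    (ω : Ω) :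
    Tendsto (fun ρ => instRate mmse H C ρ k ω / ρ) (𝓝[>] 0)
      (𝓝 ((gain mrt 0 k k (allMat H C ω)).trace.re / (N * K : ℕ) / Real.log 2)) := by
  have hX : ∀ ρ > 0, ((((N * K : ℕ) : ℝ)⁻¹ : ℝ) : ℂ) • gain mmse ρ k k (allMat H C ω)
      |>.PosSemidef := fun ρ _ =>
    (isProjPrecoder_mmse.posSemidef_gain ρ k k (allMat H C ω)).smul
      (Complex.zero_le_real.2 (inv_nonneg.2 (Nat.cast_nonneg _)))
  have hY : ∀ ρ > 0, (intCov mmse H C ρ k ω).PosDef := fun ρ hρ =>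
    isProjPrecoder_mmse.posDef_intCov (le_of_lt hρ) k ω
  have hX₀ := (tendsto_gain_mmse_zero hsys hNK k k ω).const_smul
    ((((N * K : ℕ) : ℝ)⁻¹ : ℝ) : ℂ)
  have hY₀ : Tendsto (fun ρ => intCov mmse H C ρ k ω) (𝓝[>] 0) (𝓝 1) := by
    have h : Tendsto (fun ρ => intCov mmse H C ρ k ω) (𝓝[>] 0)
        (𝓝 ((∑ j ∈ Finset.univ.erase k, (0 : ℂ) • gain mrt 0 k j (allMat H C ω)) + 1)) :=
      (tendsto_finsetSum _ fun j _ => (tendsto_ofReal_div_nhdsGT_zero _).smul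
        (tendsto_gain_mmse_zero hsys hNK k j ω)).add tendsto_const_nhds
    simpa using h
  have h := (tendsto_log_det_div hX hY hX₀ hY₀).div_const (Real.log 2)
  rw [trace_smul, smul_eq_mul, Complex.re_ofReal_mul, inv_mul_eq_div] at h
  refine h.congr fun ρ => ?_
  rw [instRate, logDet, Real.logb, rxCov_eq, smul_smul, ← Complex.ofReal_mul,
    ← div_eq_mul_inv ρ, div_right_comm]

theorem tendsto_rate_mmse_div (hsys : IsRVQSystem P H C) (hN : 1 ≤ N) (hK : 2 ≤ K)
    (k : Fin K) :
    Tendsto (fun ρ => rate P mmse H C ρ k / ρ) (𝓝[>] 0)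
      (𝓝 (N * (1 - distortion P H C k) / Real.log 2)) := by
  have hNK : N * K ≠ 0 := by positivity
  have hlim : ∫ ω, (gain mrt 0 k k (allMat H C ω)).trace.re / (N * K : ℕ) / Real.log 2 ∂P
      = N * (1 - distortion P H C k) / Real.log 2 := by
    have h := hsys.meanGain_mrt_self hN 0 k
    have hN' : (N : ℝ) ≠ 0 := by positivity
    have hM' : ((N * K : ℕ) : ℝ) ≠ 0 := Nat.cast_ne_zero.2 hNK
    rw [meanGain, div_eq_iff hN'] at h
    rw [integral_div, integral_div, h]
    field_simp
  rw [← hlim]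
  have h := tendsto_integral_filter_of_dominated_convergence (μ := P) (l := 𝓝[>] (0 : ℝ))
    (F := fun ρ ω => instRate mmse H C ρ k ω / ρ)
    (f := fun ω => (gain mrt 0 k k (allMat H C ω)).trace.re / (N * K : ℕ) / Real.log 2)
    (fun ω => (N * (((N * K : ℕ) : ℝ) * frobSq (H k ω))) / (N * K : ℕ) / Real.log 2)
    (Eventually.of_forall fun ρ =>
      ((isProjPrecoder_mmse.measurable_instRate hsys ρ k).div_const ρ).aestronglyMeasurable)
    ?_ ((((hsys.integrable_frobSq_channel k).1.const_mul _).const_mul _).div_const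
      _ |>.div_const _) (ae_of_all _ fun ω => tendsto_instRate_mmse_div hsys hNK k ω)
  · refine h.congr fun ρ => ?_
    rw [integral_div, rate]
  · filter_upwards [self_mem_nhdsWithin] with ρ hρ
    have hρ' : 0 < ρ := hρ
    refine ae_of_all _ fun ω => ?_
    rw [Real.norm_of_nonneg (div_nonneg (isProjPrecoder_mmse.instRate_nonneg hρ'.le k ω) hρ'.le),
      div_le_iff₀' hρ']
    exact isProjPrecoder_mmse.instRate_le hρ'.le k ω

theorem tendsto_rLow_div (hK : 2 ≤ K) (γ : ℝ) :
    Tendsto (fun ρ => rLow N K γ ρ / ρ) (𝓝[>] 0) (𝓝 (N * (1 - γ) / Real.log 2)) := by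
  have hK' : (K : ℝ) ≠ 0 := by positivity
  have hd : HasDerivAt (fun ρ : ℝ => rLow N K γ ρ) (N * (1 - γ) / Real.log 2) 0 := by
    have h1 : HasDerivAt (fun ρ : ℝ => ρ * K * (1 - γ)) (1 * K * (1 - γ)) 0 :=
      ((hasDerivAt_id (0 : ℝ)).mul_const _).mul_const _
    have h2 : HasDerivAt (fun ρ : ℝ => ρ * K - ρ + K) (1 * K - 1) 0 :=
      (((hasDerivAt_id (0 : ℝ)).mul_const _).sub (hasDerivAt_id 0)).add_const _
    have h3 := (((h1.div h2 (by simpa using hK')).const_add 1).log (by simp)).div_const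
      (Real.log 2) |>.const_mul (N : ℝ)
    refine h3.congr_deriv ?_
    simp only [Pi.div_apply, zero_mul, sub_self, zero_add, zero_div, add_zero, sub_zero, div_one]
    field_simp
  have h := hd.tendsto_slope_zero_right
  refine h.congr fun ρ => ?_
  have h0 : rLow N K γ 0 = 0 := by simp [rLow]
  rw [zero_add, h0, sub_zero, smul_eq_mul, div_eq_inv_mul]

theorem rate_mmse_isEquivalent_rLow (hsys : IsRVQSystem P H C) (hN : 1 ≤ N) (hK : 2 ≤ K)
    (k : Fin K) :
    (fun ρ => rate P mmse H C ρ k) ~[𝓝[>] (0 : ℝ)] rLow N K (distortion P H C k) := by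
  have hL : N * (1 - distortion P H C k) / Real.log 2 ≠ 0 := by
    have h1 := hsys.distortion_lt_one hN k
    have h2 : 0 < Real.log 2 := Real.log_pos one_lt_two
    have h3 : (0 : ℝ) < N := by exact_mod_cast hN
    have : 0 < 1 - distortion P H C k := by linarith
    positivity
  have h := (tendsto_rate_mmse_div hsys hN hK k).div
    (tendsto_rLow_div (N := N) hK (distortion P H C k)) hL
  rw [div_self hL] at h
  refine isEquivalent_of_tendsto_one (h.congr' ?_)
  filter_upwards [self_mem_nhdsWithin] with ρ hρ
  have hρ' : ρ ≠ 0 := (Set.mem_Ioi.1 hρ).ne'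
  simp only [Pi.div_apply]
  rw [div_div_div_cancel_right₀ hρ']

/-- Slope of the received covariance of the MMSE precoder at zero power. -/
noncomputable def gainSlope (ρ : ℝ) (k j : Fin K)
    (x : Idx K B → Matrix (Fin (N * K)) (Fin N) ℂ) : Matrix (Fin N) (Fin N) ℂ :=
  (x (Sum.inl k))ᴴ * mmseSlope ρ (quantizedOf x) j * x (Sum.inl k)

theorem gainSlope_eq (ρ : ℝ) (k j : Fin K) (x : Idx K B → Matrix (Fin (N * K)) (Fin N) ℂ) :
    gainSlope ρ k j x = ((ρ⁻¹ : ℝ) : ℂ) • (gain mmse ρ k j x - gain mrt 0 k j x) := by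
  simp only [gainSlope, mmseSlope, gain, Matrix.mul_smul, Matrix.smul_mul, Matrix.mul_sub,
    Matrix.sub_mul]

theorem integrable_trace_gain_re (hsys : IsRVQSystem P H C) (hpre : IsProjPrecoder pre) (ρ : ℝ)
    (k j : Fin K) : Integrable (fun ω => (gain pre ρ k j (allMat H C ω)).trace.re) P :=
  (integrable_finsetSum _ fun a _ => hpre.integrable_gain_apply hsys ρ k j a a).re

theorem meanGain_mmse_sub_div (hsys : IsRVQSystem P H C) (ρ : ℝ) (k j : Fin K) :
    (meanGain P mmse H C ρ k j - meanGain P mrt H C 0 k j) / ρ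
      = (∫ ω, (gainSlope ρ k j (allMat H C ω)).trace.re ∂P) / N := by
  have h : ∀ ω, (gainSlope ρ k j (allMat H C ω)).trace.re
      = ρ⁻¹ * ((gain mmse ρ k j (allMat H C ω)).trace.re
        - (gain mrt 0 k j (allMat H C ω)).trace.re) := fun ω => by
    rw [gainSlope_eq, trace_smul, trace_sub, smul_eq_mul, Complex.re_ofReal_mul, Complex.sub_re]
  simp only [h]
  rw [integral_const_mul, integral_sub (integrable_trace_gain_re hsys isProjPrecoder_mmse ρ k j)
    (integrable_trace_gain_re hsys isProjPrecoder_mrt 0 k j), meanGain, meanGain]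
  ring

theorem exists_norm_trace_gainSlope_le (hsys : IsRVQSystem P H C) (hNK : N * K ≠ 0) :
    ∃ c : ℝ, 0 ≤ c ∧ ∀ ρ > 0, ∀ k j ω,
      ‖(gainSlope ρ k j (allMat H C ω)).trace.re‖ ≤ c * frobSq (H k ω) := by
  refine ⟨N * ((((N * K : ℕ) : ℝ) * (1 * ((N * K : ℕ) * (K * 1)))
      + (N * K : ℕ) * (1 * ((N * K : ℕ) * (1 * ((N * K : ℕ) * (K * 1)))))) * (N * K : ℕ)),
    by positivity, fun ρ hρ k j ω => ?_⟩
  have h := norm_trace_conj_le (H k ω) (norm_mmseSlope_apply_le hρ hNK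
    (fun l => hsys.quantizedOf_semiunitary l ω) j)
  rw [Fintype.card_fin, Fintype.card_fin, ← mul_assoc (N : ℝ)] at h
  exact (Complex.abs_re_le_norm _).trans h

/-- Used for the interference gains, where `O(ρ)` is enough. -/
theorem exists_abs_meanGain_mmse_sub_le (hsys : IsRVQSystem P H C) (hNK : N * K ≠ 0) :
    ∃ c : ℝ, 0 ≤ c ∧ ∀ ρ > 0, ∀ k j,
      |meanGain P mmse H C ρ k j - meanGain P mrt H C 0 k j| ≤ c * ρ := by
  obtain ⟨c, hc, h⟩ := exists_norm_trace_gainSlope_le hsys hNK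
  refine ⟨c * ((N * K : ℕ) * N) / N, by positivity, fun ρ hρ k j => ?_⟩
  have h1 : |(meanGain P mmse H C ρ k j - meanGain P mrt H C 0 k j) / ρ|
      ≤ c * ((N * K : ℕ) * N) / N := by
    rw [meanGain_mmse_sub_div hsys, abs_div, abs_of_nonneg (Nat.cast_nonneg (α := ℝ) N)]
    gcongr
    rw [← Real.norm_eq_abs, ← (hsys.integrable_frobSq_channel k).2, ← integral_const_mul]
    exact norm_integral_le_of_norm_le ((hsys.integrable_frobSq_channel k).1.const_mul c)
      (ae_of_all _ fun ω => h ρ hρ k j ω)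
  rwa [abs_div, abs_of_pos hρ, div_le_iff₀ hρ] at h1

/-- For complementary projectors `q`, `p` the own contribution `q` in `f + q` drops out. Cycling the
trace moves `f`, the part due to the other users, in front of a factor `q g p + p g q` depending on
one user only. -/
theorem trace_mul_neg_cross {m : Type*} [Fintype m] {f g q p : Matrix m m ℂ} (h : q * p = 0)
    (h' : p * q = 0) :
    (g * -(p * ((f + q) * q) + q * ((f + q) * p))).trace
      = -(f * (q * (g * p) + p * (g * q))).trace := by
  have hc : ∀ a b : Matrix m m ℂ, (g * (a * (f * b))).trace = (f * (b * (g * a))).trace :=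
    fun a b => by rw [← Matrix.mul_assoc, trace_mul_comm, Matrix.mul_assoc]
  rw [Matrix.add_mul, Matrix.add_mul, h, add_zero, Matrix.mul_add p, ← Matrix.mul_assoc p q, h',
    Matrix.zero_mul, add_zero, Matrix.mul_neg, trace_neg, Matrix.mul_add, trace_add, hc, hc,
    Matrix.mul_add, trace_add]

/-- The first order change of the mean received signal power vanishes. -/
theorem integral_trace_slope_zero (hsys : IsRVQSystem P H C) (hNK : N * K ≠ 0) (k : Fin K) :
    ∫ ω, ((H k ω)ᴴ * (-((1 - quantizedOf (allMat H C ω) k * (quantizedOf (allMat H C ω) k)ᴴ) *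
        ((∑ j, quantizedOf (allMat H C ω) j * (quantizedOf (allMat H C ω) j)ᴴ) *
          (quantizedOf (allMat H C ω) k * (quantizedOf (allMat H C ω) k)ᴴ))
        + quantizedOf (allMat H C ω) k * (quantizedOf (allMat H C ω) k)ᴴ *
        ((∑ j, quantizedOf (allMat H C ω) j * (quantizedOf (allMat H C ω) j)ᴴ) *
          (1 - quantizedOf (allMat H C ω) k * (quantizedOf (allMat H C ω) k)ᴴ))))
        * H k ω).trace ∂P = 0 := by
  let F : (Idx K B → Matrix (Fin (N * K)) (Fin N) ℂ) → Matrix (Fin (N * K)) (Fin (N * K)) ℂ :=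
    fun x => ∑ j ∈ Finset.univ.erase k, quantizedOf x j * (quantizedOf x j)ᴴ
  let Q : (Idx K B → Matrix (Fin (N * K)) (Fin N) ℂ) → Matrix (Fin (N * K)) (Fin (N * K)) ℂ :=
    fun x => quantizedOf x k * (quantizedOf x k)ᴴ
  let G : (Idx K B → Matrix (Fin (N * K)) (Fin N) ℂ) → Matrix (Fin (N * K)) (Fin (N * K)) ℂ :=
    fun x => x (Sum.inl k) * (x (Sum.inl k))ᴴ
  -- The part depending on user `k` only. Being off-diagonal with respect to `Q`, it has trace zero,
  -- while `F` is independent of user `k` and has a scalar mean.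
  let b : (Idx K B → Matrix (Fin (N * K)) (Fin N) ℂ) → Matrix (Fin (N * K)) (Fin (N * K)) ℂ :=
    fun x => Q x * (G x * (1 - Q x)) + (1 - Q x) * (G x * Q x)
  have hFm : Measurable F := Measurable.matrix_sum fun j => measurable_outer_quantizedOf j
  have hQm : Measurable Q := measurable_outer_quantizedOf k
  have hGm : Measurable G := measurable_channelGram k
  have hQm' : Measurable fun x => 1 - Q x := measurable_const.matrix_sub hQm
  have hbm : Measurable b := (hQm.matrix_mul (hGm.matrix_mul hQm')).matrix_add
    (hQm'.matrix_mul (hGm.matrix_mul hQm))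
  have hQ : ∀ ω, Q (allMat H C ω) * (1 - Q (allMat H C ω)) = 0 := fun ω => by
    have hV := hsys.quantizedOf_semiunitary k ω
    simp only [Q]
    rw [Matrix.mul_sub, Matrix.mul_one, Matrix.mul_assoc, ← Matrix.mul_assoc _ _ (_)ᴴ, hV,
      Matrix.one_mul, sub_self]
  have hQ' : ∀ ω, (1 - Q (allMat H C ω)) * Q (allMat H C ω) = 0 := fun ω => by
    simp only [Q]
    rw [← Matrix.mul_assoc, one_sub_outer_mul (hsys.quantizedOf_semiunitary k ω), Matrix.zero_mul]
  have hval : ∀ ω, ((H k ω)ᴴ * (-((1 - Q (allMat H C ω)) *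
        ((∑ j, quantizedOf (allMat H C ω) j * (quantizedOf (allMat H C ω) j)ᴴ) *
          Q (allMat H C ω))
        + Q (allMat H C ω) *
        ((∑ j, quantizedOf (allMat H C ω) j * (quantizedOf (allMat H C ω) j)ᴴ) *
          (1 - Q (allMat H C ω))))) * H k ω).trace
      = -(F (allMat H C ω) * b (allMat H C ω)).trace := fun ω => by
    have hS : ∑ j, quantizedOf (allMat H C ω) j * (quantizedOf (allMat H C ω) j)ᴴ
        = F (allMat H C ω) + Q (allMat H C ω) :=
      (Finset.sum_erase_add _ _ (Finset.mem_univ k)).symm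
    have h1 : G (allMat H C ω) = H k ω * (H k ω)ᴴ := rfl
    rw [hS, trace_mul_comm, ← Matrix.mul_assoc, ← h1]
    exact trace_mul_neg_cross (hQ ω) (hQ' ω)
  have hb0 : ∀ ω, (b (allMat H C ω)).trace = 0 := fun ω => by
    simp only [b]
    rw [trace_add, trace_mul_comm, trace_mul_comm (1 - Q _), Matrix.mul_assoc, hQ',
      Matrix.mul_assoc (G _), hQ, Matrix.mul_zero, trace_zero, add_zero]
  have hQ1 : ∀ ω i j, ‖Q (allMat H C ω) i j‖ ≤ 1 := fun ω =>
    norm_outer_apply_le (hsys.quantizedOf_semiunitary k ω)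
  have hQ2 : ∀ ω i j, ‖(1 - Q (allMat H C ω)) i j‖ ≤ 1 := fun ω =>
    norm_apply_le_one_of_proj (one_sub_outer_conjTranspose _)
      (one_sub_outer_mul_self (hsys.quantizedOf_semiunitary k ω))
  have hG1 : ∀ ω i j, ‖G (allMat H C ω) i j‖ ≤ frobSq (H k ω) := fun ω =>
    norm_mul_conjTranspose_apply_le _
  have hbi : ∀ i j, Integrable (fun ω => b (allMat H C ω) i j) P := fun i j => by
    refine ((hsys.integrable_frobSq_channel k).1.const_mul
      (((N * K : ℕ) : ℝ) * (N * K : ℕ) + (N * K : ℕ) * (N * K : ℕ))).mono'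
      ((hbm.comp hsys.measurable_allMat).matrix_apply i j).aestronglyMeasurable
      (ae_of_all _ fun ω => ?_)
    have h1 := norm_mul_apply_le (hQ1 ω) (norm_mul_apply_le (hG1 ω) (hQ2 ω)) i j
    have h2 := norm_mul_apply_le (hQ2 ω) (norm_mul_apply_le (hG1 ω) (hQ1 ω)) i j
    rw [Fintype.card_fin] at h1 h2
    refine (norm_add_le _ _).trans ((add_le_add h1 h2).trans (le_of_eq ?_))
    ring
  have hFc : ∀ ω i j, ‖F (allMat H C ω) i j‖ ≤ (Finset.univ.erase k).card • (1 : ℝ) :=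
    fun ω i j => by
      simp only [F, Matrix.sum_apply]
      rw [← Finset.sum_const]
      exact norm_sum_le_of_le _ fun l _ =>
        norm_outer_apply_le (hsys.quantizedOf_semiunitary l ω) i j
  have hFk : ∀ x y, F (mix (userBlock k) x y) = F y := fun x y =>
    Finset.sum_congr rfl fun j hj => by rw [quantizedOf_mix_of_ne (Finset.ne_of_mem_erase hj)]
  have hFU : ∀ U ∈ unitaryGroup (Fin (N * K)) ℂ,
      ∀ x, F (fun s => U * x s) = U * F x * Uᴴ := fun U hU x => by
    simp only [F]
    rw [Matrix.mul_sum, Matrix.sum_mul]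
    refine Finset.sum_congr rfl fun j _ => ?_
    rw [quantizedOf_unitary_mul (mem_unitaryGroup_iff'.1 hU), conjTranspose_mul]
    simp only [Matrix.mul_assoc]
  have hτ : ∀ᵐ ω ∂P, (F (allMat H C ω)).trace = (Finset.univ.erase k).card • (N : ℂ) :=
    ae_of_all _ fun ω => by
      simp only [F]
      rw [trace_sum, ← Finset.sum_const]
      refine Finset.sum_congr rfl fun j _ => ?_
      rw [trace_outer_of_orthonormal (hsys.quantizedOf_semiunitary j ω), Fintype.card_fin]
  have hbT : ∀ ω' ω, b (mix (userBlock k) (allMat H C ω') (allMat H C ω))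
      = b (allMat H C ω') := fun ω' ω => by
    have h1 : Q (mix (userBlock k) (allMat H C ω') (allMat H C ω)) = Q (allMat H C ω') := by
      simp only [Q, quantizedOf_mix_self]
    have h2 : G (mix (userBlock k) (allMat H C ω') (allMat H C ω)) = G (allMat H C ω') := by
      simp [G, mix, userBlock]
    simp only [b, h1, h2]
  have h := integral_trace_mul_mix (userBlock k) hsys.measurable_allMat hsys.iIndepFun_allMat
    hFm hbm (fun ω' ω i j => by rw [hFk]; exact hFc ω i j) hbT hbi
  simp only [hFk, hsys.matExp_eq_smul_one hNK hFm hFc hFU hτ, Matrix.smul_mul, Matrix.one_mul,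
    trace_smul, hb0, smul_zero, integral_zero] at h
  rw [integral_congr_ae (ae_of_all _ hval), integral_neg, h, neg_zero]

theorem tendsto_meanGain_mmse_slope (hsys : IsRVQSystem P H C) (hNK : N * K ≠ 0) (k : Fin K) :
    Tendsto (fun ρ => (meanGain P mmse H C ρ k k - meanGain P mrt H C 0 k k) / ρ) (𝓝[>] 0)
      (𝓝 0) := by
  obtain ⟨c, hc, hle⟩ := exists_norm_trace_gainSlope_le hsys hNK
  have hm : ∀ ρ, Measurable fun ω => (gainSlope ρ k k (allMat H C ω)).trace := fun ρ => by
    have h : Measurable fun ω => ((ρ⁻¹ : ℝ) : ℂ) •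
        (gain mmse ρ k k (allMat H C ω) - gain mrt 0 k k (allMat H C ω)) :=
      (((isProjPrecoder_mmse.measurable_gain ρ k k).comp hsys.measurable_allMat).matrix_sub
        ((isProjPrecoder_mrt.measurable_gain 0 k k).comp hsys.measurable_allMat)).matrix_smul _
    simp only [gainSlope_eq]
    exact h.matrix_trace
  have hlim : ∀ ω, Tendsto (fun ρ => (gainSlope ρ k k (allMat H C ω)).trace) (𝓝[>] 0) (𝓝 _) :=
    fun ω => tendsto_trace (tendsto_matrix_mul (tendsto_matrix_mul tendsto_const_nhds
      (tendsto_mmseSlope hNK (hsys.quantizedOf_semiunitary k ω))) tendsto_const_nhds)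
  have hre : ∀ ρ ω, (gainSlope ρ k k (allMat H C ω)).trace
      = ((gainSlope ρ k k (allMat H C ω)).trace.re : ℂ) := fun ρ ω => by
    rw [gainSlope_eq, trace_smul, trace_sub, isProjPrecoder_mmse.trace_gain_eq,
      isProjPrecoder_mrt.trace_gain_eq, smul_eq_mul, ← Complex.ofReal_sub, ← Complex.ofReal_mul,
      Complex.ofReal_re]
  have hbound : ∀ᶠ ρ in 𝓝[>] (0 : ℝ), ∀ᵐ ω ∂P,
      ‖(gainSlope ρ k k (allMat H C ω)).trace‖ ≤ c * frobSq (H k ω) := by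
    filter_upwards [self_mem_nhdsWithin] with ρ hρ
    refine ae_of_all _ fun ω => ?_
    rw [hre, Complex.norm_real]
    exact hle ρ hρ k k ω
  have h := tendsto_integral_filter_of_dominated_convergence (μ := P) (l := 𝓝[>] (0 : ℝ))
    (F := fun ρ ω => (gainSlope ρ k k (allMat H C ω)).trace)
    (fun ω => c * frobSq (H k ω))
    (Eventually.of_forall fun ρ => (hm ρ).aestronglyMeasurable)
    hbound ((hsys.integrable_frobSq_channel k).1.const_mul c) (ae_of_all _ hlim)
  have hz := integral_trace_slope_zero hsys hNK k
  have h' := ((Complex.continuous_re.tendsto _).comp (h.trans_eq (congrArg 𝓝 hz))).div_const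
    (N : ℝ)
  rw [Complex.zero_re, zero_div] at h'
  refine h'.congr fun ρ => ?_
  rw [meanGain_mmse_sub_div hsys, Function.comp_apply,
    integral_congr_ae (ae_of_all _ fun ω => hre ρ ω), integral_complex_ofReal, Complex.ofReal_re]

theorem abs_logb_one_add_sub_le {u v : ℝ} (hu : 0 ≤ u) (hv : 0 ≤ v) :
    |Real.logb 2 (1 + u) - Real.logb 2 (1 + v)| ≤ |u - v| / Real.log 2 := by
  have hlog : 0 < Real.log 2 := Real.log_pos one_lt_two
  have key : ∀ u v : ℝ, 0 ≤ u → 0 ≤ v → Real.log (1 + u) - Real.log (1 + v) ≤ |u - v| := by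
    intro u v hu hv
    rw [← Real.log_div (by positivity) (by positivity)]
    refine (Real.log_le_sub_one_of_pos (by positivity)).trans ?_
    have : (1 + u) / (1 + v) - 1 = (u - v) / (1 + v) := by field_simp; ring
    rw [this]
    calc (u - v) / (1 + v) ≤ |u - v| / (1 + v) := by gcongr; exact le_abs_self _
      _ ≤ |u - v| := div_le_self (abs_nonneg _) (by linarith)
  rw [Real.logb, Real.logb, ← sub_div, abs_div, abs_of_pos hlog]
  refine div_le_div_of_nonneg_right ?_ hlog.le
  refine abs_sub_le_iff.2 ⟨key u v hu hv, ?_⟩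
  rw [abs_sub_comm]
  exact key v u hv hu

/-- Perturbation of a ratio of the form of the signal to interference and noise ratio. -/
theorem abs_div_one_add_sub_le {x x' y y' : ℝ} (hx' : 0 ≤ x') (hy : 0 ≤ y) (hy' : 0 ≤ y') :
    |x / (1 + y) - x' / (1 + y')| ≤ |x - x'| + x' * |y - y'| := by
  have h1 : x / (1 + y) - x' / (1 + y')
      = (x - x') / (1 + y) + x' * (y' - y) / ((1 + y) * (1 + y')) := by
    field_simp
    ring
  rw [h1]
  refine (abs_add_le _ _).trans (add_le_add ?_ ?_)
  · rw [abs_div, abs_of_pos (by positivity : 0 < 1 + y)]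
    exact div_le_self (abs_nonneg _) (by linarith)
  · rw [abs_div, abs_of_pos (by positivity : 0 < (1 + y) * (1 + y')), abs_mul, abs_of_nonneg hx',
      abs_sub_comm y y']
    exact div_le_self (by positivity) (by nlinarith)

theorem abs_logb_sinr_sub_le {ρ M t t' s s' d : ℝ} (hρ : 0 < ρ) (hM : 0 < M) (ht : 0 ≤ t)
    (ht' : 0 ≤ t') (hs : 0 ≤ s) (hs' : 0 ≤ s') (hd : |s - s'| ≤ d) :
    |Real.logb 2 (1 + ρ / M * t' / (1 + ρ / M * s)) - Real.logb 2 (1 + ρ / M * t / (1 + ρ / M * s'))|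
      ≤ (ρ / M * |t' - t| + ρ / M * t * (ρ / M * d)) / Real.log 2 := by
  have hlog : 0 < Real.log 2 := Real.log_pos one_lt_two
  have hq : 0 < ρ / M := div_pos hρ hM
  generalize ρ / M = q at *
  refine (abs_logb_one_add_sub_le (by positivity) (by positivity)).trans
    (div_le_div_of_nonneg_right ?_ hlog.le)
  refine (abs_div_one_add_sub_le (by positivity) (by positivity) (by positivity)).trans ?_
  rw [← mul_sub, ← mul_sub, abs_mul, abs_mul, abs_of_pos hq]
  gcongr

theorem rateOfMeans_mmse_sub_rLow_isLittleO (hsys : IsRVQSystem P H C) (hN : 1 ≤ N) (hK : 2 ≤ K)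
    (k : Fin K) :
    (fun ρ => rateOfMeans P mmse H C ρ k - rLow N K (distortion P H C k) ρ)
      =o[𝓝[>] (0 : ℝ)] (fun ρ : ℝ => ρ ^ 2) := by
  have hNK : N * K ≠ 0 := by positivity
  have hM : (0 : ℝ) < (N * K : ℕ) := by exact_mod_cast Nat.pos_of_ne_zero hNK
  obtain ⟨c, hc, hle⟩ := exists_abs_meanGain_mmse_sub_le hsys hNK
  set M : ℝ := ((N * K : ℕ) : ℝ)
  let e : ℝ → ℝ := fun ρ => (meanGain P mmse H C ρ k k - meanGain P mrt H C 0 k k) / ρ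
  have hmrt : ∀ ρ j, meanGain P mrt H C ρ k j = meanGain P mrt H C 0 k j := fun ρ j => rfl
  set t := meanGain P mrt H C 0 k k
  have ht : 0 ≤ t := isProjPrecoder_mrt.meanGain_nonneg 0 k k
  -- The signal error `|e ρ| ρ` enters with a factor `ρ / M`; the interference error, at most `K c
  -- ρ`, enters with `(ρ / M)² t`. Both are `ρ²` times a quantity tending to zero.
  have hbound : ∀ᶠ ρ in 𝓝[>] (0 : ℝ),
      ‖rateOfMeans P mmse H C ρ k - rLow N K (distortion P H C k) ρ‖
        ≤ N / Real.log 2 * (|e ρ| / M + t / M * (K * c / M) * ρ) * ‖ρ ^ 2‖ := by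
    filter_upwards [self_mem_nhdsWithin] with ρ hρ
    have hρ' : 0 < ρ := hρ
    rw [← hsys.rateOfMeans_mrt hN hK hρ', hsys.rateOfMeans_eq isProjPrecoder_mmse hN hρ',
      hsys.rateOfMeans_eq isProjPrecoder_mrt hN hρ', ← mul_sub, norm_mul, Real.norm_natCast,
      Real.norm_eq_abs]
    simp only [hmrt ρ]
    have hs : 0 ≤ ∑ j ∈ Finset.univ.erase k, meanGain P mmse H C ρ k j :=
      Finset.sum_nonneg fun j _ => isProjPrecoder_mmse.meanGain_nonneg ρ k j
    have hs' : 0 ≤ ∑ j ∈ Finset.univ.erase k, meanGain P mrt H C 0 k j :=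
      Finset.sum_nonneg fun j _ => isProjPrecoder_mrt.meanGain_nonneg 0 k j
    have htk : 0 ≤ meanGain P mmse H C ρ k k := isProjPrecoder_mmse.meanGain_nonneg ρ k k
    have hd : |∑ j ∈ Finset.univ.erase k, meanGain P mmse H C ρ k j
        - ∑ j ∈ Finset.univ.erase k, meanGain P mrt H C 0 k j| ≤ K * (c * ρ) := by
      rw [← Finset.sum_sub_distrib]
      refine (Finset.abs_sum_le_sum_abs _ _).trans
        ((Finset.sum_le_sum fun j _ => hle ρ hρ' k j).trans ?_)
      rw [Finset.sum_const, nsmul_eq_mul]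
      gcongr
      calc (Finset.univ.erase k).card ≤ (Finset.univ : Finset (Fin K)).card :=
            Finset.card_le_card (Finset.erase_subset _ _)
        _ = K := by simp
    have h1 := abs_logb_sinr_sub_le hρ' hM ht htk hs hs' hd
    have h3 : |meanGain P mmse H C ρ k k - t| = |e ρ| * ρ := by
      have h4 : meanGain P mmse H C ρ k k - t = e ρ * ρ := (div_mul_cancel₀ _ hρ'.ne').symm
      rw [h4, abs_mul, abs_of_pos hρ']
    rw [h3] at h1
    rw [Real.norm_of_nonneg (sq_nonneg ρ)]
    refine (mul_le_mul_of_nonneg_left h1 (Nat.cast_nonneg _)).trans (le_of_eq ?_)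
    ring
  have he : Tendsto e (𝓝[>] 0) (𝓝 0) := tendsto_meanGain_mmse_slope hsys hNK k
  have hid : Tendsto (fun ρ : ℝ => ρ) (𝓝[>] 0) (𝓝 0) := tendsto_id.mono_left nhdsWithin_le_nhds
  have hlim : Tendsto (fun ρ => N / Real.log 2 * (|e ρ| / M + t / M * (K * c / M) * ρ)) (𝓝[>] 0)
      (𝓝 0) := by
    have h := (((he.abs).div_const M).add (hid.const_mul (t / M * (K * c / M)))).const_mul
      (N / Real.log 2)
    simpa using h
  refine isLittleO_iff.2 fun ε hε => ?_
  filter_upwards [hbound, hlim.eventually_lt_const hε] with ρ h1 h2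
  exact h1.trans (mul_le_mul_of_nonneg_right h2.le (norm_nonneg _))

end Rates

end LimitedFeedback

namespace LimitedFeedback

open scoped ENNReal NNReal ComplexOrder

set_option linter.unusedSectionVars false

/-! ### Uniform integrability from second moments. -/

section UniformIntegrability

variable {Ω : Type*} [MeasurableSpace Ω] {P : Measure Ω} [IsProbabilityMeasure P]

theorem uniformIntegrable_of_lintegral_sq_le {f : ℕ → Ω → ℝ} (hf : ∀ n, Measurable (f n))
    {A : ℝ≥0∞} (hA : A ≠ ∞) (h : ∀ n, ∫⁻ ω, ‖f n ω‖ₑ ^ 2 ∂P ≤ A) : UniformIntegrable f 1 P := by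
  refine uniformIntegrable_of le_rfl ENNReal.one_ne_top (fun n => (hf n).aestronglyMeasurable)
    fun ε hε => ?_
  have hε' : 0 < ε.toNNReal := Real.toNNReal_pos.2 hε
  lift A to ℝ≥0 using hA
  -- On the set where `|f| ≥ R` one has `|f| ≤ f² / R`, and this level makes `A / R ≤ ε`; the added
  -- `1` keeps it positive.
  refine ⟨(A + 1) / ε.toNNReal, fun n => ?_⟩
  set R : ℝ≥0 := (A + 1) / ε.toNNReal
  have hR : 0 < R := div_pos (by positivity) hε'
  have hR' : (R : ℝ≥0∞) ≠ 0 := by exact_mod_cast hR.ne'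
  rw [eLpNorm_one_eq_lintegral_enorm]
  have h1 : ∀ ω, ‖({x | R ≤ ‖f n x‖₊}.indicator (f n)) ω‖ₑ ≤ ‖f n ω‖ₑ ^ 2 / R := fun ω => by
    by_cases hω : ω ∈ {x | R ≤ ‖f n x‖₊}
    · rw [Set.indicator_of_mem hω, ENNReal.le_div_iff_mul_le (Or.inl hR')
        (Or.inl ENNReal.coe_ne_top), sq]
      refine mul_le_mul_right ?_ _
      exact ENNReal.coe_le_coe.2 hω
    · rw [Set.indicator_of_notMem hω]
      simp
  refine (lintegral_mono h1).trans ?_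
  simp only [div_eq_mul_inv]
  rw [lintegral_mul_const _ ((hf n).enorm.pow_const 2), ← div_eq_mul_inv]
  refine (ENNReal.div_le_div_right (h n) _).trans ?_
  rw [ENNReal.div_le_iff hR' ENNReal.coe_ne_top]
  rw [ENNReal.ofReal, ← ENNReal.coe_mul, ENNReal.coe_le_coe, mul_div_cancel₀ _ hε'.ne']
  exact le_self_add

/-- Convergence of means from almost sure convergence and a uniform second moment bound. -/
theorem tendsto_integral_of_lintegral_sq_le {f : ℕ → Ω → ℝ} {g : Ω → ℝ}
    (hf : ∀ n, Measurable (f n)) {A : ℝ≥0∞} (hA : A ≠ ∞)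
    (h : ∀ n, ∫⁻ ω, ‖f n ω‖ₑ ^ 2 ∂P ≤ A)
    (hlim : ∀ᵐ ω ∂P, Tendsto (fun n => f n ω) atTop (𝓝 (g ω))) :
    Tendsto (fun n => ∫ ω, f n ω ∂P) atTop (𝓝 (∫ ω, g ω ∂P)) := by
  have hui := uniformIntegrable_of_lintegral_sq_le hf hA h
  have hg := hui.memLp_of_ae_tendsto hlim
  have hL := tendsto_Lp_finite_of_tendsto_ae le_rfl ENNReal.one_ne_top
    (fun n => (hf n).aestronglyMeasurable) hg hui.unifIntegrable hlim
  refine tendsto_integral_of_L1' g hg.aestronglyMeasurable (Eventually.of_forall fun n =>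
    (hui.memLp n).integrable le_rfl) hL

end UniformIntegrability

/-- From `log Z ≤ n log a - log δ` with `log a ≤ 2 √a` and `-log δ = 4 log δ^(-1/4) ≤ 4 δ^(-1/4)`.
These roots are chosen so that the square involves only `a` and `δ^(-1/2)`, whose means are under
control. -/
theorem sq_log_le {Z δ a : ℝ} {n : ℕ} (hZ : 1 ≤ Z) (hδ : 0 < δ) (ha : 1 ≤ a)
    (h : Z * δ ≤ a ^ n) : Real.log Z ^ 2 ≤ 8 * n ^ 2 * a + 32 * (√δ)⁻¹ := by
  have ha0 : 0 < a := by linarith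
  have hs : 0 < √δ := Real.sqrt_pos.2 hδ
  have hw : 0 < (√(√δ))⁻¹ := inv_pos.2 (Real.sqrt_pos.2 hs)
  have h1 : Real.log Z + Real.log δ ≤ n * Real.log a := by
    rw [← Real.log_mul (by linarith) hδ.ne', ← Real.log_pow]
    exact Real.log_le_log (by positivity) h
  have h2 : Real.log a ≤ 2 * √a := by
    have := Real.log_le_self (Real.sqrt_nonneg a)
    rw [Real.log_sqrt ha0.le] at this
    linarith
  have h3 : -Real.log δ ≤ 4 * (√(√δ))⁻¹ := by
    have := Real.log_le_self hw.le
    rw [Real.log_inv, Real.log_sqrt hs.le, Real.log_sqrt hδ.le] at this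
    linarith
  have h4 : Real.log Z ≤ n * (2 * √a) + 4 * (√(√δ))⁻¹ := by
    have : n * Real.log a ≤ n * (2 * √a) := by gcongr
    linarith
  have h5 : (√(√δ))⁻¹ ^ 2 = (√δ)⁻¹ := by rw [inv_pow, Real.sq_sqrt hs.le]
  have h6 : √a ^ 2 = a := Real.sq_sqrt ha0.le
  calc Real.log Z ^ 2 ≤ (n * (2 * √a) + 4 * (√(√δ))⁻¹) ^ 2 :=
        pow_le_pow_left₀ (Real.log_nonneg hZ) h4 2
    _ ≤ 2 * ((n * (2 * √a)) ^ 2 + (4 * (√(√δ))⁻¹) ^ 2) := by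
        nlinarith [sq_nonneg (n * (2 * √a) - 4 * (√(√δ))⁻¹)]
    _ = 8 * n ^ 2 * √a ^ 2 + 32 * (√(√δ))⁻¹ ^ 2 := by ring
    _ = _ := by rw [h5, h6]

/-! ### Second moment of the rate at high SNR. -/

section HighSNR

variable {N K B : ℕ} {Ω : Type*} [MeasurableSpace Ω] {P : Measure Ω} [IsProbabilityMeasure P]
  {H : Fin K → Ω → Matrix (Fin (N * K)) (Fin N) ℂ}
  {C : Fin K → Fin (2 ^ B) → Ω → Matrix (Fin (N * K)) (Fin N) ℂ}
  {pre : ℝ → (Fin K → Matrix (Fin (N * K)) (Fin N) ℂ) → Fin K →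
      Matrix (Fin (N * K)) (Fin (N * K)) ℂ}

/-- A projector precoder with `N` streams per user. -/
structure IsFullRankPrecoder (pre : ℝ → (Fin K → Matrix (Fin (N * K)) (Fin N) ℂ) → Fin K →
    Matrix (Fin (N * K)) (Fin (N * K)) ℂ) : Prop extends IsProjPrecoder pre where
  exists_outer : ∀ ρ > 0, ∀ c : Fin K → Matrix (Fin (N * K)) (Fin N) ℂ,
    (∀ j, (c j)ᴴ * c j = 1) → IsUnit (∑ j, c j * (c j)ᴴ).det → ∀ j,
      ∃ V : Matrix (Fin (N * K)) (Fin N) ℂ, Vᴴ * V = 1 ∧ pre ρ c j = V * Vᴴ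

theorem isFullRankPrecoder_bd : IsFullRankPrecoder (N := N) (K := K) bd :=
  { isProjPrecoder_bd with
    exists_outer := fun ρ _ c _ hS j => by
      obtain ⟨V, hV, h⟩ := exists_colProj_eq (isUnit_gram_zeroForcing hS j)
      exact ⟨V, hV, (bd_eq_colProj ρ hS j).trans h⟩ }

theorem isFullRankPrecoder_mmse (hNK : N * K ≠ 0) :
    IsFullRankPrecoder (N := N) (K := K) mmse :=
  { isProjPrecoder_mmse with
    exists_outer := fun ρ hρ c hc _ j => by
      obtain ⟨V, hV, h⟩ := exists_colProj_eq (isUnit_gram_inv_one_add_smul_mul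
        (posSemidef_sum_mul_conjTranspose c) (le_of_lt hρ) (hc j))
      exact ⟨V, hV, (mmse_eq_colProj hρ hNK c j).trans h⟩ }

/-- The quantized channels, with the codeword of user `k` replaced by the one of index `i`. -/
noncomputable def quantizedWith (k : Fin K) (i : Fin (2 ^ B))
    (x : Idx K B → Matrix (Fin (N * K)) (Fin N) ℂ) : Fin K → Matrix (Fin (N * K)) (Fin N) ℂ :=
  Function.update (quantizedOf x) k (x (Sum.inr (k, i)))

theorem exists_quantizedWith_eq (k : Fin K) (x : Idx K B → Matrix (Fin (N * K)) (Fin N) ℂ) :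
    ∃ i, quantizedWith k i x = quantizedOf x :=
  ⟨_, Function.update_eq_self k (quantizedOf x)⟩

/-- Once the index of user `k` is prescribed, the family no longer depends on `H_k`. The channel
then stays Gaussian and independent of the precoders, which the true selection would destroy. -/
theorem quantizedWith_mix (k : Fin K) (i : Fin (2 ^ B))
    (x y : Idx K B → Matrix (Fin (N * K)) (Fin N) ℂ) :
    quantizedWith k i (mix (fun s => s ≠ Sum.inl k) x y) = quantizedWith k i x := by
  funext l
  by_cases hl : l = k
  · subst hl
    simp [quantizedWith, mix]
  · rw [quantizedWith, quantizedWith, Function.update_of_ne hl, Function.update_of_ne hl]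
    exact quantizedOf_congr (by simp [mix, hl]) fun i => by simp [mix]

theorem measurable_quantizedWith (k : Fin K) (i : Fin (2 ^ B)) :
    Measurable fun x : Idx K B → Matrix (Fin (N * K)) (Fin N) ℂ => quantizedWith k i x :=
  measurable_pi_iff.2 fun l => by
    by_cases hl : l = k
    · subst hl
      simp only [quantizedWith, Function.update_self]
      exact measurable_pi_apply _
    · simp only [quantizedWith, Function.update_of_ne hl]
      exact measurable_quantizedOf l

theorem IsRVQSystem.ae_isUnit_gramSum_quantizedWith (hsys : IsRVQSystem P H C) (k : Fin K) :
    ∀ᵐ ω ∂P, ∀ i, IsUnit (∑ j, quantizedWith k i (allMat H C ω) j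
      * (quantizedWith k i (allMat H C ω) j)ᴴ).det := by
  filter_upwards [hsys.ae_det_gramSum_ne_zero] with ω h i
  have h1 : ∀ j, quantizedWith k i (allMat H C ω) j = C j (Function.update
      (fun j => argminIdx fun i => chordalSq (H j ω) (C j i ω)) k i j) ω := fun j => by
    by_cases hj : j = k
    · subst hj
      simp only [quantizedWith, Function.update_self]
      rfl
    · simp only [quantizedWith, Function.update_of_ne hj]
      rfl
  simp only [h1]
  exact isUnit_iff_ne_zero.2 (h _)

theorem IsRVQSystem.quantizedWith_semiunitary (hsys : IsRVQSystem P H C) (k : Fin K)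
    (i : Fin (2 ^ B)) (ω : Ω) (j : Fin K) :
    (quantizedWith k i (allMat H C ω) j)ᴴ * quantizedWith k i (allMat H C ω) j = 1 := by
  by_cases hj : j = k
  · subst hj
    simp only [quantizedWith, Function.update_self]
    exact hsys.codeword_semiunitary _ _ _
  · simp only [quantizedWith, Function.update_of_ne hj]
    exact hsys.quantizedOf_semiunitary j ω

theorem det_conj_outer {V h : Matrix (Fin (N * K)) (Fin N) ℂ} :
    (hᴴ * (V * Vᴴ) * h).det.re = ‖(Vᴴ * h).det‖ ^ 2 := by
  have h1 : hᴴ * (V * Vᴴ) * h = (Vᴴ * h)ᴴ * (Vᴴ * h) := by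
    rw [conjTranspose_mul, conjTranspose_conjTranspose]
    simp only [Matrix.mul_assoc]
  rw [h1, det_mul, det_conjTranspose, RCLike.star_def, Complex.conj_mul', ← Complex.ofReal_pow,
    Complex.ofReal_re]

/-- Given everything but `H_k`, the precoder is a fixed `V Vᴴ` and the square root of the
determinant is `|det(Vᴴ H_k)|`. The Gaussian bound does not see `V`, hence is uniform in `ρ`. -/
theorem lintegral_inv_sqrt_det_le (hsys : IsRVQSystem P H C) (hpre : IsFullRankPrecoder pre) :
    ∃ A : ℝ≥0∞, A ≠ ∞ ∧ ∀ ρ > 0, ∀ k j i,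
      ∫⁻ ω, (ENNReal.ofReal √((H k ω)ᴴ * pre ρ (quantizedWith k i (allMat H C ω)) j
        * H k ω).det.re)⁻¹ ∂P ≤ A := by
  obtain ⟨A, hA, h⟩ := exists_lintegral_inv_det_le (Fin (N * K)) (Fin N)
  refine ⟨A, hA, fun ρ hρ k j i => ?_⟩
  let F : (Idx K B → Matrix (Fin (N * K)) (Fin N) ℂ) → ℝ≥0∞ := fun x =>
    (ENNReal.ofReal √((x (Sum.inl k))ᴴ * pre ρ (quantizedWith k i x) j
      * x (Sum.inl k)).det.re)⁻¹
  have hF : Measurable F := by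
    have h1 : Measurable fun x : Idx K B → Matrix (Fin (N * K)) (Fin N) ℂ =>
        ((x (Sum.inl k))ᴴ * pre ρ (quantizedWith k i x) j * x (Sum.inl k)).det :=
      ((((measurable_pi_apply (Sum.inl k)).matrix_conjTranspose.matrix_mul
        ((hpre.measurable ρ j).comp (measurable_quantizedWith k i)))).matrix_mul
          (measurable_pi_apply (Sum.inl k))).matrix_det
    exact (ENNReal.measurable_ofReal.comp (Complex.measurable_re.comp h1).sqrt).inv
  refine (lintegral_mix (fun s => s ≠ Sum.inl k) hsys.measurable_allMat hsys.iIndepFun_allMat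
    hF).le.trans ?_
  have hle : ∀ᵐ ω' ∂P, ∫⁻ ω, F (mix (fun s => s ≠ Sum.inl k) (allMat H C ω') (allMat H C ω)) ∂P
      ≤ A := by
    filter_upwards [hsys.ae_isUnit_gramSum_quantizedWith k] with ω' hω'
    obtain ⟨V, hV, hVe⟩ := hpre.exists_outer ρ hρ _ (hsys.quantizedWith_semiunitary k i ω')
      (hω' i) j
    have h2 := h V hV
    have hm : Measurable fun G : Matrix (Fin (N * K)) (Fin N) ℂ => ‖(Vᴴ * G).det‖ₑ⁻¹ :=
      ((measurable_const.matrix_mul measurable_id).matrix_det).enorm.inv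
    rw [← hsys.map_channel k, lintegral_map hm (hsys.measurable_channel k)] at h2
    refine (lintegral_mono fun ω => le_of_eq ?_).trans h2
    have h3 : mix (fun s => s ≠ Sum.inl k) (allMat H C ω') (allMat H C ω) (Sum.inl k) = H k ω := by
      simp only [mix, ne_eq, not_true_eq_false, if_false]
      rfl
    simp only [F]
    rw [quantizedWith_mix, hVe, h3, det_conj_outer, Real.sqrt_sq (norm_nonneg _), ofReal_norm]
  refine (lintegral_mono_ae hle).trans ?_
  simp

theorem ae_det_gain_pos (hsys : IsRVQSystem P H C) (hpre : IsFullRankPrecoder pre) {ρ : ℝ}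
    (hρ : 0 < ρ) (k j : Fin K) :
    ∀ᵐ ω ∂P, 0 < (gain pre ρ k j (allMat H C ω)).det.re := by
  obtain ⟨A, hA, h⟩ := lintegral_inv_sqrt_det_le hsys hpre
  have h1 : ∀ᵐ ω ∂P, ∀ i, (ENNReal.ofReal √((H k ω)ᴴ * pre ρ (quantizedWith k i (allMat H C ω)) j
        * H k ω).det.re)⁻¹ < ∞ := by
    refine ae_all_iff.2 fun i => ae_lt_top ?_ (ne_top_of_le_ne_top hA (h ρ hρ k j i))
    have h1 : Measurable fun ω =>
        ((H k ω)ᴴ * pre ρ (quantizedWith k i (allMat H C ω)) j * H k ω).det :=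
      (((hsys.measurable_channel k).matrix_conjTranspose.matrix_mul
        ((hpre.measurable ρ j).comp ((measurable_quantizedWith k i).comp
          hsys.measurable_allMat))).matrix_mul (hsys.measurable_channel k)).matrix_det
    exact (ENNReal.measurable_ofReal.comp (Complex.measurable_re.comp h1).sqrt).inv
  filter_upwards [h1] with ω hω
  obtain ⟨i, hi⟩ := exists_quantizedWith_eq k (allMat H C ω)
  have h2 := hω i
  rw [hi, ENNReal.inv_lt_top, ENNReal.ofReal_pos, Real.sqrt_pos] at h2
  exact h2

theorem re_det_real_smul {n : Type*} [Fintype n] [DecidableEq n] (q : ℝ) (A : Matrix n n ℂ) :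
    ((q : ℂ) • A).det.re = q ^ Fintype.card n * A.det.re := by
  rw [det_smul, ← Complex.ofReal_pow, Complex.re_ofReal_mul]

/-- The determinant bound is used with a single interferer `j` as the nonsingular part. Signal,
interference and, for `ρ ≥ 1`, noise are all at most proportional to `ρ`, so the power cancels. -/
theorem sq_instRate_le (hpre : IsProjPrecoder pre) (hN : 1 ≤ N) {ρ : ℝ}
    (hρ : 1 ≤ ρ) {k j : Fin K} (hj : j ≠ k) {ω : Ω}
    (hδ : 0 < (gain pre ρ k j (allMat H C ω)).det.re) :
    instRate pre H C ρ k ω ^ 2 ≤ (8 * N ^ 2 * (K * (N * ((N * K : ℕ) * frobSq (H k ω)))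
      + N * (N * K : ℕ)) + 32 * (√(gain pre ρ k j (allMat H C ω)).det.re)⁻¹) / Real.log 2 ^ 2 := by
  have hK : 0 < K := k.pos
  have hM : (1 : ℝ) ≤ (N * K : ℕ) := by
    exact_mod_cast Nat.one_le_iff_ne_zero.2 (by positivity)
  have hρ0 : 0 < ρ := by linarith
  have hM0 : (0 : ℝ) < (N * K : ℕ) := by linarith
  have hN1 : (1 : ℝ) ≤ N := by exact_mod_cast hN
  have hf := frobSq_nonneg (H k ω)
  have hX := hpre.posSemidef_rxCov (H := H) (C := C) hρ0.le k k ω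
  have hY := hpre.posDef_intCov (H := H) (C := C) hρ0.le k ω
  have hW := hpre.posSemidef_rxCov (H := H) (C := C) hρ0.le k j ω
  have hmem : j ∈ Finset.univ.erase k := Finset.mem_erase.2 ⟨hj, Finset.mem_univ j⟩
  have hZ : ((∑ l ∈ (Finset.univ.erase k).erase j, rxCov pre H C ρ k l ω) + 1).PosSemidef :=
    (posSemidef_sum _ fun l _ => hpre.posSemidef_rxCov hρ0.le k l ω).add PosSemidef.one
  have hsplit : intCov pre H C ρ k ω
      = (∑ l ∈ (Finset.univ.erase k).erase j, rxCov pre H C ρ k l ω) + 1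
        + rxCov pre H C ρ k j ω := by
    rw [intCov, ← Finset.sum_erase_add _ _ hmem]
    abel
  have hkey := re_det_one_add_mul_inv_le hX hZ hW (by rw [← hsplit]; exact hY)
  rw [← hsplit] at hkey
  have htr : (rxCov pre H C ρ k k ω + intCov pre H C ρ k ω).trace.re
      ≤ ρ / (N * K : ℕ) * (K * (N * ((N * K : ℕ) * frobSq (H k ω))) + N * (N * K : ℕ)) := by
    have h1 : rxCov pre H C ρ k k ω + intCov pre H C ρ k ω = (∑ l, rxCov pre H C ρ k l ω) + 1 := by
      rw [intCov, ← Finset.sum_erase_add _ _ (Finset.mem_univ k)]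
      abel
    have h2 : ∀ l, (rxCov pre H C ρ k l ω).trace.re
        ≤ ρ / (N * K : ℕ) * (N * ((N * K : ℕ) * frobSq (H k ω))) := fun l => by
      rw [rxCov_eq, trace_smul, smul_eq_mul, Complex.re_ofReal_mul]
      gcongr
      exact (Complex.re_le_norm _).trans (hpre.norm_trace_gain_le ρ k l (allMat H C ω))
    rw [h1, trace_add, trace_sum, trace_one, Complex.add_re, Complex.re_sum, Fintype.card_fin,
      Complex.natCast_re, mul_add]
    refine add_le_add ((Finset.sum_le_sum fun l _ => h2 l).trans (le_of_eq ?_)) ?_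
    · rw [Finset.sum_const, Finset.card_univ, Fintype.card_fin, nsmul_eq_mul]
      ring
    · have : ρ / (N * K : ℕ) * (N * (N * K : ℕ)) = ρ * N := by field_simp
      rw [this]
      nlinarith
  have htr0 : 0 ≤ (rxCov pre H C ρ k k ω + intCov pre H C ρ k ω).trace.re :=
    (Complex.nonneg_iff.1 (hX.add hY.posSemidef).trace_nonneg).1
  have h1 : (1 + rxCov pre H C ρ k k ω * (intCov pre H C ρ k ω)⁻¹).det.re
      * (gain pre ρ k j (allMat H C ω)).det.re
      ≤ (K * (N * ((N * K : ℕ) * frobSq (H k ω))) + N * (N * K : ℕ)) ^ N := by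
    -- The common factor `(ρ / M)^N` of the interference determinant and of the trace bound.
    have hq : 0 < (ρ / (N * K : ℕ)) ^ N := by positivity
    have h2 := hkey.trans (pow_le_pow_left₀ htr0 htr _)
    rw [rxCov_eq ρ k j, re_det_real_smul, Fintype.card_fin, mul_pow, mul_left_comm] at h2
    exact le_of_mul_le_mul_left h2 hq
  have ha : 1 ≤ K * (N * ((N * K : ℕ) * frobSq (H k ω))) + N * ((N * K : ℕ) : ℝ) := by
    have h2 : 1 ≤ N * ((N * K : ℕ) : ℝ) := one_le_mul_of_one_le_of_one_le hN1 hM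
    have h3 : 0 ≤ K * (N * (((N * K : ℕ) : ℝ) * frobSq (H k ω))) := by positivity
    linarith
  have h2 := sq_log_le (one_le_re_det_one_add_mul_inv hX hY) hδ ha h1
  rw [instRate, logDet, Real.logb, div_pow]
  exact div_le_div_of_nonneg_right h2 (sq_nonneg _)

end HighSNR

end LimitedFeedback

namespace LimitedFeedback

open scoped ENNReal NNReal ComplexOrder

set_option linter.unusedSectionVars false

/-! ### Limits at infinite SNR. -/

section HighSNRLimit

variable {N K B : ℕ} {Ω : Type*} [MeasurableSpace Ω] {P : Measure Ω} [IsProbabilityMeasure P]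
  {H : Fin K → Ω → Matrix (Fin (N * K)) (Fin N) ℂ}
  {C : Fin K → Fin (2 ^ B) → Ω → Matrix (Fin (N * K)) (Fin N) ℂ}
  {pre : ℝ → (Fin K → Matrix (Fin (N * K)) (Fin N) ℂ) → Fin K →
      Matrix (Fin (N * K)) (Fin (N * K)) ℂ}

/-- The inverse determinant for the selected codeword is dominated by the sum over all `2 ^ B`
prescribed codewords, each of bounded mean. -/
theorem exists_lintegral_sq_instRate_le (hsys : IsRVQSystem P H C) (hpre : IsFullRankPrecoder pre)
    (hN : 1 ≤ N) (hK : 2 ≤ K) (k : Fin K) :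
    ∃ A : ℝ≥0∞, A ≠ ∞ ∧ ∀ ρ ≥ 1, ∫⁻ ω, ‖instRate pre H C ρ k ω‖ₑ ^ 2 ∂P ≤ A := by
  obtain ⟨j, hj⟩ := Fintype.exists_ne_of_one_lt_card (by rw [Fintype.card_fin]; omega) k
  obtain ⟨A, hA, hle⟩ := lintegral_inv_sqrt_det_le hsys hpre
  set a : Ω → ℝ := fun ω => 8 * N ^ 2 * (K * (N * ((N * K : ℕ) * frobSq (H k ω)))
      + N * (N * K : ℕ)) / Real.log 2 ^ 2 with ha
  have hai : Integrable a P :=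
    ((((((hsys.integrable_frobSq_channel k).1.const_mul _).const_mul _).const_mul _).add
      (integrable_const _)).const_mul _).div_const _
  refine ⟨∫⁻ ω, ENNReal.ofReal (a ω) ∂P
    + ENNReal.ofReal (32 / Real.log 2 ^ 2) * ((2 ^ B : ℕ) * A),
    ENNReal.add_ne_top.2 ⟨hai.lintegral_lt_top.ne, ENNReal.mul_ne_top ENNReal.ofReal_ne_top
      (ENNReal.mul_ne_top (ENNReal.natCast_ne_top _) hA)⟩, fun ρ hρ => ?_⟩
  have hρ0 : 0 < ρ := by linarith
  set D : Fin (2 ^ B) → Ω → ℝ≥0∞ := fun i ω =>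
    (ENNReal.ofReal √((H k ω)ᴴ * pre ρ (quantizedWith k i (allMat H C ω)) j * H k ω).det.re)⁻¹
  have hDm : ∀ i, Measurable (D i) := fun i => by
    have h1 : Measurable fun ω =>
        ((H k ω)ᴴ * pre ρ (quantizedWith k i (allMat H C ω)) j * H k ω).det :=
      (((hsys.measurable_channel k).matrix_conjTranspose.matrix_mul
        ((hpre.measurable ρ j).comp ((measurable_quantizedWith k i).comp
          hsys.measurable_allMat))).matrix_mul (hsys.measurable_channel k)).matrix_det
    exact (ENNReal.measurable_ofReal.comp (Complex.measurable_re.comp h1).sqrt).inv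
  have hpt : ∀ᵐ ω ∂P, ‖instRate pre H C ρ k ω‖ₑ ^ 2
      ≤ ENNReal.ofReal (a ω) + ENNReal.ofReal (32 / Real.log 2 ^ 2) * ∑ i, D i ω := by
    filter_upwards [ae_det_gain_pos hsys hpre hρ0 k j] with ω hω
    obtain ⟨i, hi⟩ := exists_quantizedWith_eq k (allMat H C ω)
    have hDi : D i ω = (ENNReal.ofReal √(gain pre ρ k j (allMat H C ω)).det.re)⁻¹ := by
      simp only [D, hi]
      rfl
    have h1 := sq_instRate_le hpre.toIsProjPrecoder hN hρ hj hω
    have h2 : ‖instRate pre H C ρ k ω‖ₑ ^ 2 = ENNReal.ofReal (instRate pre H C ρ k ω ^ 2) := by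
      rw [Real.enorm_eq_ofReal_abs, ← ENNReal.ofReal_pow (abs_nonneg _), sq_abs]
    have h3 : D i ω ≤ ∑ i, D i ω :=
      Finset.single_le_sum (f := fun i => D i ω) (fun _ _ => zero_le) (Finset.mem_univ i)
    rw [h2]
    refine (ENNReal.ofReal_le_ofReal h1).trans ?_
    rw [add_div, mul_div_right_comm 32]
    refine ENNReal.ofReal_add_le.trans (add_le_add le_rfl ?_)
    rw [ENNReal.ofReal_mul (by positivity), ENNReal.ofReal_inv_of_pos (Real.sqrt_pos.2 hω), ← hDi]
    exact mul_le_mul_right h3 _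
  refine (lintegral_mono_ae hpt).trans ?_
  rw [lintegral_add_right _ ((Finset.measurable_sum _ fun i _ => hDm i).const_mul _),
    lintegral_const_mul _ (Finset.measurable_sum _ fun i _ => hDm i),
    lintegral_finsetSum _ fun i _ => hDm i]
  gcongr
  refine (Finset.sum_le_sum fun i _ => hle ρ hρ0 k j i).trans (le_of_eq ?_)
  rw [Finset.sum_const, Finset.card_univ, Fintype.card_fin, nsmul_eq_mul]

theorem tendsto_mmse_atTop (hNK : N * K ≠ 0) {c : Fin K → Matrix (Fin (N * K)) (Fin N) ℂ}
    (hS : IsUnit (∑ j, c j * (c j)ᴴ).det) (k : Fin K) :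
    Tendsto (fun ρ => mmse ρ c k) atTop (𝓝 (bd 0 c k)) := by
  have h0 : Tendsto (fun ρ : ℝ => ((ρ⁻¹ : ℝ) : ℂ)) atTop (𝓝 ((0 : ℝ) : ℂ)) :=
    (Complex.continuous_ofReal.tendsto 0).comp tendsto_inv_atTop_zero
  have h1 : Tendsto (fun ρ : ℝ => (∑ j, c j * (c j)ᴴ) + ((ρ⁻¹ : ℝ) : ℂ) •
      (1 : Matrix (Fin (N * K)) (Fin (N * K)) ℂ)) atTop (𝓝 (∑ j, c j * (c j)ᴴ)) := by
    have h : Tendsto (fun ρ : ℝ => (∑ j, c j * (c j)ᴴ) + ((ρ⁻¹ : ℝ) : ℂ) •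
      (1 : Matrix (Fin (N * K)) (Fin (N * K)) ℂ)) atTop
        (𝓝 ((∑ j, c j * (c j)ᴴ) + ((0 : ℝ) : ℂ) • 1)) :=
      tendsto_const_nhds.add (h0.smul_const 1)
    simpa using h
  rw [bd_eq_colProj 0 hS]
  refine (tendsto_colProj (tendsto_matrix_mul (tendsto_inv_of_isUnit h1 hS) tendsto_const_nhds)
    (isUnit_gram_zeroForcing hS k)).congr' ?_
  filter_upwards [eventually_gt_atTop 0] with ρ hρ
  exact (mmse_eq_colProj_inv hρ hNK c k).symm

/-- The rate of one realization at infinite power. -/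
noncomputable def satRate (H : Fin K → Ω → Matrix (Fin (N * K)) (Fin N) ℂ)
    (C : Fin K → Fin (2 ^ B) → Ω → Matrix (Fin (N * K)) (Fin N) ℂ) (k : Fin K) (ω : Ω) : ℝ :=
  logDet (gain bd 0 k k (allMat H C ω))
    (∑ j ∈ Finset.univ.erase k, gain bd 0 k j (allMat H C ω))

/-- Dividing signal and interference by `ρ / M` leaves a noise term `M / ρ`, so the limit `ρ → ∞`
can be taken inside. -/
theorem instRate_eq_logDet (hpre : IsProjPrecoder pre) (hNK : N * K ≠ 0) {ρ : ℝ} (hρ : 0 < ρ)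
    (k : Fin K) (ω : Ω) :
    instRate pre H C ρ k ω = logDet (gain pre ρ k k (allMat H C ω))
      ((∑ j ∈ Finset.univ.erase k, gain pre ρ k j (allMat H C ω))
        + ((((N * K : ℕ) : ℝ) / ρ : ℝ) : ℂ) • 1) := by
  have hM : (0 : ℝ) < (N * K : ℕ) := by exact_mod_cast Nat.pos_of_ne_zero hNK
  have hq : ((ρ / (N * K : ℕ) : ℝ) : ℂ) ≠ 0 := Complex.ofReal_ne_zero.2 (by positivity)
  set D := (∑ j ∈ Finset.univ.erase k, gain pre ρ k j (allMat H C ω))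
        + ((((N * K : ℕ) : ℝ) / ρ : ℝ) : ℂ) • (1 : Matrix (Fin N) (Fin N) ℂ) with hD
  have h1 : intCov pre H C ρ k ω = ((ρ / (N * K : ℕ) : ℝ) : ℂ) • D := by
    have h2 : ρ / ((N * K : ℕ) : ℝ) * (((N * K : ℕ) : ℝ) / ρ) = 1 := by field_simp
    rw [intCov, hD, smul_add, smul_smul, ← Complex.ofReal_mul, h2, Complex.ofReal_one, one_smul,
      Finset.smul_sum]
    rfl
  have hu : IsUnit D.det := by
    have h2 : D.PosDef := PosDef.posSemidef_add
      (posSemidef_sum _ fun j _ => hpre.posSemidef_gain ρ k j _)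
      (PosDef.one.smul (Complex.zero_lt_real.2 (by positivity)))
    exact h2.isUnit.map detMonoidHom
  rw [instRate, logDet, logDet, h1, inv_smul_of_ne_zero hq hu, rxCov_eq, Matrix.smul_mul,
    Matrix.mul_smul, smul_smul, mul_inv_cancel₀ hq, one_smul]

theorem tendsto_instRate_atTop (hpre : IsProjPrecoder pre) (hNK : N * K ≠ 0) {k : Fin K} {ω : Ω}
    (hlim : ∀ j, Tendsto (fun ρ => pre ρ (quantizedOf (allMat H C ω)) j) atTop
      (𝓝 (bd 0 (quantizedOf (allMat H C ω)) j)))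
    (hD : (∑ j ∈ Finset.univ.erase k, gain bd 0 k j (allMat H C ω)).PosDef) :
    Tendsto (fun ρ => instRate pre H C ρ k ω) atTop (𝓝 (satRate H C k ω)) := by
  have hg : ∀ j, Tendsto (fun ρ => gain pre ρ k j (allMat H C ω)) atTop
      (𝓝 (gain bd 0 k j (allMat H C ω))) := fun j =>
    tendsto_matrix_mul (tendsto_matrix_mul tendsto_const_nhds (hlim j)) tendsto_const_nhds
  have h0 : Tendsto (fun ρ : ℝ => ((((N * K : ℕ) : ℝ) / ρ : ℝ) : ℂ)) atTop (𝓝 ((0 : ℝ) : ℂ)) :=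
    (Complex.continuous_ofReal.tendsto 0).comp (tendsto_const_nhds.div_atTop tendsto_id)
  have hY : Tendsto (fun ρ : ℝ => (∑ j ∈ Finset.univ.erase k, gain pre ρ k j (allMat H C ω))
      + ((((N * K : ℕ) : ℝ) / ρ : ℝ) : ℂ) • (1 : Matrix (Fin N) (Fin N) ℂ)) atTop
      (𝓝 (∑ j ∈ Finset.univ.erase k, gain bd 0 k j (allMat H C ω))) := by
    have h : Tendsto (fun ρ : ℝ => (∑ j ∈ Finset.univ.erase k, gain pre ρ k j (allMat H C ω))
      + ((((N * K : ℕ) : ℝ) / ρ : ℝ) : ℂ) • (1 : Matrix (Fin N) (Fin N) ℂ)) atTop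
      (𝓝 ((∑ j ∈ Finset.univ.erase k, gain bd 0 k j (allMat H C ω)) + ((0 : ℝ) : ℂ) • 1)) :=
      (tendsto_finsetSum _ fun j _ => hg j).add (h0.smul_const 1)
    simpa using h
  have hdet := (Complex.continuous_re.tendsto _).comp (tendsto_det
    ((tendsto_const_nhds (x := (1 : Matrix (Fin N) (Fin N) ℂ))).add (tendsto_matrix_mul (hg k)
      (tendsto_inv_of_isUnit hY (hD.isUnit.map detMonoidHom)))))
  have hne : (1 + gain bd 0 k k (allMat H C ω) *
      (∑ j ∈ Finset.univ.erase k, gain bd 0 k j (allMat H C ω))⁻¹).det.re ≠ 0 :=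
    (zero_lt_one.trans_le
      (one_le_re_det_one_add_mul_inv (isProjPrecoder_bd.posSemidef_gain 0 k k _) hD)).ne'
  refine ((hdet.log hne).div_const (Real.log 2)).congr' ?_
  filter_upwards [eventually_gt_atTop 0] with ρ hρ
  rw [instRate_eq_logDet hpre hNK hρ]
  rfl

/-- One interferer, available as `K ≥ 2`, already has a nonsingular covariance. Hence the noiseless
rate is finite and continuity of the inverse applies. -/
theorem ae_posDef_interference_bd (hsys : IsRVQSystem P H C) (hK : 2 ≤ K) (k : Fin K) :
    ∀ᵐ ω ∂P, (∑ j ∈ Finset.univ.erase k, gain bd 0 k j (allMat H C ω)).PosDef := by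
  obtain ⟨j, hj⟩ := Fintype.exists_ne_of_one_lt_card (by rw [Fintype.card_fin]; omega) k
  filter_upwards [ae_det_gain_pos hsys isFullRankPrecoder_bd one_pos k j] with ω hω
  have hps : ∀ l, (gain bd 0 k l (allMat H C ω)).PosSemidef := fun l =>
    isProjPrecoder_bd.posSemidef_gain 0 k l _
  rw [(posSemidef_sum _ fun l _ => hps l).posDef_iff_det_ne_zero,
    ← Finset.sum_erase_add _ _ (Finset.mem_erase.2 ⟨hj, Finset.mem_univ j⟩)]
  have h := re_det_mono (hps j)
    (posSemidef_sum ((Finset.univ.erase k).erase j) fun l _ => hps l)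
  intro h0
  rw [h0, Complex.zero_re] at h
  exact absurd hω (not_lt.2 h)

theorem tendsto_rate_atTop (hsys : IsRVQSystem P H C) (hpre : IsFullRankPrecoder pre)
    (hN : 1 ≤ N) (hK : 2 ≤ K) (k : Fin K)
    (hlim : ∀ᵐ ω ∂P, ∀ j, Tendsto (fun ρ => pre ρ (quantizedOf (allMat H C ω)) j) atTop
      (𝓝 (bd 0 (quantizedOf (allMat H C ω)) j))) :
    Tendsto (fun ρ => rate P pre H C ρ k) atTop (𝓝 (∫ ω, satRate H C k ω ∂P)) := by
  have hNK : N * K ≠ 0 := by positivity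
  obtain ⟨A, hA, hle⟩ := exists_lintegral_sq_instRate_le hsys hpre hN hK k
  refine tendsto_of_seq_tendsto fun u hu => ?_
  have h1 := tendsto_integral_of_lintegral_sq_le (P := P)
    -- Truncating the power below at `1` makes the second moment bound valid for every `n` without
    -- changing the limit.
    (f := fun n => instRate pre H C (max (u n) 1) k) (g := satRate H C k)
    (fun n => hpre.measurable_instRate hsys _ k) hA (fun n => hle _ (le_max_right _ _)) (by
      filter_upwards [hlim, ae_posDef_interference_bd hsys hK k] with ω h2 h3
      exact (tendsto_instRate_atTop hpre.toIsProjPrecoder hNK h2 h3).comp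
        (tendsto_atTop_mono (fun n => le_max_left _ _) hu))
  refine h1.congr' ?_
  filter_upwards [hu.eventually_ge_atTop 1] with n hn
  simp only [max_eq_left hn, Function.comp_apply]
  rfl

theorem ae_tendsto_mmse_atTop (hsys : IsRVQSystem P H C) (hNK : N * K ≠ 0) :
    ∀ᵐ ω ∂P, ∀ j, Tendsto (fun ρ => mmse ρ (quantizedOf (allMat H C ω)) j) atTop
      (𝓝 (bd 0 (quantizedOf (allMat H C ω)) j)) := by
  filter_upwards [hsys.ae_isUnit_gramSum] with ω hω j
  exact tendsto_mmse_atTop hNK hω j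

theorem tendsto_meanGain_mmse_atTop (hsys : IsRVQSystem P H C) (hNK : N * K ≠ 0) (k j : Fin K) :
    Tendsto (fun ρ => meanGain P mmse H C ρ k j) atTop (𝓝 (meanGain P bd H C 0 k j)) := by
  refine (tendsto_integral_filter_of_dominated_convergence
    (fun ω => N * (((N * K : ℕ) : ℝ) * frobSq (H k ω)))
    (Eventually.of_forall fun ρ => (Complex.measurable_re.comp
      ((isProjPrecoder_mmse.measurable_gain ρ k j).comp
        hsys.measurable_allMat).matrix_trace).aestronglyMeasurable)
    (Eventually.of_forall fun ρ => ae_of_all _ fun ω => (Complex.abs_re_le_norm _).trans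
      (isProjPrecoder_mmse.norm_trace_gain_le ρ k j (allMat H C ω)))
    (((hsys.integrable_frobSq_channel k).1.const_mul _).const_mul _) ?_).div_const _
  filter_upwards [ae_tendsto_mmse_atTop hsys hNK] with ω hω
  exact (Complex.continuous_re.tendsto _).comp (tendsto_trace
    (tendsto_matrix_mul (tendsto_matrix_mul tendsto_const_nhds (hω j)) tendsto_const_nhds))

theorem tendsto_logb_sinr_atTop {M t₀ s₀ : ℝ} {t s : ℝ → ℝ} (hM : 0 < M) (ht₀ : 0 ≤ t₀)
    (hs₀ : 0 < s₀) (ht : Tendsto t atTop (𝓝 t₀)) (hs : Tendsto s atTop (𝓝 s₀)) :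
    Tendsto (fun ρ => Real.logb 2 (1 + ρ / M * t ρ / (1 + ρ / M * s ρ))) atTop
      (𝓝 (Real.logb 2 (1 + t₀ / s₀))) := by
  have h0 : Tendsto (fun ρ : ℝ => M / ρ) atTop (𝓝 0) := tendsto_const_nhds.div_atTop tendsto_id
  have h1 : Tendsto (fun ρ => t ρ / (M / ρ + s ρ)) atTop (𝓝 (t₀ / (0 + s₀))) :=
    ht.div (h0.add hs) (by simpa using hs₀.ne')
  rw [zero_add] at h1
  have h2 := ((h1.const_add 1).log (by positivity)).div_const (Real.log 2)
  refine h2.congr' ?_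
  filter_upwards [eventually_gt_atTop 0] with ρ hρ
  have h3 : ρ / M * t ρ / (1 + ρ / M * s ρ) = t ρ / (M / ρ + s ρ) := by
    have h4 : 1 + ρ / M * s ρ = ρ / M * (M / ρ + s ρ) := by field_simp
    rw [h4, mul_div_mul_left _ _ (by positivity)]
  rw [h3, Real.logb]

theorem tendsto_rateOfMeans_mmse_atTop (hsys : IsRVQSystem P H C) (hN : 1 ≤ N) (hK : 2 ≤ K)
    (k : Fin K) :
    Tendsto (fun ρ => rateOfMeans P mmse H C ρ k) atTop
      (𝓝 (N * Real.logb 2 (1 + 1 / (K * distortion P H C k)))) := by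
  have hNK : N * K ≠ 0 := by positivity
  have hM : (0 : ℝ) < (N * K : ℕ) := by exact_mod_cast Nat.pos_of_ne_zero hNK
  have hγ := hsys.distortion_pos hN hK k
  have hN' : (0 : ℝ) < N := by exact_mod_cast hN
  have ht := tendsto_meanGain_mmse_atTop hsys hNK k k
  have hs := tendsto_finsetSum (Finset.univ.erase k) fun j _ =>
    tendsto_meanGain_mmse_atTop hsys hNK k j
  rw [hsys.meanGain_bd_self hN hNK] at ht
  rw [hsys.sum_meanGain_bd hN hK] at hs
  have h := (tendsto_logb_sinr_atTop hM hN'.le (mul_pos hγ hM) ht hs).const_mul (N : ℝ)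
  have hv : (N : ℝ) / (distortion P H C k * (N * K : ℕ)) = 1 / (K * distortion P H C k) := by
    push_cast
    field_simp
  rw [hv] at h
  refine h.congr' ?_
  filter_upwards [eventually_gt_atTop 0] with ρ hρ
  rw [hsys.rateOfMeans_eq isProjPrecoder_mmse hN hρ]

theorem tendsto_rHigh_atTop (hK : 2 ≤ K) {γ : ℝ} (hγ : 0 < γ) :
    Tendsto (rHigh N K γ) atTop (𝓝 (N * Real.logb 2 (1 + 1 / (K * γ)))) := by
  have hK' : (0 : ℝ) < K := by exact_mod_cast (by omega : 0 < K)
  have h := (tendsto_logb_sinr_atTop (t := fun _ => 1) (s := fun _ => K * γ) hK' zero_le_one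
    (mul_pos hK' hγ) tendsto_const_nhds tendsto_const_nhds).const_mul (N : ℝ)
  refine h.congr' ?_
  filter_upwards [eventually_gt_atTop 0] with ρ hρ
  rw [rHigh]
  congr 3
  field_simp

end HighSNRLimit

end LimitedFeedback

/-! ### The main theorem. -/

theorem theorem1 {Ω : Type*} [MeasurableSpace Ω] (P : Measure Ω) [IsProbabilityMeasure P]
    (N K B : ℕ) (hN : 1 ≤ N) (hK : 2 ≤ K)
    (H : Fin K → Ω → Matrix (Fin (N * K)) (Fin N) ℂ)
    (C : Fin K → Fin (2 ^ B) → Ω → Matrix (Fin (N * K)) (Fin N) ℂ)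
    (hsys : LimitedFeedback.IsRVQSystem P H C) :
    ∃ γ : ℝ, 0 < γ ∧ γ < 1 ∧ (∀ k, LimitedFeedback.distortion P H C k = γ) ∧
      ∀ k : Fin K,
        -- the rate is a genuine expectation
        (∀ ρ : ℝ, 0 < ρ →
          Integrable (fun ω => LimitedFeedback.instRate LimitedFeedback.mmse H C ρ k ω) P) ∧
        -- low SNR: the achievable rate, and its log-det-of-expectations approximation
        (fun ρ => LimitedFeedback.rate P LimitedFeedback.mmse H C ρ k)
          ~[𝓝[>] (0 : ℝ)] LimitedFeedback.rLow N K γ ∧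
        (fun ρ => LimitedFeedback.rateOfMeans P LimitedFeedback.mmse H C ρ k
            - LimitedFeedback.rLow N K γ ρ) =o[𝓝[>] (0 : ℝ)] (fun ρ : ℝ => ρ ^ 2) ∧
        (∀ ρ : ℝ, 0 < ρ →
          LimitedFeedback.rateOfMeans P LimitedFeedback.mrt H C ρ k
            = LimitedFeedback.rLow N K γ ρ) ∧
        -- high SNR: the achievable rate saturates at that of block diagonalization
        (∃ L : ℝ,
          Tendsto (fun ρ => LimitedFeedback.rate P LimitedFeedback.mmse H C ρ k)
            atTop (𝓝 L) ∧
          Tendsto (fun ρ => LimitedFeedback.rate P LimitedFeedback.bd H C ρ k)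
            atTop (𝓝 L)) ∧
        -- high SNR: log-det-of-expectations approximation
        Tendsto (fun ρ => LimitedFeedback.rateOfMeans P LimitedFeedback.mmse H C ρ k
            - LimitedFeedback.rHigh N K γ ρ) atTop (𝓝 0) ∧
        (∀ ρ : ℝ, 0 < ρ →
          LimitedFeedback.rateOfMeans P LimitedFeedback.bd H C ρ k
            = LimitedFeedback.rHigh N K γ ρ) ∧
        Tendsto (LimitedFeedback.rHigh N K γ) atTop
          (𝓝 (N * Real.logb 2 (1 + 1 / (K * γ)))) := by
  have hK0 : 0 < K := by omega
  have hNK : N * K ≠ 0 := by positivity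
  have hγ : ∀ k, LimitedFeedback.distortion P H C k
      = LimitedFeedback.distortion P H C ⟨0, hK0⟩ := fun k => hsys.distortion_eq hN k _
  refine ⟨LimitedFeedback.distortion P H C ⟨0, hK0⟩, hsys.distortion_pos hN hK _,
    hsys.distortion_lt_one hN _, hγ, fun k => ?_⟩
  rw [← hγ k]
  have hsat := LimitedFeedback.tendsto_rHigh_atTop (N := N) hK (hsys.distortion_pos hN hK k)
  refine ⟨fun ρ hρ => LimitedFeedback.isProjPrecoder_mmse.integrable_instRate hsys hρ.le k,
    LimitedFeedback.rate_mmse_isEquivalent_rLow hsys hN hK k,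
    LimitedFeedback.rateOfMeans_mmse_sub_rLow_isLittleO hsys hN hK k,
    fun ρ hρ => hsys.rateOfMeans_mrt hN hK hρ k,
    ⟨∫ ω, LimitedFeedback.satRate H C k ω ∂P, ?_, ?_⟩, ?_,
    fun ρ hρ => hsys.rateOfMeans_bd hN hK hρ k, hsat⟩
  · exact LimitedFeedback.tendsto_rate_atTop hsys (LimitedFeedback.isFullRankPrecoder_mmse hNK)
      hN hK k (LimitedFeedback.ae_tendsto_mmse_atTop hsys hNK)
  · exact LimitedFeedback.tendsto_rate_atTop hsys LimitedFeedback.isFullRankPrecoder_bd hN hK k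
      (ae_of_all _ fun ω j => tendsto_const_nhds)
  · simpa using (LimitedFeedback.tendsto_rateOfMeans_mmse_atTop hsys hN hK k).sub hsat
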